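/- For $\varepsilon>0$ let $\rho_\varepsilon(x)=(2\pi\varepsilon)^{-1/2}e^{-x^2/(2\varepsilon)}$, so that $\rho_\varepsilon'(x)=\frac{i}{2\pi}\int_{\mathbb R}p\,e^{ipx}e^{-\varepsilon p^2/2}\,dp$. For real-valued processes $X,Y$ with continuous paths and a bounded Borel set $A$ of pairs $(s,t)$ of nonnegative times, $\int_A\delta'(X_t-Y_s)\,ds\,dt$ denotes the limit of $\int_A\rho_\varepsilon'(X_t-Y_s)\,ds\,dt$ as $\varepsilon\downarrow0$, almost surely and in $L^p$ for all $0<p<\infty$, when this limit exists. Let $B$ be a standard real Brownian motion and let $B^1,B^2$ be independent standard real Brownian motions, possibly on another probability space. For $n\ge1$ and $1\le k\le2^{n-1}$ put $$A_k^n=\big[2(k-1)2^{-n},(2k-1)2^{-n}\big)\times\big((2k-1)2^{-n},2k\,2^{-n}\big],\qquad \hat L_{n,k}=\int_{A_k^n}\delta'(B_t-B_s)\,ds\,dt,$$ and let $L=\int_0^1\int_0^1\delta'(B^1_t-B^2_s)\,ds\,dt$ (the derivative of intersection local time, DILT) and $\hat L=\int_0^1\int_0^t\delta'(B_t-B_s)\,ds\,dt$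 (the derivative of self-intersection local time, DSLT). Then the limits defining $L$, $\hat L$ and all the $\hat L_{n,k}$ exist, almost surely and in $L^p$ for all $0<p<\infty$, and: 1. For each fixed $n\ge1$, the random variables $\hat L_{n,k}$, $1\le k\le2^{n-1}$, are mutually independent. 2. For all $n\ge1$ and $1\le k\le2^{n-1}$, $\hat L_{n,k}\overset{d}{=}2^{-n}L$. 3. $\hat L=\sum_{n=1}^\infty\sum_{k=1}^{2^{n-1}}\hat L_{n,k}$, where the partial sums over $1\le n\le N$ converge to $\hat L$ as $N\to\infty$, almost surely and in $L^p$ for every $0<p<\infty$. -/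

import Mathlib

open MeasureTheory ProbabilityTheory Filter Topology
open scoped NNReal ENNReal

namespace LeGallScheme

/-- The Gaussian heat kernel `ρ_ε(x) = (2πε)^{-1/2} exp(-x² / (2ε))`. -/
noncomputable def heatKernel (ε x : ℝ) : ℝ :=
  (Real.sqrt (2 * Real.pi * ε))⁻¹ * Real.exp (-x ^ 2 / (2 * ε))

/-- The approximation `ρ_ε'` of `δ'`. -/
noncomputable def heatKernelDeriv (ε : ℝ) : ℝ → ℝ :=
  deriv (heatKernel ε)

theorem heatKernelDeriv_eq (ε x : ℝ) :
    heatKernelDeriv ε x = -(x / ε) * heatKernel ε x := by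
  have h : HasDerivAt (heatKernel ε)
      ((Real.sqrt (2 * Real.pi * ε))⁻¹ *
        (Real.exp (-x ^ 2 / (2 * ε)) * (-(2 * x) / (2 * ε)))) x := by
    unfold heatKernel
    have h1 : HasDerivAt (fun y : ℝ => -y ^ 2 / (2 * ε)) (-(2 * x) / (2 * ε)) x := by
      have := ((hasDerivAt_pow 2 x).neg).div_const (2 * ε)
      simpa using this
    exact (h1.exp).const_mul _
  rw [heatKernelDeriv, h.deriv, heatKernel]
  have : -(2 * x) / (2 * ε) = -(x / ε) := by
    rw [neg_div, mul_div_mul_left _ _ (two_ne_zero)]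
  rw [this]; ring

/-- The Fourier form `ρ_ε'(x) = (i / 2π) ∫ p e^{ipx} e^{-εp²/2} dp` of the approximation of `δ'`. -/
theorem heatKernelDeriv_eq_fourier {ε : ℝ} (hε : 0 < ε) (x : ℝ) :
    ((heatKernelDeriv ε x : ℝ) : ℂ) =
      Complex.I / (2 * Real.pi) *
        ∫ p : ℝ, (p : ℂ) * Complex.exp (Complex.I * p * x) *
          Complex.exp (-(ε : ℂ) * (p : ℂ) ^ 2 / 2) := by
  have hb : (0 : ℝ) < ((ε : ℂ) / 2).re := by
    have : ((ε : ℂ) / 2).re = ε / 2 := by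
      rw [show ((ε : ℂ) / 2) = ((ε / 2 : ℝ) : ℂ) by push_cast; rfl, Complex.ofReal_re]
    rw [this]; positivity
  have hεC : (ε : ℂ) ≠ 0 := by exact_mod_cast hε.ne'
  set F : ℝ → ℂ := fun p => Complex.exp (Complex.I * x * p) *
    Complex.exp (-((ε : ℂ) / 2) * (p : ℂ) ^ 2) with hF
  have hnorm : ∀ p : ℝ, ‖Complex.exp (Complex.I * x * p)‖ = 1 := by
    intro p
    rw [show Complex.I * x * p = ((x * p : ℝ) : ℂ) * Complex.I by push_cast; ring]
    exact Complex.norm_exp_ofReal_mul_I _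
  have hcont : Continuous fun p : ℝ => Complex.exp (Complex.I * x * p) := by fun_prop
  have hFint : Integrable F :=
    (integrable_cexp_neg_mul_sq hb).bdd_mul (c := 1) hcont.aestronglyMeasurable
      (ae_of_all _ fun p => (hnorm p).le)
  have hpFint : Integrable fun p : ℝ => (p : ℂ) * F p := by
    have := (integrable_mul_cexp_neg_mul_sq hb).bdd_mul (c := 1) hcont.aestronglyMeasurable
      (ae_of_all _ fun p => (hnorm p).le)
    refine this.congr (ae_of_all _ fun p => ?_)
    simp only [hF]; ring
  have hderiv : ∀ p : ℝ, HasDerivAt F (Complex.I * x * F p - ε * ((p : ℂ) * F p)) p := by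
    intro p
    have h1 : HasDerivAt (fun q : ℂ => Complex.exp (Complex.I * x * q) *
        Complex.exp (-((ε : ℂ) / 2) * q ^ 2))
        (Complex.I * x * F p - ε * ((p : ℂ) * F p)) (p : ℂ) := by
      have a := ((hasDerivAt_id (p : ℂ)).const_mul (Complex.I * x)).cexp
      have b := ((hasDerivAt_pow 2 (p : ℂ)).const_mul (-((ε : ℂ) / 2))).cexp
      refine (a.mul b).congr_deriv ?_
      simp only [hF, id]
      push_cast
      ring
    exact h1.comp_ofReal
  have hzero := integral_eq_zero_of_hasDerivAt_of_integrable hderiv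
    ((hFint.const_mul _).sub (hpFint.const_mul _)) hFint
  rw [integral_sub (hFint.const_mul _) (hpFint.const_mul _), integral_const_mul,
    integral_const_mul] at hzero
  have hgauss : ∫ p : ℝ, F p =
      (2 * Real.pi) * (heatKernel ε x : ℂ) := by
    rw [hF, fourierIntegral_gaussian hb x]
    have e1 : (Real.pi : ℂ) / ((ε : ℂ) / 2) = ((2 * Real.pi / ε : ℝ) : ℂ) := by
      push_cast; field_simp
    have e2 : (-(x : ℂ) ^ 2 / (4 * ((ε : ℂ) / 2))) = ((-x ^ 2 / (2 * ε) : ℝ) : ℂ) := by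
      push_cast; congr 1; ring
    have e3 : Real.sqrt (2 * Real.pi / ε) = 2 * Real.pi * (Real.sqrt (2 * Real.pi * ε))⁻¹ := by
      have hpi := Real.pi_pos
      rw [Real.sqrt_eq_iff_mul_self_eq (by positivity) (by positivity)]
      have h2 : Real.sqrt (2 * Real.pi * ε) * Real.sqrt (2 * Real.pi * ε) = 2 * Real.pi * ε :=
        Real.mul_self_sqrt (by positivity)
      have h3 : Real.sqrt (2 * Real.pi * ε) ≠ 0 := by positivity
      field_simp
      rw [sq, h2]
    rw [e1, e2, ← Complex.ofReal_exp,
      show (1 / 2 : ℂ) = ((1 / 2 : ℝ) : ℂ) by push_cast; rfl,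
      ← Complex.ofReal_cpow (by have := Real.pi_pos; positivity), ← Real.sqrt_eq_rpow, e3]
    unfold heatKernel
    push_cast
    ring
  have hint : (∫ p : ℝ, (p : ℂ) * Complex.exp (Complex.I * p * x) *
      Complex.exp (-(ε : ℂ) * (p : ℂ) ^ 2 / 2)) = ∫ p : ℝ, (p : ℂ) * F p := by
    refine integral_congr_ae (ae_of_all _ fun p => ?_)
    simp only [hF, mul_assoc]
    congr 3 <;> ring_nf
  have hpi : (Real.pi : ℂ) ≠ 0 := by exact_mod_cast Real.pi_ne_zero
  have hval : ∫ p : ℝ, (p : ℂ) * F p =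
      Complex.I * x / ε * ((2 * Real.pi) * (heatKernel ε x : ℂ)) := by
    rw [← hgauss, div_mul_eq_mul_div, eq_div_iff hεC]
    linear_combination -hzero
  rw [hint, hval, heatKernelDeriv_eq]
  push_cast
  field_simp
  rw [Complex.I_sq]
  ring

/-- The approximation `∫_A ρ_ε'(X_t - Y_s) ds dt` of `∫_A δ'(X_t - Y_s) ds dt`, where `A` is a set
of pairs `(s, t)` of nonnegative times. -/
noncomputable def localTimeDerivApprox {Ω : Type*} (A : Set (ℝ × ℝ)) (X Y : ℝ≥0 → Ω → ℝ)
    (ε : ℝ) (ω : Ω) : ℝ :=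
  ∫ z in A, heatKernelDeriv ε (X z.2.toNNReal ω - Y z.1.toNNReal ω)

/-- `∫_A δ'(X_t - Y_s) ds dt`, the pathwise limit as `ε ↓ 0` of the approximations. -/
noncomputable def localTimeDeriv {Ω : Type*} (A : Set (ℝ × ℝ)) (X Y : ℝ≥0 → Ω → ℝ) (ω : Ω) : ℝ :=
  limUnder (𝓝[>] (0 : ℝ)) (fun ε => localTimeDerivApprox A X Y ε ω)

/-- The triangle `{(s, t) : 0 ≤ s ≤ t ≤ 1}`. -/
def triangle : Set (ℝ × ℝ) := {z | 0 ≤ z.1 ∧ z.1 ≤ z.2 ∧ z.2 ≤ 1}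

/-- The unit square of pairs `(s, t)`. -/
def unitSquare : Set (ℝ × ℝ) := Set.Icc 0 1 ×ˢ Set.Icc 0 1

/-- The dyadic square
`A_k^n = [2(k-1) 2^{-n}, (2k-1) 2^{-n}) × ((2k-1) 2^{-n}, 2k 2^{-n}]` of pairs `(s, t)`. -/
def dyadicSquare (n k : ℕ) : Set (ℝ × ℝ) :=
  Set.Ico (2 * ((k : ℝ) - 1) / 2 ^ n) ((2 * (k : ℝ) - 1) / 2 ^ n) ×ˢ
    Set.Ioc ((2 * (k : ℝ) - 1) / 2 ^ n) (2 * (k : ℝ) / 2 ^ n)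

/-- The derivative of self-intersection local time (DSLT) of `B` on `[0, 1]`,
`∫_0^1 ∫_0^t δ'(B_t - B_s) ds dt`. -/
noncomputable def dslt {Ω : Type*} (B : ℝ≥0 → Ω → ℝ) : Ω → ℝ :=
  localTimeDeriv triangle B B

/-- The dyadic piece `∫_{A_k^n} δ'(B_t - B_s) ds dt` of the DSLT. -/
noncomputable def dsltPiece {Ω : Type*} (B : ℝ≥0 → Ω → ℝ) (n k : ℕ) : Ω → ℝ :=
  localTimeDeriv (dyadicSquare n k) B B

/-- The derivative of intersection local time (DILT) of `B₁` and `B₂` on `[0, 1]²`,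
`∫_0^1 ∫_0^1 δ'(B₁_t - B₂_s) ds dt`. -/
noncomputable def dilt {Ω : Type*} (B₁ B₂ : ℝ≥0 → Ω → ℝ) : Ω → ℝ :=
  localTimeDeriv unitSquare B₁ B₂

/-- The random variables `F i` converge to `X` along `l`, almost surely and in `L^p` for every
`0 < p < ∞`. -/
def ConvergesAEAndLp {Ω ι : Type*} [MeasurableSpace Ω] (P : Measure Ω) (l : Filter ι)
    (F : ι → Ω → ℝ) (X : Ω → ℝ) : Prop :=
  (∀ᵐ ω ∂P, Tendsto (fun i => F i ω) l (𝓝 (X ω))) ∧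
    ∀ p : ℝ≥0∞, 0 < p → p < ∞ →
      (∀ᶠ i in l, MemLp (F i) p P) ∧ MemLp X p P ∧
        Tendsto (fun i => eLpNorm (fun ω => F i ω - X ω) p P) l (𝓝 0)

end LeGallScheme

/-! Everything reduces to one functional of a pair of paths on `[0,1]`, `squareApprox ε x y = ∫∫
ρ_ε'(x_t - y_s) ds dt`, and to one estimate of its derivative in `ε`.

Moment estimate. Write `x̂` for the Fourier transform of the occupation measure of `x`. Then
`squareApprox` is a pairing `∫ κ(p) x̂(p) ŷ(-p) dp`. For independent Wiener paths its `M`-th moment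
is an integral over `p ∈ ℝ^M` containing `E ∏ x̂(p_j)` and `E ∏ ŷ(-p_j)`. Ordering the times makes
the increments independent, and each expectation is at most a sum over orderings of `∏ 3 / (1 +
u_i²)`, where the `u_i` are the tail sums of the reordered `p`. The product of the two expectations
therefore beats any coefficient with `|κ(p)| ≤ c (1 + p²)^{5/8}` (`norm_integral_pairing_pow_le`).
The `ε`-derivative of the coefficient of `ρ_ε'` satisfies this with `c = ε^{-7/8}`
(`norm_heatCoeffDeriv_le`).

Existence of limits. Since `ε^{-7/8}` is integrable at `0`, Minkowski's inequality shows that the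
total variation of `ε ↦ squareApprox ε` on `(0,1]` has moments of all orders. This gives the almost
sure limit and, at the same time, a dominating variable in every `L^p`.

Dyadic pieces. Around the midpoint of a dyadic square, the path after it and the time-reversed path
before it, rescaled, are independent Brownian motions. By scaling, the piece at level `n` is
`2^{-n}` times the functional of such a pair, which gives existence and the law. Pieces of one level
depend on increments over non-overlapping time intervals, which gives independence.

Summation. The derivative of the contribution of level `n + 1` is a sum of `2^n` independent centred
terms of size `(2^{n+1} ε)^{-7/8}`. Independence replaces the factor `2^n` by `2^{n/2}`, so its
`L^{2m}` norm is `O(2^{-3n/8} ε^{-7/8})` (`exists_integral_layerDeriv_pow_le`). The total variations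
of all levels are thus summable in every `L^p`. They dominate both the limit `ε ↓ 0` over the
triangle and the limit of the partial sums, and they allow the two to be exchanged. -/

namespace LeGallScheme

open scoped Matrix

/-! ### Continuous paths on the unit interval -/

/-- Continuous real paths on the unit interval, with the σ-algebra generated by the evaluations. -/
abbrev UnitPath : Type := {x : unitInterval → ℝ // Continuous x}

/-- Evaluation of a path, extended by constants outside of the unit interval. -/
noncomputable def pathEval (x : UnitPath) (t : ℝ) : ℝ := x.1 (Set.projIcc 0 1 zero_le_one t)

lemma continuous_pathEval (x : UnitPath) : Continuous (pathEval x) :=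
  x.2.comp continuous_projIcc

lemma measurable_pathEval (t : ℝ) : Measurable fun x : UnitPath => pathEval x t :=
  (measurable_pi_apply _).comp measurable_subtype_coe

lemma measurable_pathEval_uncurry : Measurable fun q : UnitPath × ℝ => pathEval q.1 q.2 :=
  (measurable_uncurry_of_continuous_of_measurable (u := fun (t : ℝ) (x : UnitPath) => pathEval x t)
    continuous_pathEval measurable_pathEval).comp measurable_swap

@[fun_prop]
lemma measurable_pathEval_comp {α : Type*} [MeasurableSpace α] {f : α → UnitPath} {g : α → ℝ}
    (hf : Measurable f) (hg : Measurable g) : Measurable fun a => pathEval (f a) (g a) :=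
  measurable_pathEval_uncurry.comp (hf.prodMk hg)

/-- The Fourier transform of the occupation measure of a path. -/
noncomputable def pathFourier (x : UnitPath) (p : ℝ) : ℂ :=
  ∫ t in Set.Icc (0 : ℝ) 1, Complex.exp (Complex.I * p * pathEval x t)

lemma norm_cexp_I_mul_mul (p y : ℝ) : ‖Complex.exp (Complex.I * p * y)‖ = 1 := by
  rw [show Complex.I * p * y = ((p * y : ℝ) : ℂ) * Complex.I by push_cast; ring]
  exact Complex.norm_exp_ofReal_mul_I _

instance : IsProbabilityMeasure (volume.restrict (Set.Icc (0 : ℝ) 1)) := ⟨by simp⟩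

lemma norm_pathFourier_le (x : UnitPath) (p : ℝ) : ‖pathFourier x p‖ ≤ 1 := by
  refine (norm_integral_le_of_norm_le_const (C := 1) (ae_of_all _ fun t => ?_)).trans (by simp)
  rw [norm_cexp_I_mul_mul]

lemma measurable_pathFourier : Measurable fun q : UnitPath × ℝ => pathFourier q.1 q.2 := by
  have h : Measurable fun z : (UnitPath × ℝ) × ℝ =>
      Complex.exp (Complex.I * z.1.2 * pathEval z.1.1 z.2) := by fun_prop
  exact (h.stronglyMeasurable.integral_prod_right' (ν := volume.restrict (Set.Icc (0 : ℝ) 1))).measurable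

@[fun_prop]
lemma measurable_pathFourier_comp {α : Type*} [MeasurableSpace α] {f : α → UnitPath} {g : α → ℝ}
    (hf : Measurable f) (hg : Measurable g) : Measurable fun a => pathFourier (f a) (g a) :=
  measurable_pathFourier.comp (hf.prodMk hg)

lemma conj_pathFourier (x : UnitPath) (p : ℝ) :
    (starRingEnd ℂ) (pathFourier x p) = pathFourier x (-p) := by
  unfold pathFourier
  rw [← integral_conj]
  refine integral_congr_ae (ae_of_all _ fun t => ?_)
  simp [← Complex.exp_conj]

/-! ### The law of Brownian motion through its characteristic functions -/

/-- The upper triangular matrix of ones. -/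
def cumMat (M : ℕ) : Matrix (Fin M) (Fin M) ℝ := Matrix.of fun i j => if i ≤ j then 1 else 0

lemma cumMat_mulVec {M : ℕ} (p : Fin M → ℝ) (i : Fin M) :
    (cumMat M *ᵥ p) i = ∑ j, if i ≤ j then p j else 0 := by
  simp [cumMat, Matrix.mulVec, dotProduct]

lemma cumMat_transpose_mulVec {M : ℕ} (s : Fin M → ℝ) (j : Fin M) :
    ((cumMat M)ᵀ *ᵥ s) j = ∑ i, if i ≤ j then s i else 0 := by
  simp [cumMat, Matrix.mulVec, dotProduct]

lemma det_cumMat (M : ℕ) : (cumMat M).det = 1 := by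
  rw [Matrix.det_of_isUpperTriangular]
  · simp [cumMat]
  · intro i j hij
    simp only [cumMat, Matrix.of_apply, ite_eq_right_iff, one_ne_zero, imp_false, not_le]
    exact hij

lemma measurePreserving_mulVec_of_det_eq_one {M : ℕ} {A : Matrix (Fin M) (Fin M) ℝ}
    (hA : A.det = 1) : MeasurePreserving (fun p : Fin M → ℝ => A *ᵥ p) volume volume := by
  refine ⟨?_, ?_⟩
  · exact (Matrix.toLin' A).continuous_of_finiteDimensional.measurable
  · have := Real.map_matrix_volume_pi_eq_smul_volume_pi (M := A) (by rw [hA]; norm_num)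
    rw [hA, inv_one, abs_one, ENNReal.ofReal_one, one_smul] at this
    exact this

/-- The law `W` on continuous paths has the finite-dimensional characteristic functions of
Brownian motion. -/
def IsWiener (W : Measure UnitPath) : Prop :=
  ∀ (M : ℕ) (p s : Fin M → ℝ), (∀ i, 0 ≤ s i) → ∑ i, s i ≤ 1 →
    ∫ x, ∏ j, Complex.exp (Complex.I * p j * pathEval x (((cumMat M)ᵀ *ᵥ s) j)) ∂W =
      ∏ i, Complex.exp (-(s i * (cumMat M *ᵥ p) i ^ 2 / 2 : ℝ))

lemma lintegral_ofReal_prod {M : ℕ} {h : Fin M → ℝ → ℝ} (h0 : ∀ i x, 0 ≤ h i x)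
    (hi : ∀ i, Integrable (h i)) :
    ∫⁻ x : Fin M → ℝ, ENNReal.ofReal (∏ i, h i (x i)) = ENNReal.ofReal (∏ i, ∫ x, h i x) := by
  rw [← integral_fintype_prod_volume_eq_prod, ofReal_integral_eq_lintegral_ofReal]
  · exact Integrable.fintype_prod_dep hi
  · exact ae_of_all _ fun x => Finset.prod_nonneg fun i _ => h0 i _

/-- The integral is at most `1`, and `u²` times it is at most `2` by explicit integration. Adding
the two bounds produces the constant `3`, without a singularity at `u = 0`. -/
lemma integral_exp_neg_mul_sq_le (u : ℝ) :
    ∫ s in Set.Icc (0 : ℝ) 1, Real.exp (-(s * u ^ 2 / 2)) ≤ 3 / (1 + u ^ 2) := by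
  rw [le_div_iff₀ (by positivity), integral_Icc_eq_integral_Ioc,
    ← intervalIntegral.integral_of_le zero_le_one]
  have hd : ∀ s : ℝ, HasDerivAt (fun s => -2 * Real.exp (-(s * u ^ 2 / 2)))
      (u ^ 2 * Real.exp (-(s * u ^ 2 / 2))) s := by
    intro s
    have := ((((hasDerivAt_id s).mul_const (u ^ 2)).div_const 2).neg.exp).const_mul (-2)
    refine this.congr_deriv ?_
    simp only [id, Pi.neg_apply]
    ring
  have h1 := intervalIntegral.integral_eq_sub_of_hasDerivAt (a := 0) (b := 1)
    (fun s _ => hd s) (by apply Continuous.intervalIntegrable; fun_prop)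
  rw [intervalIntegral.integral_const_mul] at h1
  have h2 : ∫ s in (0 : ℝ)..1, Real.exp (-(s * u ^ 2 / 2)) ≤ ∫ s in (0 : ℝ)..1, (1 : ℝ) := by
    refine intervalIntegral.integral_mono_on zero_le_one
      (by apply Continuous.intervalIntegrable; fun_prop) (by simp) fun s hs => ?_
    rw [Real.exp_le_one_iff]
    have := hs.1
    have : 0 ≤ s * u ^ 2 / 2 := by positivity
    linarith
  simp only [intervalIntegral.integral_const, sub_zero, smul_eq_mul, mul_one] at h2
  have h3 := Real.exp_pos (-(1 * u ^ 2 / 2))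
  simp only [zero_mul, zero_div, neg_zero, Real.exp_zero] at h1
  linarith

lemma measurable_integral_prod_exp {M : ℕ} (W : Measure UnitPath) [SFinite W] (p : Fin M → ℝ) :
    Measurable fun t : Fin M → ℝ =>
      ∫ x, ∏ j, Complex.exp (Complex.I * p j * pathEval x (t j)) ∂W := by
  have h : Measurable fun z : (Fin M → ℝ) × UnitPath =>
      ∏ j, Complex.exp (Complex.I * p j * pathEval z.2 (z.1 j)) := by fun_prop
  exact (h.stronglyMeasurable.integral_prod_right' (ν := W)).measurable

/-- Nonnegativity of the increments of a monotone sequence, written in terms of partial sums. -/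
lemma nonneg_of_monotone_cumMat {M : ℕ} {s : Fin M → ℝ} (hm : Monotone ((cumMat M)ᵀ *ᵥ s))
    (h0 : ∀ j, 0 ≤ ((cumMat M)ᵀ *ᵥ s) j) (i : Fin M) : 0 ≤ s i := by
  by_cases hi : i.1 = 0
  · have h := h0 i
    rw [cumMat_transpose_mulVec, Finset.sum_eq_single i] at h
    · simpa using h
    · intro j _ hj
      rw [if_neg]
      intro hle
      exact hj (Fin.ext (by have := Fin.le_def.1 hle; omega))
    · simp
  · set i' : Fin M := ⟨i.1 - 1, by omega⟩ with hi'
    have hle : i' ≤ i := Fin.le_def.2 (by simp [hi'])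
    have h := sub_nonneg.2 (hm hle)
    rw [cumMat_transpose_mulVec, cumMat_transpose_mulVec, ← Finset.sum_sub_distrib,
      Finset.sum_eq_single i] at h
    · have hn : ¬ i ≤ i' := by rw [Fin.le_def]; simp only [hi']; omega
      simpa [hn] using h
    · intro j _ hj
      by_cases h1 : j ≤ i'
      · simp [h1, h1.trans hle]
      · have h2 : ¬ j ≤ i := by
          intro h2
          apply h1
          rw [Fin.le_def] at h2 ⊢
          simp only [hi']
          have : j.1 ≠ i.1 := fun h => hj (Fin.ext h)
          omega
        simp [h1, h2]
    · simp

lemma measurableSet_monotone_unitCube (M : ℕ) :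
    MeasurableSet {t : Fin M → ℝ | Monotone t ∧ ∀ j, t j ∈ Set.Icc (0 : ℝ) 1} := by
  have : {t : Fin M → ℝ | Monotone t ∧ ∀ j, t j ∈ Set.Icc (0 : ℝ) 1} =
      (⋂ i, ⋂ j, ⋂ (_ : i ≤ j), {t : Fin M → ℝ | t i ≤ t j}) ∩
      ⋂ j, {t : Fin M → ℝ | t j ∈ Set.Icc (0 : ℝ) 1} := by
    ext t
    simp [Monotone]
  rw [this]
  refine MeasurableSet.inter ?_ ?_
  · exact MeasurableSet.iInter fun i => MeasurableSet.iInter fun j => MeasurableSet.iInter fun _ =>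
      measurableSet_le (measurable_pi_apply i) (measurable_pi_apply j)
  · exact MeasurableSet.iInter fun i => measurableSet_Icc.preimage (measurable_pi_apply i)

/-- On ordered times the substitution `t = (cumMat M)ᵀ s` passes to the increments `s` and has
determinant one. The expectation then factorises into `∏ exp(-s_i u_i² / 2)` with `u = cumMat M *ᵥ
p`. Enlarging the simplex of increments to the cube makes the integral a product. -/
lemma lintegral_monotone_le {M : ℕ} {W : Measure UnitPath} [IsProbabilityMeasure W]
    (hW : IsWiener W) (p : Fin M → ℝ) :
    ∫⁻ t in {t : Fin M → ℝ | Monotone t ∧ ∀ j, t j ∈ Set.Icc (0 : ℝ) 1},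
      ‖∫ x, ∏ j, Complex.exp (Complex.I * p j * pathEval x (t j)) ∂W‖ₑ ≤
      ENNReal.ofReal (∏ i, 3 / (1 + (cumMat M *ᵥ p) i ^ 2)) := by
  set S := {t : Fin M → ℝ | Monotone t ∧ ∀ j, t j ∈ Set.Icc (0 : ℝ) 1} with hS
  have hSm : MeasurableSet S := measurableSet_monotone_unitCube M
  set Ψ := fun t : Fin M → ℝ =>
    ‖∫ x, ∏ j, Complex.exp (Complex.I * p j * pathEval x (t j)) ∂W‖ₑ with hΨ
  have hΨm : Measurable Ψ := (measurable_integral_prod_exp W p).enorm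
  set u := cumMat M *ᵥ p
  let h : Fin M → ℝ → ℝ := fun i =>
    (Set.Icc (0 : ℝ) 1).indicator fun y => Real.exp (-(y * u i ^ 2 / 2))
  have hh0 : ∀ i x, 0 ≤ h i x := fun i x => Set.indicator_nonneg (fun _ _ => (Real.exp_pos _).le) _
  have hhi : ∀ i, Integrable (h i) := fun i =>
    (integrable_indicator_iff measurableSet_Icc).2
      (ContinuousOn.integrableOn_Icc (by fun_prop))
  have hT := measurePreserving_mulVec_of_det_eq_one (A := (cumMat M)ᵀ)
    (by rw [Matrix.det_transpose, det_cumMat])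
  calc ∫⁻ t in S, Ψ t = ∫⁻ t, S.indicator Ψ t := (lintegral_indicator hSm _).symm
    _ = ∫⁻ s, S.indicator Ψ ((cumMat M)ᵀ *ᵥ s) :=
        (hT.lintegral_comp (hΨm.indicator hSm)).symm
    _ ≤ ∫⁻ s : Fin M → ℝ, ENNReal.ofReal (∏ i, h i (s i)) := by
        refine lintegral_mono fun s => ?_
        by_cases hs : (cumMat M)ᵀ *ᵥ s ∈ S
        · rw [Set.indicator_of_mem hs]
          have hs0 := nonneg_of_monotone_cumMat hs.1 fun j => (hs.2 j).1
          have hs1 : ∀ i, s i ≤ 1 := fun i => by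
            refine le_trans ?_ (hs.2 i).2
            rw [cumMat_transpose_mulVec]
            have := Finset.single_le_sum (f := fun k => if k ≤ i then s k else 0)
              (fun k _ => by split_ifs <;> simp [hs0]) (Finset.mem_univ i)
            simpa using this
          have hsum : ∑ i, s i ≤ 1 := by
            cases M with
            | zero => simp
            | succ n =>
              have := (hs.2 (Fin.last n)).2
              rw [cumMat_transpose_mulVec] at this
              simpa [Fin.le_last] using this
          simp only [hΨ]
          rw [hW M p s hs0 hsum, ← ofReal_norm, norm_prod]
          refine ENNReal.ofReal_le_ofReal (Finset.prod_congr rfl fun i _ => ?_).le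
          simp only [h]
          rw [Set.indicator_of_mem (show s i ∈ Set.Icc (0 : ℝ) 1 from ⟨hs0 i, hs1 i⟩), Complex.norm_exp, ← Complex.ofReal_neg,
            Complex.ofReal_re]
        · rw [Set.indicator_of_notMem hs]
          exact zero_le
    _ = ENNReal.ofReal (∏ i, ∫ x, h i x) := lintegral_ofReal_prod hh0 hhi
    _ ≤ _ := by
        refine ENNReal.ofReal_le_ofReal (Finset.prod_le_prod
          (fun i _ => integral_nonneg (hh0 i)) fun i _ => ?_)
        rw [integral_indicator measurableSet_Icc]
        exact integral_exp_neg_mul_sq_le _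

end LeGallScheme

/-! ### Joint moments of occupation Fourier transforms and of pairings -/

namespace LeGallScheme

open scoped Matrix

lemma measurePreserving_comp_perm {M : ℕ} (σ : Equiv.Perm (Fin M)) :
    MeasurePreserving (fun t : Fin M → ℝ => t ∘ σ) volume volume := by
  convert volume_measurePreserving_piCongrLeft (fun _ : Fin M => ℝ) σ.symm using 1
  ext t i
  rw [MeasurableEquiv.coe_piCongrLeft]
  simp [Equiv.piCongrLeft_apply]

/-- By Fubini the expectation is an integral over the cube of times. The cube is covered by the `M!`
ordering regions, and on each of them relabelling the coordinates leads back to monotone times. -/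
lemma enorm_integral_prod_pathFourier_le {M : ℕ} {W : Measure UnitPath} [IsProbabilityMeasure W]
    (hW : IsWiener W) (p : Fin M → ℝ) :
    ‖∫ x, ∏ j, pathFourier x (p j) ∂W‖ₑ ≤ ∑ σ : Equiv.Perm (Fin M),
      ENNReal.ofReal (∏ i, 3 / (1 + (cumMat M *ᵥ (p ∘ σ)) i ^ 2)) := by
  set S := {t : Fin M → ℝ | Monotone t ∧ ∀ j, t j ∈ Set.Icc (0 : ℝ) 1} with hS
  let Ψ := fun (p t : Fin M → ℝ) =>
    ‖∫ x, ∏ j, Complex.exp (Complex.I * p j * pathEval x (t j)) ∂W‖ₑ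
  have hpi : (Measure.pi fun _ : Fin M => volume.restrict (Set.Icc (0 : ℝ) 1)) =
      volume.restrict (Set.univ.pi fun _ => Set.Icc (0 : ℝ) 1) :=
    (Measure.restrict_pi_pi _ _).symm
  have hswap : ∫ x, ∏ j, pathFourier x (p j) ∂W =
      ∫ t in Set.univ.pi fun _ : Fin M => Set.Icc (0 : ℝ) 1,
        ∫ x, ∏ j, Complex.exp (Complex.I * p j * pathEval x (t j)) ∂W := by
    rw [← hpi, ← integral_integral_swap]
    · refine integral_congr_ae (ae_of_all _ fun x => ?_)
      exact (integral_fintype_prod_eq_prod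
        (fun j (t : ℝ) => Complex.exp (Complex.I * p j * pathEval x t))).symm
    · refine Integrable.of_bound (C := 1) (Measurable.aestronglyMeasurable ?_)
        (ae_of_all _ fun z => ?_)
      · simp only [Function.uncurry_def]
        fun_prop
      · simp [Function.uncurry_def, norm_prod, norm_cexp_I_mul_mul]
  rw [hswap]
  refine (enorm_integral_le_lintegral_enorm _).trans ?_
  have hcover : (Set.univ.pi fun _ : Fin M => Set.Icc (0 : ℝ) 1) ⊆
      ⋃ σ : Equiv.Perm (Fin M), (fun t : Fin M → ℝ => t ∘ σ) ⁻¹' S := by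
    intro t ht
    refine Set.mem_iUnion.2 ⟨Tuple.sort t, Tuple.monotone_sort t, fun j => ht _ trivial⟩
  refine (lintegral_mono_set hcover).trans ((lintegral_iUnion_le _ _).trans ?_)
  rw [tsum_fintype]
  refine Finset.sum_le_sum fun σ _ => ?_
  have hΨ : ∀ t, Ψ p t = Ψ (p ∘ σ) (t ∘ σ) := by
    intro t
    simp only [Ψ, Function.comp]
    congr 1
    refine integral_congr_ae (ae_of_all _ fun x => ?_)
    exact (Equiv.prod_comp σ fun j => Complex.exp (Complex.I * p j * pathEval x (t j))).symm
  have hSm : MeasurableSet S := measurableSet_monotone_unitCube M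
  calc ∫⁻ t in (fun t : Fin M → ℝ => t ∘ σ) ⁻¹' S, Ψ p t
      = ∫⁻ t in (fun t : Fin M → ℝ => t ∘ σ) ⁻¹' S, Ψ (p ∘ σ) (t ∘ σ) := by simp only [hΨ]
    _ = ∫⁻ t in S, Ψ (p ∘ σ) t :=
        (measurePreserving_comp_perm σ).setLIntegral_comp_preimage hSm
          (measurable_integral_prod_exp W (p ∘ σ)).enorm
    _ ≤ _ := lintegral_monotone_le hW (p ∘ σ)

/-- The weight `(1 + p²)^{5/8}` bounding the Fourier coefficients. -/
noncomputable def weight (p : ℝ) : ℝ := (1 + p ^ 2) ^ (5 / 8 : ℝ)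

lemma one_le_weight (p : ℝ) : 1 ≤ weight p :=
  Real.one_le_rpow (by nlinarith [sq_nonneg p]) (by norm_num)

lemma weight_zero : weight 0 = 1 := by simp [weight]

lemma measurable_weight : Measurable weight := by unfold weight; fun_prop

lemma weight_sub_le (u v : ℝ) : weight (u - v) ≤ 2 * (weight u * weight v) := by
  unfold weight
  rw [← Real.mul_rpow (by positivity) (by positivity)]
  calc (1 + (u - v) ^ 2) ^ (5 / 8 : ℝ) ≤ (2 * ((1 + u ^ 2) * (1 + v ^ 2))) ^ (5 / 8 : ℝ) := by
        refine Real.rpow_le_rpow (by positivity) ?_ (by norm_num)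
        nlinarith [sq_nonneg (u + v), sq_nonneg (u * v)]
    _ = 2 ^ (5 / 8 : ℝ) * ((1 + u ^ 2) * (1 + v ^ 2)) ^ (5 / 8 : ℝ) :=
        Real.mul_rpow (by norm_num) (by positivity)
    _ ≤ 2 * ((1 + u ^ 2) * (1 + v ^ 2)) ^ (5 / 8 : ℝ) := by
        gcongr
        calc (2 : ℝ) ^ (5 / 8 : ℝ) ≤ 2 ^ (1 : ℝ) :=
              Real.rpow_le_rpow_of_exponent_le (by norm_num) (by norm_num)
          _ = 2 := Real.rpow_one 2

/-- Each `p_j` is a difference `U_j - U_{j+1}` of consecutive tail sums, and the weight is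
submultiplicative up to a factor `2`. Every tail sum occurs in at most two such differences, hence
the square on the right. -/
lemma prod_weight_le {M : ℕ} (p : Fin M → ℝ) :
    ∏ j, weight (p j) ≤ ∏ i, 2 * weight ((cumMat M *ᵥ p) i) ^ 2 := by
  let U : ℕ → ℝ := fun i => ∑ j : Fin M, if i ≤ j.1 then p j else 0
  have hU : ∀ i : Fin M, (cumMat M *ᵥ p) i = U i := fun i => by
    rw [cumMat_mulVec]; simp only [U, Fin.le_def]
  have hUM : U M = 0 := Finset.sum_eq_zero fun j _ => if_neg (by omega)
  have hp : ∀ j : Fin M, p j = U j - U (j + 1) := by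
    intro j
    simp only [U]
    rw [← Finset.sum_sub_distrib, Finset.sum_eq_single j]
    · simp
    · intro k _ hk
      have : k.1 ≠ j.1 := fun h => hk (Fin.ext h)
      by_cases h : j.1 ≤ k.1
      · rw [if_pos h, if_pos (by omega), sub_self]
      · rw [if_neg h, if_neg (by omega), sub_self]
    · simp
  have h0 : ∀ x, 0 ≤ weight x := fun x => zero_le_one.trans (one_le_weight x)
  -- The shift gains `U M = 0`, of weight one, and loses `U 0`, of weight at least one.
  have hshift : ∏ i ∈ Finset.range M, weight (U (i + 1)) ≤ ∏ i ∈ Finset.range M, weight (U i) := by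
    have h1 := Finset.prod_range_succ (fun i => weight (U i)) M
    have h2 := Finset.prod_range_succ' (fun i => weight (U i)) M
    rw [h1, hUM, weight_zero, mul_one] at h2
    rw [h2]
    exact le_mul_of_one_le_right (Finset.prod_nonneg fun _ _ => h0 _) (one_le_weight _)
  calc ∏ j, weight (p j) ≤ ∏ j : Fin M, 2 * (weight (U j) * weight (U (j + 1))) := by
        refine Finset.prod_le_prod (fun _ _ => h0 _) fun j _ => ?_
        rw [hp j]
        exact weight_sub_le _ _
    _ = 2 ^ M * ((∏ i ∈ Finset.range M, weight (U i)) *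
          ∏ i ∈ Finset.range M, weight (U (i + 1))) := by
        rw [Finset.prod_mul_distrib, Finset.prod_mul_distrib, Finset.prod_const, Finset.card_univ,
          Fintype.card_fin, Fin.prod_univ_eq_prod_range (fun i => weight (U i)),
          Fin.prod_univ_eq_prod_range (fun i => weight (U (i + 1)))]
    _ ≤ 2 ^ M * ((∏ i ∈ Finset.range M, weight (U i)) * ∏ i ∈ Finset.range M, weight (U i)) := by
        gcongr
        exact Finset.prod_nonneg fun _ _ => h0 _
    _ = ∏ i, 2 * weight ((cumMat M *ᵥ p) i) ^ 2 := by
        simp only [hU]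
        rw [Finset.prod_mul_distrib, Finset.prod_const, Finset.card_univ, Fintype.card_fin,
          Finset.prod_pow, Fin.prod_univ_eq_prod_range (fun i => weight (U i)), sq]

/-- This is where the exponent `5/8` is constrained. With exponent `θ` the power here is `2θ - 2`,
which is integrable exactly when `θ < 3/4`. Integrability at `ε = 0` of the bound in
`norm_heatCoeffDeriv_le` needs `θ > 1/2`. The value `5/8` is the midpoint. -/
lemma weight_sq_mul (u : ℝ) :
    2 * weight u ^ 2 * (3 / (1 + u ^ 2)) ^ 2 = 18 * (1 + u ^ 2) ^ (-(3 / 4) : ℝ) := by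
  have h : 0 < 1 + u ^ 2 := by positivity
  unfold weight
  rw [div_pow, ← Real.rpow_natCast ((1 + u ^ 2) ^ (5 / 8 : ℝ)), ← Real.rpow_mul h.le,
    ← Real.rpow_natCast (1 + u ^ 2) 2]
  have : (-(3 / 4) : ℝ) = 5 / 8 * (2 : ℕ) - (2 : ℕ) := by norm_num
  rw [this, Real.rpow_sub h]
  ring

lemma integrable_weight_bound :
    Integrable fun u : ℝ => 18 * (1 + u ^ 2) ^ (-(3 / 4) : ℝ) := by
  have h := (integrable_rpow_neg_one_add_norm_sq (E := ℝ) (μ := volume) (r := 3 / 2)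
    (by norm_num)).const_mul 18
  refine h.congr (ae_of_all _ fun u => ?_)
  simp only [Real.norm_eq_abs, sq_abs]
  norm_num

/-- Cauchy–Schwarz over the permutations and invariance of the weight under relabelling reduce the
sum to a single ordering. In the tail sums `u = cumMat M *ᵥ p`, a change of variables of determinant
one, the integrand is then dominated by a product of one-dimensional integrable functions. -/
lemma lintegral_weight_mul_sum_sq_lt_top (M : ℕ) :
    ∫⁻ p : Fin M → ℝ, ENNReal.ofReal ((∏ j, weight (p j)) *
      (∑ σ : Equiv.Perm (Fin M), ∏ i, 3 / (1 + (cumMat M *ᵥ (p ∘ σ)) i ^ 2)) ^ 2) < ∞ := by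
  let A : (Fin M → ℝ) → ℝ := fun p => ∏ i, 3 / (1 + (cumMat M *ᵥ p) i ^ 2)
  let V : (Fin M → ℝ) → ℝ := fun p => ∏ j, weight (p j)
  have hV0 : ∀ p, 0 ≤ V p := fun p =>
    Finset.prod_nonneg fun _ _ => zero_le_one.trans (one_le_weight _)
  let c : ℝ := (Finset.univ : Finset (Equiv.Perm (Fin M))).card
  have hmv : Measurable fun p : Fin M → ℝ => cumMat M *ᵥ p :=
    (measurePreserving_mulVec_of_det_eq_one (det_cumMat M)).measurable
  have hAm : Measurable A := by
    refine Finset.measurable_prod _ fun i _ => ?_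
    have := (measurable_pi_apply i).comp hmv
    simp only [Function.comp_def] at this
    fun_prop
  have hVm : Measurable V :=
    Finset.measurable_prod _ fun i _ => measurable_weight.comp (measurable_pi_apply i)
  have hbase : ∫⁻ p, ENNReal.ofReal (c * (V p * A p ^ 2)) < ∞ := by
    have h1 : ∀ p, V p * A p ^ 2 ≤
        ∏ i, 18 * (1 + (cumMat M *ᵥ p) i ^ 2) ^ (-(3 / 4) : ℝ) := by
      intro p
      calc V p * A p ^ 2 ≤ (∏ i, 2 * weight ((cumMat M *ᵥ p) i) ^ 2) * A p ^ 2 :=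
            mul_le_mul_of_nonneg_right (prod_weight_le p) (sq_nonneg _)
        _ = _ := by
            simp only [A]
            rw [← Finset.prod_pow, ← Finset.prod_mul_distrib]
            exact Finset.prod_congr rfl fun i _ => weight_sq_mul _
    calc ∫⁻ p, ENNReal.ofReal (c * (V p * A p ^ 2))
        = ENNReal.ofReal c * ∫⁻ p, ENNReal.ofReal (V p * A p ^ 2) := by
          rw [← lintegral_const_mul _ (by fun_prop)]
          refine lintegral_congr fun p => ?_
          rw [ENNReal.ofReal_mul (by positivity)]
      _ ≤ ENNReal.ofReal c * ∫⁻ p : Fin M → ℝ, ENNReal.ofReal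
            (∏ i, 18 * (1 + (cumMat M *ᵥ p) i ^ 2) ^ (-(3 / 4) : ℝ)) := by
          gcongr with p
          exact h1 p
      _ = ENNReal.ofReal c * ∫⁻ u : Fin M → ℝ, ENNReal.ofReal
            (∏ i, 18 * (1 + u i ^ 2) ^ (-(3 / 4) : ℝ)) := by
          congr 1
          exact (measurePreserving_mulVec_of_det_eq_one (det_cumMat M)).lintegral_comp
            (f := fun u : Fin M → ℝ => ENNReal.ofReal
              (∏ i, 18 * (1 + u i ^ 2) ^ (-(3 / 4) : ℝ))) (by fun_prop)
      _ = ENNReal.ofReal c * ENNReal.ofReal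
            (∏ _i : Fin M, ∫ u : ℝ, 18 * (1 + u ^ 2) ^ (-(3 / 4) : ℝ)) := by
          congr 1
          exact lintegral_ofReal_prod (h := fun _ u => 18 * (1 + u ^ 2) ^ (-(3 / 4) : ℝ))
            (fun _ _ => by positivity) fun _ => integrable_weight_bound
      _ < ∞ := ENNReal.mul_lt_top ENNReal.ofReal_lt_top ENNReal.ofReal_lt_top
  calc ∫⁻ p, ENNReal.ofReal (V p * (∑ σ : Equiv.Perm (Fin M), A (p ∘ σ)) ^ 2)
      ≤ ∫⁻ p, ∑ σ : Equiv.Perm (Fin M), ENNReal.ofReal (c * (V (p ∘ σ) * A (p ∘ σ) ^ 2)) := by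
        refine lintegral_mono fun p => ?_
        have hV : ∀ σ : Equiv.Perm (Fin M), V (p ∘ σ) = V p := fun σ =>
          Equiv.prod_comp σ fun j => weight (p j)
        rw [← ENNReal.ofReal_sum_of_nonneg fun σ _ =>
          mul_nonneg (by positivity) (mul_nonneg (hV0 _) (sq_nonneg _))]
        refine ENNReal.ofReal_le_ofReal ?_
        simp only [hV]
        rw [← Finset.mul_sum, ← Finset.mul_sum, mul_left_comm]
        exact mul_le_mul_of_nonneg_left sq_sum_le_card_mul_sum_sq (hV0 p)
    _ = ∑ σ : Equiv.Perm (Fin M), ∫⁻ p, ENNReal.ofReal (c * (V (p ∘ σ) * A (p ∘ σ) ^ 2)) := by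
        refine lintegral_finsetSum _ fun σ _ => ?_
        have := (measurePreserving_comp_perm σ).measurable
        have h1 := hAm.comp this
        have h2 := hVm.comp this
        simp only [Function.comp_def] at h1 h2 ⊢
        fun_prop
    _ = ∑ _σ : Equiv.Perm (Fin M), ∫⁻ p, ENNReal.ofReal (c * (V p * A p ^ 2)) := by
        refine Finset.sum_congr rfl fun σ _ => ?_
        exact (measurePreserving_comp_perm σ).lintegral_comp
          (f := fun p => ENNReal.ofReal (c * (V p * A p ^ 2))) (by fun_prop)
    _ < ∞ := ENNReal.sum_lt_top.2 fun _ _ => hbase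

/-- The bilinear pairing `∫ κ(p) x̂(p) ŷ(-p) dp` of two paths. -/
noncomputable def pairing (κ : ℝ → ℂ) (x y : UnitPath) : ℂ :=
  ∫ p, κ p * (pathFourier x p * pathFourier y (-p))

lemma norm_pathFourier_mul_le (x y : UnitPath) (p q : ℝ) :
    ‖pathFourier x p * pathFourier y q‖ ≤ 1 := by
  rw [norm_mul]
  exact mul_le_one₀ (norm_pathFourier_le _ _) (norm_nonneg _) (norm_pathFourier_le _ _)

/-- The power of an integral is an integral over `ℝ^M`. Fubini applies because `κ` is integrable and
the transforms are bounded by one. Under the product law the expectation splits between the two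
paths. -/
lemma integral_pairing_pow {W : Measure UnitPath} [IsProbabilityMeasure W] {κ : ℝ → ℂ}
    (hκ : Integrable κ) (M : ℕ) :
    ∫ z, pairing κ z.1 z.2 ^ M ∂(W.prod W) =
      ∫ p : Fin M → ℝ, (∏ j, κ (p j)) * ((∫ x, ∏ j, pathFourier x (p j) ∂W) *
        ∫ y, ∏ j, pathFourier y (-p j) ∂W) := by
  have h1 : ∀ z : UnitPath × UnitPath, pairing κ z.1 z.2 ^ M =
      ∫ p : Fin M → ℝ, ∏ j, κ (p j) * (pathFourier z.1 (p j) * pathFourier z.2 (-p j)) := by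
    intro z
    have := integral_fintype_prod_volume_eq_pow (ι := Fin M)
      (fun p : ℝ => κ p * (pathFourier z.1 p * pathFourier z.2 (-p)))
    rw [Fintype.card_fin] at this
    exact this.symm
  simp only [h1]
  have hprod : Integrable fun p : Fin M → ℝ => ∏ j, κ (p j) := Integrable.fintype_prod fun _ => hκ
  rw [integral_integral_swap]
  · refine integral_congr_ae (ae_of_all _ fun p => ?_)
    simp only [Finset.prod_mul_distrib]
    rw [integral_const_mul, integral_prod_mul (fun x => ∏ j, pathFourier x (p j))
      (fun y => ∏ j, pathFourier y (-p j))]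
  · have hbd := (hprod.comp_snd (W.prod W)).bdd_mul (c := 1)
      (f := fun q : (UnitPath × UnitPath) × (Fin M → ℝ) =>
        ∏ j, pathFourier q.1.1 (q.2 j) * pathFourier q.1.2 (-q.2 j))
      (Measurable.aestronglyMeasurable (by fun_prop)) (ae_of_all _ fun q => by
        rw [norm_prod]
        exact Finset.prod_le_one (fun _ _ => norm_nonneg _) fun j _ => norm_pathFourier_mul_le _ _ _ _)
    refine hbd.congr (ae_of_all _ fun q => ?_)
    simp only [Function.uncurry_def, Finset.prod_mul_distrib]
    ring

/-- Moment bounds for pairings, uniform in the coefficient function. -/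
lemma norm_integral_pairing_pow_le {W : Measure UnitPath} [IsProbabilityMeasure W]
    (hW : IsWiener W) (M : ℕ) :
    ∃ K : ℝ, 0 ≤ K ∧ ∀ (κ : ℝ → ℂ) (c : ℝ), Integrable κ → 0 ≤ c →
      (∀ p, ‖κ p‖ ≤ c * weight p) →
      ‖∫ z, pairing κ z.1 z.2 ^ M ∂(W.prod W)‖ ≤ c ^ M * K := by
  set J := ∫⁻ p : Fin M → ℝ, ENNReal.ofReal ((∏ j, weight (p j)) *
      (∑ σ : Equiv.Perm (Fin M), ∏ i, 3 / (1 + (cumMat M *ᵥ (p ∘ σ)) i ^ 2)) ^ 2) with hJ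
  have hJtop : J < ∞ := lintegral_weight_mul_sum_sq_lt_top M
  refine ⟨J.toReal, ENNReal.toReal_nonneg, fun κ c hκ hc hb => ?_⟩
  rw [integral_pairing_pow hκ]
  have hc' : c ^ M * J.toReal = (ENNReal.ofReal (c ^ M) * J).toReal := by
    rw [ENNReal.toReal_mul, ENNReal.toReal_ofReal (by positivity)]
  rw [hc', ← toReal_enorm]
  refine ENNReal.toReal_mono (ENNReal.mul_lt_top ENNReal.ofReal_lt_top hJtop).ne ?_
  refine (enorm_integral_le_lintegral_enorm _).trans ?_
  rw [hJ, ← lintegral_const_mul' _ _ ENNReal.ofReal_ne_top]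
  refine lintegral_mono fun p => ?_
  set A := fun p : Fin M → ℝ =>
    ∑ σ : Equiv.Perm (Fin M), ∏ i, 3 / (1 + (cumMat M *ᵥ (p ∘ σ)) i ^ 2) with hA
  have hA0 : 0 ≤ A p := Finset.sum_nonneg fun σ _ => Finset.prod_nonneg fun i _ => by positivity
  have hF : ∀ q : Fin M → ℝ, ‖∫ x, ∏ j, pathFourier x (q j) ∂W‖ₑ ≤ ENNReal.ofReal (A q) := by
    intro q
    refine (enorm_integral_prod_pathFourier_le hW q).trans_eq ?_
    rw [hA, ENNReal.ofReal_sum_of_nonneg]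
    exact fun σ _ => Finset.prod_nonneg fun i _ => by positivity
  -- The second path enters at `-p`. The bound depends only on squares of tail sums, so both
  -- expectations have the same bound and their product is `A p ^ 2`.
  have hneg : A (-p) = A p := by
    simp only [hA]
    refine Finset.sum_congr rfl fun σ _ => Finset.prod_congr rfl fun i _ => ?_
    have : (-p) ∘ σ = -(p ∘ σ) := rfl
    rw [this, Matrix.mulVec_neg, Pi.neg_apply, neg_sq]
  have hκp : ‖∏ j, κ (p j)‖ₑ ≤ ENNReal.ofReal (c ^ M * ∏ j, weight (p j)) := by
    rw [← ofReal_norm, norm_prod]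
    refine ENNReal.ofReal_le_ofReal ?_
    calc ∏ j, ‖κ (p j)‖ ≤ ∏ j, c * weight (p j) :=
          Finset.prod_le_prod (fun _ _ => norm_nonneg _) fun j _ => hb _
      _ = _ := by rw [Finset.prod_mul_distrib]; simp
  have hw0 : 0 ≤ ∏ j, weight (p j) :=
    Finset.prod_nonneg fun _ _ => zero_le_one.trans (one_le_weight _)
  calc ‖(∏ j, κ (p j)) * ((∫ x, ∏ j, pathFourier x (p j) ∂W) *
        ∫ y, ∏ j, pathFourier y (-p j) ∂W)‖ₑ
      ≤ ENNReal.ofReal (c ^ M * ∏ j, weight (p j)) * (ENNReal.ofReal (A p) *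
          ENNReal.ofReal (A p)) := by
        rw [enorm_mul, enorm_mul]
        gcongr
        · exact hF p
        · exact (hF (-p)).trans_eq (by rw [hneg])
    _ = _ := by
        rw [← ENNReal.ofReal_mul hA0, ← ENNReal.ofReal_mul (by positivity),
          ← ENNReal.ofReal_mul (by positivity)]
        congr 1
        ring

end LeGallScheme

namespace LeGallScheme

/-! ### The approximations on the unit square -/

lemma abs_heatKernelDeriv_le {ε : ℝ} (hε : 0 < ε) (x : ℝ) : |heatKernelDeriv ε x| ≤ 1 / ε := by
  rw [heatKernelDeriv_eq, heatKernel, abs_mul, abs_neg, abs_div, abs_of_pos hε, abs_mul,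
    abs_of_pos (Real.exp_pos _), abs_of_nonneg (inv_nonneg.2 (Real.sqrt_nonneg (2 * Real.pi * ε)))]
  have hs : 0 < √ε := Real.sqrt_pos.2 hε
  have h1 : √(2 * Real.pi * ε) ≥ √ε :=
    Real.sqrt_le_sqrt (by nlinarith [Real.pi_gt_three])
  -- In the scale-free variable `y` the claim becomes `y exp(-y²/2) ≤ 1`.
  set y := |x| / √ε with hy
  have hxy : |x| = y * √ε := by rw [hy]; field_simp
  have h2 : -x ^ 2 / (2 * ε) = -(y ^ 2 / 2) := by
    rw [← sq_abs x, hxy, mul_pow, Real.sq_sqrt hε.le]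
    field_simp
  have hy0 : 0 ≤ y := by positivity
  have h3 : y * Real.exp (-(y ^ 2 / 2)) ≤ 1 := by
    rw [Real.exp_neg, ← div_eq_mul_inv, div_le_one (Real.exp_pos _)]
    have := Real.add_one_le_exp (y ^ 2 / 2)
    nlinarith [sq_nonneg (y - 1)]
  calc |x| / ε * ((√(2 * Real.pi * ε))⁻¹ * Real.exp (-x ^ 2 / (2 * ε)))
      ≤ |x| / ε * ((√ε)⁻¹ * Real.exp (-x ^ 2 / (2 * ε))) := by gcongr
    _ = 1 / ε * (y * Real.exp (-(y ^ 2 / 2))) := by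
        rw [h2, hxy]; field_simp
    _ ≤ 1 / ε * 1 := by gcongr
    _ = 1 / ε := mul_one _

lemma continuous_heatKernelDeriv (ε : ℝ) : Continuous (heatKernelDeriv ε) := by
  have : heatKernelDeriv ε = fun x => -(x / ε) * heatKernel ε x :=
    funext fun x => heatKernelDeriv_eq ε x
  rw [this]
  unfold heatKernel
  fun_prop

/-- The Fourier coefficients of `ρ_ε'`. -/
noncomputable def heatCoeff (ε p : ℝ) : ℂ :=
  Complex.I * ((2 * Real.pi)⁻¹ * (p * Real.exp (-(ε / 2) * p ^ 2)) : ℝ)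

/-- The derivative of the Fourier coefficients of `ρ_ε'` in `ε`. -/
noncomputable def heatCoeffDeriv (ε p : ℝ) : ℂ :=
  -Complex.I * ((4 * Real.pi)⁻¹ * (p ^ 3 * Real.exp (-(ε / 2) * p ^ 2)) : ℝ)

lemma integrable_pow_mul_exp_neg {b : ℝ} (hb : 0 < b) (n : ℕ) :
    Integrable fun p : ℝ => p ^ n * Real.exp (-b * p ^ 2) := by
  have := integrable_rpow_mul_exp_neg_mul_sq hb (s := n) (by have := n.cast_nonneg (α := ℝ); linarith)
  simpa only [Real.rpow_natCast] using this

lemma integrable_heatCoeff {ε : ℝ} (hε : 0 < ε) : Integrable (heatCoeff ε) := by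
  have := integrable_pow_mul_exp_neg (half_pos hε) 1
  simp only [pow_one] at this
  exact ((this.const_mul _).ofReal).const_mul _

lemma integrable_heatCoeffDeriv {ε : ℝ} (hε : 0 < ε) : Integrable (heatCoeffDeriv ε) :=
  (((integrable_pow_mul_exp_neg (half_pos hε) 3).const_mul _).ofReal).const_mul _

/-- The growth is shared out as `|p|³ = |p|^{5/4} |p|^{7/4}`. The first factor is absorbed by the
weight. The second equals `ε^{-7/8} (ε p²)^{7/8}`, whose last factor is controlled by the Gaussian.
The power `-7/8 > -1` is integrable at zero. -/
lemma norm_heatCoeffDeriv_le {ε : ℝ} (hε : 0 < ε) (p : ℝ) :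
    ‖heatCoeffDeriv ε p‖ ≤ ε ^ (-(7 / 8) : ℝ) * weight p := by
  have hn : ‖heatCoeffDeriv ε p‖ =
      (4 * Real.pi)⁻¹ * (|p| ^ 3 * Real.exp (-(ε / 2) * p ^ 2)) := by
    rw [heatCoeffDeriv, norm_mul, norm_neg, Complex.norm_I, one_mul, Complex.norm_real,
      Real.norm_eq_abs, abs_mul, abs_mul, abs_pow, abs_of_pos (Real.exp_pos _),
      abs_of_pos (by positivity)]
  set z := ε * p ^ 2 with hz
  have hz0 : 0 ≤ z := by positivity
  have h1 : |p| ^ 3 = (p ^ 2) ^ (5 / 8 : ℝ) * (ε ^ (-(7 / 8) : ℝ) * z ^ (7 / 8 : ℝ)) := by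
    rw [hz, Real.mul_rpow hε.le (sq_nonneg p), ← mul_assoc (ε ^ _), ← Real.rpow_add hε,
      neg_add_cancel, Real.rpow_zero, one_mul,
      ← Real.rpow_add_of_nonneg (sq_nonneg p) (by norm_num) (by norm_num), ← sq_abs,
      ← Real.rpow_natCast |p| 2, ← Real.rpow_mul (abs_nonneg p), ← Real.rpow_natCast |p| 3]
    norm_num
  have h2 : z ^ (7 / 8 : ℝ) ≤ 1 + z := by
    calc z ^ (7 / 8 : ℝ) ≤ (1 + z) ^ (7 / 8 : ℝ) :=
          Real.rpow_le_rpow hz0 (by linarith) (by norm_num)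
      _ ≤ (1 + z) ^ (1 : ℝ) := Real.rpow_le_rpow_of_exponent_le (by linarith) (by norm_num)
      _ = 1 + z := Real.rpow_one _
  have h3 : (1 + z) * Real.exp (-(ε / 2) * p ^ 2) ≤ 2 := by
    rw [show -(ε / 2) * p ^ 2 = -(z / 2) by rw [hz]; ring, Real.exp_neg, ← div_eq_mul_inv,
      div_le_iff₀ (Real.exp_pos _)]
    have := Real.add_one_le_exp (z / 2)
    linarith
  have h4 : (p ^ 2) ^ (5 / 8 : ℝ) ≤ weight p :=
    Real.rpow_le_rpow (sq_nonneg p) (by linarith) (by norm_num)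
  have h5 : (4 * Real.pi)⁻¹ * 2 ≤ 1 := by
    rw [inv_mul_le_iff₀ (by positivity)]
    linarith [Real.pi_gt_three]
  have hw := one_le_weight p
  rw [hn, h1]
  calc (4 * Real.pi)⁻¹ * ((p ^ 2) ^ (5 / 8 : ℝ) * (ε ^ (-(7 / 8) : ℝ) * z ^ (7 / 8 : ℝ)) *
        Real.exp (-(ε / 2) * p ^ 2))
      ≤ (4 * Real.pi)⁻¹ * (weight p * (ε ^ (-(7 / 8) : ℝ) * (1 + z)) *
        Real.exp (-(ε / 2) * p ^ 2)) := by gcongr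
    _ = (4 * Real.pi)⁻¹ * ((1 + z) * Real.exp (-(ε / 2) * p ^ 2)) *
        (ε ^ (-(7 / 8) : ℝ) * weight p) := by ring
    _ ≤ (4 * Real.pi)⁻¹ * 2 * (ε ^ (-(7 / 8) : ℝ) * weight p) := by gcongr
    _ ≤ 1 * (ε ^ (-(7 / 8) : ℝ) * weight p) := by gcongr
    _ = _ := one_mul _

/-- The approximation `∫∫ ρ_ε'(x_t - y_s) ds dt` over the unit square. -/
noncomputable def squareApprox (ε : ℝ) (x y : UnitPath) : ℝ :=
  ∫ z in unitSquare, heatKernelDeriv ε (pathEval x z.2 - pathEval y z.1)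

lemma volume_restrict_unitSquare : (volume : Measure (ℝ × ℝ)).restrict unitSquare =
    (volume.restrict (Set.Icc (0 : ℝ) 1)).prod (volume.restrict (Set.Icc (0 : ℝ) 1)) := by
  rw [Measure.prod_restrict, unitSquare, Measure.volume_eq_prod]

instance : IsProbabilityMeasure ((volume : Measure (ℝ × ℝ)).restrict unitSquare) := by
  rw [volume_restrict_unitSquare]; infer_instance

lemma abs_squareApprox_le {ε : ℝ} (hε : 0 < ε) (x y : UnitPath) :
    |squareApprox ε x y| ≤ 1 / ε := by
  rw [squareApprox, ← Real.norm_eq_abs]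
  refine (norm_integral_le_of_norm_le_const (C := 1 / ε) (ae_of_all _ fun t => ?_)).trans (by simp)
  exact abs_heatKernelDeriv_le hε _

/-- The Fourier form of `ρ_ε'` separates the two times, so for fixed `p` the integral over the
square is a product of two occupation transforms. -/
lemma squareApprox_eq_pairing {ε : ℝ} (hε : 0 < ε) (x y : UnitPath) :
    (squareApprox ε x y : ℂ) = pairing (heatCoeff ε) x y := by
  have h1 : ∀ z : ℝ × ℝ, ((heatKernelDeriv ε (pathEval x z.2 - pathEval y z.1) : ℝ) : ℂ) =
      ∫ p : ℝ, heatCoeff ε p * (Complex.exp (Complex.I * (-p : ℝ) * pathEval y z.1) *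
        Complex.exp (Complex.I * p * pathEval x z.2)) := by
    intro z
    rw [heatKernelDeriv_eq_fourier hε, ← integral_const_mul]
    refine integral_congr_ae (ae_of_all _ fun p => ?_)
    simp only [heatCoeff]
    rw [← Complex.exp_add]
    push_cast
    have e1 : Complex.I * -(p : ℂ) * (pathEval y z.1) + Complex.I * p * pathEval x z.2 =
      Complex.I * p * (pathEval x z.2 - pathEval y z.1) := by ring
    have e2 : -(ε : ℂ) * (p : ℂ) ^ 2 / 2 = -(ε / 2) * (p : ℂ) ^ 2 := by ring
    rw [e1, e2]
    field_simp
  rw [squareApprox, ← integral_complex_ofReal]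
  simp only [h1]
  rw [integral_integral_swap]
  · refine integral_congr_ae (ae_of_all _ fun p => ?_)
    simp only
    rw [integral_const_mul, volume_restrict_unitSquare, integral_prod_mul
      (fun s => Complex.exp (Complex.I * (-p : ℝ) * pathEval y s))
      (fun t => Complex.exp (Complex.I * p * pathEval x t)), mul_comm (∫ s, _ ∂_)]
    rfl
  · refine ((integrable_heatCoeff hε).comp_snd (volume.restrict unitSquare)).mul_bdd (c := 1)
      (Measurable.aestronglyMeasurable ?_) (ae_of_all _ fun q => ?_)
    · fun_prop
    · rw [norm_mul, norm_cexp_I_mul_mul, norm_cexp_I_mul_mul, one_mul]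

/-- Conjugation amounts to the substitution `p ↦ -p`. It follows that no information is lost in
taking the real part in `squareDeriv`. -/
lemma conj_pairing {κ : ℝ → ℂ} (hκ : ∀ p, (starRingEnd ℂ) (κ p) = κ (-p)) (x y : UnitPath) :
    (starRingEnd ℂ) (pairing κ x y) = pairing κ x y := by
  unfold pairing
  rw [← integral_conj, ← integral_neg_eq_self]
  refine integral_congr_ae (ae_of_all _ fun p => ?_)
  simp only [map_mul, hκ, conj_pathFourier, neg_neg]

/-- The derivative in `ε` of the approximation over the unit square. -/
noncomputable def squareDeriv (ε : ℝ) (x y : UnitPath) : ℝ := (pairing (heatCoeffDeriv ε) x y).re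

lemma squareDeriv_eq_pairing (ε : ℝ) (x y : UnitPath) :
    (squareDeriv ε x y : ℂ) = pairing (heatCoeffDeriv ε) x y := by
  refine Complex.conj_eq_iff_re.1 (conj_pairing (fun p => ?_) x y)
  simp only [heatCoeffDeriv, map_mul, map_neg, Complex.conj_I, Complex.conj_ofReal]
  push_cast
  ring_nf

lemma norm_pairing_le {κ : ℝ → ℂ} (hκ : Integrable κ) (x y : UnitPath) :
    ‖pairing κ x y‖ ≤ ∫ p, ‖κ p‖ := by
  refine norm_integral_le_of_norm_le hκ.norm (ae_of_all _ fun p => ?_)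
  rw [norm_mul]
  exact mul_le_of_le_one_right (norm_nonneg _) (norm_pathFourier_mul_le _ _ _ _)

lemma exists_abs_squareDeriv_le {ε : ℝ} (hε : 0 < ε) :
    ∃ C, ∀ x y : UnitPath, |squareDeriv ε x y| ≤ C :=
  ⟨_, fun x y => (Complex.abs_re_le_norm _).trans
    (norm_pairing_le (integrable_heatCoeffDeriv hε) x y)⟩

lemma measurable_squareDeriv :
    Measurable fun q : ℝ × UnitPath × UnitPath => squareDeriv q.1 q.2.1 q.2.2 := by
  have h : Measurable fun q : (ℝ × UnitPath × UnitPath) × ℝ =>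
      heatCoeffDeriv q.1.1 q.2 * (pathFourier q.1.2.1 q.2 * pathFourier q.1.2.2 (-q.2)) := by
    unfold heatCoeffDeriv
    fun_prop
  exact Complex.measurable_re.comp (h.stronglyMeasurable.integral_prod_right' (ν := volume)).measurable

@[fun_prop]
lemma measurable_squareDeriv_comp {α : Type*} [MeasurableSpace α] {f : α → ℝ} {g h : α → UnitPath}
    (hf : Measurable f) (hg : Measurable g) (hh : Measurable h) :
    Measurable fun a => squareDeriv (f a) (g a) (h a) :=
  (measurable_squareDeriv.comp (hf.prodMk (hg.prodMk hh)) :)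

lemma measurable_squareApprox (ε : ℝ) :
    Measurable fun q : UnitPath × UnitPath => squareApprox ε q.1 q.2 := by
  have h : Measurable fun q : (UnitPath × UnitPath) × (ℝ × ℝ) =>
      heatKernelDeriv ε (pathEval q.1.1 q.2.2 - pathEval q.1.2 q.2.1) :=
    (continuous_heatKernelDeriv ε).measurable.comp (by fun_prop)
  exact (h.stronglyMeasurable.integral_prod_right' (ν := volume.restrict unitSquare)).measurable

lemma heatCoeff_sub {a b : ℝ} (p : ℝ) :
    heatCoeff b p - heatCoeff a p = ∫ ε in a..b, heatCoeffDeriv ε p := by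
  have hd : ∀ ε : ℝ, HasDerivAt (fun ε => heatCoeff ε p) (heatCoeffDeriv ε p) ε := by
    intro ε
    have h1 : HasDerivAt (fun ε : ℝ => (2 * Real.pi)⁻¹ * (p * Real.exp (-(ε / 2) * p ^ 2)))
        ((2 * Real.pi)⁻¹ * (p * (Real.exp (-(ε / 2) * p ^ 2) * (-(1 / 2) * p ^ 2)))) ε :=
      (((((hasDerivAt_id ε).div_const 2).neg.mul_const (p ^ 2)).exp).const_mul p).const_mul _
    refine (h1.ofReal_comp.const_mul Complex.I).congr_deriv ?_
    have h2 : (2 * Real.pi)⁻¹ * (p * (Real.exp (-(ε / 2) * p ^ 2) * (-(1 / 2) * p ^ 2))) =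
        -((4 * Real.pi)⁻¹ * (p ^ 3 * Real.exp (-(ε / 2) * p ^ 2))) := by
      rw [mul_inv, mul_inv]
      ring
    rw [h2, heatCoeffDeriv, Complex.ofReal_neg, mul_neg, neg_mul Complex.I]
  refine (intervalIntegral.integral_eq_sub_of_hasDerivAt (fun ε _ => hd ε) ?_).symm
  apply Continuous.intervalIntegrable
  unfold heatCoeffDeriv
  fun_prop

lemma integrable_squareDeriv_integrand {a b : ℝ} (ha : 0 < a) (x y : UnitPath) :
    Integrable (Function.uncurry fun ε p =>
      heatCoeffDeriv ε p * (pathFourier x p * pathFourier y (-p)))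
      ((volume.restrict (Set.Ioc a b)).prod volume) := by
  have hdom := ((integrable_heatCoeffDeriv ha).norm).comp_snd (volume.restrict (Set.Ioc a b))
  refine hdom.mono' (Measurable.aestronglyMeasurable ?_) ?_
  · unfold heatCoeffDeriv
    simp only [Function.uncurry_def]
    fun_prop
  · have : ∀ᵐ q ∂((volume.restrict (Set.Ioc a b)).prod (volume : Measure ℝ)),
        q.1 ∈ Set.Ioc a b :=
      Measure.quasiMeasurePreserving_fst.ae (ae_restrict_mem measurableSet_Ioc)
    filter_upwards [this] with q hq
    simp only [Function.uncurry_def]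
    rw [norm_mul]
    refine (mul_le_of_le_one_right (norm_nonneg _) (norm_pathFourier_mul_le _ _ _ _)).trans ?_
    simp only [heatCoeffDeriv, norm_mul, Complex.norm_real, Real.norm_eq_abs,
      abs_of_pos (Real.exp_pos _)]
    have := hq.1
    gcongr

lemma intervalIntegrable_squareDeriv {a b : ℝ} (ha : 0 < a) (hab : a ≤ b) (x y : UnitPath) :
    IntervalIntegrable (fun ε => squareDeriv ε x y) volume a b := by
  rw [intervalIntegrable_iff_integrableOn_Ioc_of_le hab]
  exact (integrable_squareDeriv_integrand ha x y).integral_prod_left.re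

/-- The fundamental theorem of calculus is applied to the Fourier coefficient for each `p`, and the
integrals in `ε` and `p` are then exchanged. Away from `ε = 0` the coefficient derivatives are
dominated by the one at `a`. -/
lemma squareApprox_sub {a b : ℝ} (ha : 0 < a) (hab : a ≤ b) (x y : UnitPath) :
    squareApprox b x y - squareApprox a x y = ∫ ε in a..b, squareDeriv ε x y := by
  have hb := ha.trans_le hab
  have hbd : ∀ {ε : ℝ}, 0 < ε → Integrable fun p =>
      heatCoeff ε p * (pathFourier x p * pathFourier y (-p)) := fun hε =>
    (integrable_heatCoeff hε).mul_bdd (c := 1) (Measurable.aestronglyMeasurable (by fun_prop))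
      (ae_of_all _ fun p => norm_pathFourier_mul_le _ _ _ _)
  apply Complex.ofReal_injective
  rw [Complex.ofReal_sub, squareApprox_eq_pairing ha, squareApprox_eq_pairing hb,
    ← intervalIntegral.integral_ofReal]
  simp only [squareDeriv_eq_pairing]
  unfold pairing
  rw [← integral_sub (hbd hb) (hbd ha), intervalIntegral.integral_of_le hab,
    integral_integral_swap (integrable_squareDeriv_integrand ha x y)]
  refine integral_congr_ae (ae_of_all _ fun p => ?_)
  simp only
  rw [← sub_mul, heatCoeff_sub, integral_mul_const, intervalIntegral.integral_of_le hab]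

/-- All even moments of the derivative of the approximation, uniformly in `ε`. -/
lemma exists_integral_squareDeriv_pow_le {W : Measure UnitPath} [IsProbabilityMeasure W]
    (hW : IsWiener W) (m : ℕ) :
    ∃ K : ℝ, 0 ≤ K ∧ ∀ ε : ℝ, 0 < ε →
      ∫ z, squareDeriv ε z.1 z.2 ^ (2 * m) ∂(W.prod W) ≤ (ε ^ (-(7 / 8) : ℝ)) ^ (2 * m) * K := by
  obtain ⟨K, hK, h⟩ := norm_integral_pairing_pow_le hW (2 * m)
  refine ⟨K, hK, fun ε hε => ?_⟩
  refine le_trans ?_ (h (heatCoeffDeriv ε) _ (integrable_heatCoeffDeriv hε) (by positivity)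
    (norm_heatCoeffDeriv_le hε))
  simp only [← squareDeriv_eq_pairing, ← Complex.ofReal_pow]
  rw [integral_complex_ofReal, Complex.norm_real]
  exact le_abs_self _

/-- The coefficient is odd in `p`. Both paths have the same law, so the product of the two
expectations is even in `p`, and the mean is the integral of an odd function. Centring is what later
yields square-root cancellation within a dyadic level. -/
lemma integral_squareDeriv_eq_zero {W : Measure UnitPath} [IsProbabilityMeasure W] {ε : ℝ}
    (hε : 0 < ε) : ∫ z, squareDeriv ε z.1 z.2 ∂(W.prod W) = 0 := by
  have h := integral_pairing_pow (W := W) (integrable_heatCoeffDeriv hε) 1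
  set J := ∫ p : Fin 1 → ℝ, (∏ j, heatCoeffDeriv ε (p j)) *
    ((∫ x, ∏ j, pathFourier x (p j) ∂W) * ∫ y, ∏ j, pathFourier y (-p j) ∂W) with hJ
  have hodd : J = -J := by
    conv_lhs => rw [hJ]
    rw [← integral_neg_eq_self, hJ, ← integral_neg]
    refine integral_congr_ae (ae_of_all _ fun p => ?_)
    simp only [Finset.univ_unique, Finset.prod_singleton, Pi.neg_apply, neg_neg]
    have : heatCoeffDeriv ε (-p default) = -heatCoeffDeriv ε (p default) := by
      simp only [heatCoeffDeriv]
      push_cast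
      ring_nf
    rw [this]
    ring
  have hJ0 : J = 0 := by linear_combination hodd / 2
  rw [hJ0] at h
  simp only [pow_one, ← squareDeriv_eq_pairing] at h
  rw [integral_complex_ofReal] at h
  exact_mod_cast h

end LeGallScheme

namespace LeGallScheme

/-! ### Moments of sums of independent centred random variables -/

/-- The linear term of the binomial expansion is kept exactly, because it vanishes in expectation
when `x` is centred and independent of `s`. Every later term is at most the bracket on the right, by
comparing `|x|` with `|s|`, and the binomial coefficients sum to at most `2^{2(m+1)}`. -/
lemma add_pow_le_taylor (m : ℕ) (s x : ℝ) :
    (s + x) ^ (2 * (m + 1)) ≤ s ^ (2 * (m + 1)) + (2 * (m + 1) : ℕ) * (s ^ (2 * m + 1) * x) +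
      2 ^ (2 * (m + 1)) * (s ^ (2 * m) * x ^ 2 + x ^ (2 * (m + 1))) := by
  set R := s ^ (2 * m) * x ^ 2 + x ^ (2 * (m + 1)) with hR
  have hs0 : 0 ≤ s ^ (2 * m) := (even_two_mul m).pow_nonneg s
  have hx0 : 0 ≤ x ^ (2 * (m + 1)) := (even_two_mul (m + 1)).pow_nonneg x
  have hR0 : 0 ≤ R := by positivity
  have hterm : ∀ i ∈ Finset.range (2 * m + 1), x ^ (i + 2) * s ^ (2 * m - i) ≤ R := by
    intro i hi
    have hi : i ≤ 2 * m := by have := Finset.mem_range.1 hi; omega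
    refine (le_abs_self _).trans ?_
    rw [abs_mul, abs_pow, abs_pow]
    rcases le_total |x| |s| with h | h
    · calc |x| ^ (i + 2) * |s| ^ (2 * m - i) = |x| ^ i * |s| ^ (2 * m - i) * |x| ^ 2 := by ring
        _ ≤ |s| ^ i * |s| ^ (2 * m - i) * |x| ^ 2 := by gcongr
        _ = s ^ (2 * m) * x ^ 2 := by
            rw [← pow_add, Nat.add_sub_cancel' hi, (even_two_mul m).pow_abs, sq_abs]
        _ ≤ R := by rw [hR]; linarith
    · calc |x| ^ (i + 2) * |s| ^ (2 * m - i) ≤ |x| ^ (i + 2) * |x| ^ (2 * m - i) := by gcongr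
        _ = x ^ (2 * (m + 1)) := by
            rw [← pow_add, show i + 2 + (2 * m - i) = 2 * (m + 1) by omega,
              (even_two_mul (m + 1)).pow_abs]
        _ ≤ R := by rw [hR]; nlinarith [mul_nonneg hs0 (sq_nonneg x)]
  have hchoose : ∑ i ∈ Finset.range (2 * m + 1), ((2 * (m + 1)).choose (i + 2) : ℝ) ≤
      2 ^ (2 * (m + 1)) := by
    have h := Nat.sum_range_choose (2 * (m + 1))
    rw [show 2 * (m + 1) + 1 = (2 * m + 1) + 1 + 1 by ring, Finset.sum_range_succ',
      Finset.sum_range_succ'] at h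
    have h' : ∑ i ∈ Finset.range (2 * m + 1), (2 * (m + 1)).choose (i + 1 + 1) ≤
        2 ^ (2 * (m + 1)) := by omega
    exact_mod_cast h'
  rw [add_comm s x, add_pow, show 2 * (m + 1) + 1 = (2 * m + 1) + 1 + 1 by ring,
    Finset.sum_range_succ', Finset.sum_range_succ']
  have hsum : ∑ i ∈ Finset.range (2 * m + 1),
      x ^ (i + 1 + 1) * s ^ (2 * (m + 1) - (i + 1 + 1)) * ((2 * (m + 1)).choose (i + 1 + 1) : ℝ) ≤
      2 ^ (2 * (m + 1)) * R := by
    calc _ ≤ ∑ i ∈ Finset.range (2 * m + 1), R * ((2 * (m + 1)).choose (i + 2) : ℝ) := by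
          refine Finset.sum_le_sum fun i hi => ?_
          rw [show 2 * (m + 1) - (i + 1 + 1) = 2 * m - i by omega]
          exact mul_le_mul_of_nonneg_right (hterm i hi) (Nat.cast_nonneg _)
      _ ≤ _ := by
          rw [← Finset.mul_sum, mul_comm]
          exact mul_le_mul_of_nonneg_right hchoose hR0
  have e1 : 2 * (m + 1) - (0 + 1) = 2 * m + 1 := by omega
  simp only [e1, zero_add, pow_one, Nat.choose_one_right, pow_zero, Nat.sub_zero, one_mul,
    Nat.choose_zero_right, Nat.cast_one, mul_one]
  linarith

lemma integrable_of_abs_le {Ω : Type*} [MeasurableSpace Ω] {P : Measure Ω} [IsFiniteMeasure P]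
    {f : Ω → ℝ} (hf : Measurable f) {C : ℝ} (hC : ∀ ω, |f ω| ≤ C) : Integrable f P :=
  Integrable.of_bound hf.aestronglyMeasurable C (ae_of_all _ hC)

/-- Even moments of sums of `N` independent centred variables grow at most like `N ^ m`. -/
lemma exists_integral_sum_pow_le (C : ℕ → ℝ) (hC : ∀ j, 0 ≤ C j) (m : ℕ) :
    ∃ K : ℝ, 0 ≤ K ∧ ∀ {Ω : Type*} [MeasurableSpace Ω] (P : Measure Ω) [IsProbabilityMeasure P]
      {ι : Type} (X : ι → Ω → ℝ), (∀ i, Measurable (X i)) → (∀ i, ∃ D, ∀ ω, |X i ω| ≤ D) →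
      iIndepFun X P → (∀ i, ∫ ω, X i ω ∂P = 0) → (∀ i j, ∫ ω, X i ω ^ (2 * j) ∂P ≤ C j) →
      ∀ s : Finset ι, ∫ ω, (∑ i ∈ s, X i ω) ^ (2 * m) ∂P ≤ K * (s.card : ℝ) ^ m := by
  induction m with
  | zero => exact ⟨1, zero_le_one, fun P _ ι X _ _ _ _ _ s => by simp⟩
  | succ m ih =>
    obtain ⟨K, hK, ih⟩ := ih
    set c : ℝ := 2 ^ (2 * (m + 1)) * (K * C 1 + C (m + 1)) with hc
    have hc0 : 0 ≤ c := by have := hC 1; have := hC (m + 1); positivity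
    refine ⟨c, hc0, fun P _ ι X hX hb hind h0 hmom s => ?_⟩
    classical
    induction s using Finset.induction_on with
    | empty => simp
    | insert a s ha ihs =>
      choose D hD using hb
      set S := fun ω => ∑ i ∈ s, X i ω with hS
      have hSm : Measurable S := Finset.measurable_sum _ fun i _ => hX i
      have hSb : ∀ ω, |S ω| ≤ ∑ i ∈ s, D i := fun ω =>
        (Finset.abs_sum_le_sum_abs _ _).trans (Finset.sum_le_sum fun i _ => hD i ω)
      have hint : ∀ k l : ℕ, Integrable (fun ω => S ω ^ k * X a ω ^ l) P := fun k l => by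
        refine integrable_of_abs_le ((hSm.pow_const k).mul ((hX a).pow_const l))
          (C := (∑ i ∈ s, D i) ^ k * D a ^ l) fun ω => ?_
        rw [abs_mul, abs_pow, abs_pow]
        have h1 := hSb ω
        have h2 := hD a ω
        have h3 := (abs_nonneg _).trans h1
        gcongr
      have hind' : IndepFun S (X a) P := by
        have := hind.indepFun_finsetSum_of_notMem hX ha
        convert this using 1
        ext ω
        simp [hS]
      have hprod : ∀ k l : ℕ, ∫ ω, S ω ^ k * X a ω ^ l ∂P =
          (∫ ω, S ω ^ k ∂P) * ∫ ω, X a ω ^ l ∂P := fun k l =>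
        (hind'.comp (measurable_id.pow_const k) (measurable_id.pow_const l)).integral_fun_mul_eq_mul_integral
          (hSm.pow_const k).aestronglyMeasurable ((hX a).pow_const l).aestronglyMeasurable
      have hs0 : ∀ k : ℕ, 0 ≤ ∫ ω, S ω ^ (2 * k) ∂P := fun k =>
        integral_nonneg fun ω => (even_two_mul k).pow_nonneg _
      have i1 : Integrable (fun ω => S ω ^ (2 * (m + 1))) P := by simpa using hint (2 * (m + 1)) 0
      have i2 : Integrable (fun ω => S ω ^ (2 * m + 1) * X a ω) P := by
        simpa using hint (2 * m + 1) 1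
      have i3 : Integrable (fun ω => S ω ^ (2 * m) * X a ω ^ 2) P := hint (2 * m) 2
      have i4 : Integrable (fun ω => X a ω ^ (2 * (m + 1))) P := by
        simpa using hint 0 (2 * (m + 1))
      have i5 : Integrable (fun ω => (S ω + X a ω) ^ (2 * (m + 1))) P := by
        refine integrable_of_abs_le ((hSm.add (hX a)).pow_const _)
          (C := (∑ i ∈ s, D i + D a) ^ (2 * (m + 1))) fun ω => ?_
        rw [abs_pow]
        exact pow_le_pow_left₀ (abs_nonneg _)
          ((abs_add_le _ _).trans (add_le_add (hSb ω) (hD a ω))) _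
      -- Independence and centring remove the linear term of the expansion.
      have hz : ∫ ω, S ω ^ (2 * m + 1) * X a ω ∂P = 0 := by
        have := hprod (2 * m + 1) 1
        simpa [h0 a] using this
      have hq : ∫ ω, S ω ^ (2 * m) * X a ω ^ 2 ∂P ≤ K * (s.card : ℝ) ^ m * C 1 := by
        rw [hprod]
        have h1 := hmom a 1
        rw [mul_one] at h1
        exact mul_le_mul (ih P X hX (fun i => ⟨D i, hD i⟩) hind h0 hmom s) h1
          (integral_nonneg fun ω => sq_nonneg _) (by positivity)
      have hmain : ∫ ω, (S ω + X a ω) ^ (2 * (m + 1)) ∂P ≤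
          ∫ ω, S ω ^ (2 * (m + 1)) ∂P +
            2 ^ (2 * (m + 1)) * (∫ ω, S ω ^ (2 * m) * X a ω ^ 2 ∂P +
              ∫ ω, X a ω ^ (2 * (m + 1)) ∂P) := by
        have e1 : ∫ ω, (S ω ^ (2 * (m + 1)) + (2 * (m + 1) : ℕ) * (S ω ^ (2 * m + 1) * X a ω) +
            2 ^ (2 * (m + 1)) * (S ω ^ (2 * m) * X a ω ^ 2 + X a ω ^ (2 * (m + 1)))) ∂P =
            ∫ ω, (S ω ^ (2 * (m + 1)) + (2 * (m + 1) : ℕ) * (S ω ^ (2 * m + 1) * X a ω)) ∂P +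
            ∫ ω, 2 ^ (2 * (m + 1)) * (S ω ^ (2 * m) * X a ω ^ 2 + X a ω ^ (2 * (m + 1))) ∂P :=
          integral_add (i1.add (i2.const_mul _)) ((i3.add i4).const_mul _)
        refine (integral_mono i5 ((i1.add (i2.const_mul _)).add ((i3.add i4).const_mul _))
          fun ω => add_pow_le_taylor m (S ω) (X a ω)).trans_eq ?_
        refine e1.trans ?_
        rw [integral_add i1 (i2.const_mul _), integral_const_mul, integral_const_mul, hz,
          integral_add i3 i4, mul_zero, add_zero]
      have hsum : ∀ ω, ∑ i ∈ insert a s, X i ω = S ω + X a ω := fun ω => by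
        rw [Finset.sum_insert ha, add_comm]
      simp only [hsum]
      rw [Finset.card_insert_of_notMem ha]
      set N : ℝ := (s.card : ℝ) with hN
      have hN0 : 0 ≤ N := Nat.cast_nonneg _
      have hC1 := hC 1
      have hCm := hC (m + 1)
      calc _ ≤ c * N ^ (m + 1) + 2 ^ (2 * (m + 1)) * (K * N ^ m * C 1 + C (m + 1)) := by
            refine hmain.trans (add_le_add ihs ?_)
            gcongr
            exact hmom a (m + 1)
        _ ≤ c * N ^ (m + 1) + c * (N + 1) ^ m := by
            have h1 : N ^ m ≤ (N + 1) ^ m := pow_le_pow_left₀ hN0 (by linarith) _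
            have h2 : 1 ≤ (N + 1) ^ m := one_le_pow₀ (by linarith)
            have h3 : K * N ^ m * C 1 + C (m + 1) ≤ (K * C 1 + C (m + 1)) * (N + 1) ^ m := by
              calc K * N ^ m * C 1 + C (m + 1)
                  ≤ K * (N + 1) ^ m * C 1 + C (m + 1) * (N + 1) ^ m := by
                    gcongr
                    exact le_mul_of_one_le_right hCm h2
                _ = _ := by ring
            have h4 := mul_le_mul_of_nonneg_left h3 (show (0 : ℝ) ≤ 2 ^ (2 * (m + 1)) by positivity)
            rw [← mul_assoc, ← hc] at h4
            linarith
        -- Replacing `N ^ m` by `(N + 1) ^ m` makes the two terms add up exactly to `c (N +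
        -- 1)^{m+1}`, so the constant does not grow as elements are inserted.
        _ ≤ c * (N * (N + 1) ^ m) + c * (N + 1) ^ m := by
            rw [pow_succ' N]
            gcongr
            linarith
        _ = c * ((s.card + 1 : ℕ) : ℝ) ^ (m + 1) := by
            push_cast
            ring

/-! ### Minkowski's inequality for integrals -/

/-- This is Hölder's inequality after the splitting `w = w^{1/q} · w^{1/r}` with conjugate
exponents, that is, Jensen's inequality for the unnormalised measure `w dμ`. -/
lemma lintegral_weight_mul_pow_le {α : Type*} [MeasurableSpace α] (μ : Measure α) {w g : α → ℝ≥0∞}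
    (hw : Measurable w) (hg : Measurable g) {q : ℕ} (hq : 2 ≤ q) :
    (∫⁻ a, w a * g a ∂μ) ^ q ≤ (∫⁻ a, w a ∂μ) ^ (q - 1) * ∫⁻ a, w a * g a ^ q ∂μ := by
  have hq1 : (1 : ℝ) < q := by exact_mod_cast hq
  have hq0 : (0 : ℝ) < q := by linarith
  have hconj : (q : ℝ).HolderConjugate (Real.conjExponent q) := Real.HolderConjugate.conjExponent hq1
  set r := Real.conjExponent q with hr
  have hr0 : 0 < r := hconj.symm.pos
  have hsplit : ∀ a, w a * g a = (w a ^ (1 / (q : ℝ)) * g a) * w a ^ (1 / r) := fun a => by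
    rw [mul_right_comm, ← ENNReal.rpow_add_of_nonneg _ _ (by positivity) (by positivity)]
    have := hconj.inv_add_inv_eq_one
    rw [one_div, one_div, this, ENNReal.rpow_one]
  have hH := ENNReal.lintegral_mul_le_Lp_mul_Lq μ hconj
    (f := fun a => w a ^ (1 / (q : ℝ)) * g a) (g := fun a => w a ^ (1 / r)) (by fun_prop) (by fun_prop)
  simp only [Pi.mul_apply, ← hsplit] at hH
  have e1 : ∀ a, (w a ^ (1 / (q : ℝ)) * g a) ^ (q : ℝ) = w a * g a ^ q := fun a => by
    rw [ENNReal.mul_rpow_of_nonneg _ _ hq0.le, ← ENNReal.rpow_mul, one_div_mul_cancel hq0.ne',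
      ENNReal.rpow_one, ENNReal.rpow_natCast]
  have e2 : ∀ a, (w a ^ (1 / r)) ^ r = w a := fun a => by
    rw [← ENNReal.rpow_mul, one_div_mul_cancel hr0.ne', ENNReal.rpow_one]
  simp only [e1, e2] at hH
  calc (∫⁻ a, w a * g a ∂μ) ^ q
      ≤ ((∫⁻ a, w a * g a ^ q ∂μ) ^ (1 / (q : ℝ)) * (∫⁻ a, w a ∂μ) ^ (1 / r)) ^ q := by gcongr
    _ = _ := by
        rw [mul_pow, ← ENNReal.rpow_natCast, ← ENNReal.rpow_mul, one_div_mul_cancel hq0.ne',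
          ENNReal.rpow_one, ← ENNReal.rpow_natCast ((∫⁻ a, w a ∂μ) ^ (1 / r)), ← ENNReal.rpow_mul,
          mul_comm, ← ENNReal.rpow_natCast _ (q - 1)]
        congr 2
        rw [Nat.cast_sub (by omega), Nat.cast_one]
        have h := hconj.inv_add_inv_eq_one
        rw [one_div]
        have : r⁻¹ = 1 - (q : ℝ)⁻¹ := by linarith
        rw [this, sub_mul, one_mul, inv_mul_cancel₀ hq0.ne']

/-- **Minkowski's inequality** in integral form: if `‖f(·, a)‖_q ≤ C^{1/q} w(a)` then
`‖∫ f(·, a) da‖_q ≤ C^{1/q} ∫ w(a) da`. -/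
lemma lintegral_lintegral_pow_le {Ω α : Type*} [MeasurableSpace Ω] [MeasurableSpace α]
    (P : Measure Ω) [SFinite P] (μ : Measure α) [SFinite μ] {f : Ω → α → ℝ≥0∞} {w : α → ℝ≥0∞}
    (hf : Measurable (Function.uncurry f)) (hw : Measurable w) {q : ℕ} (hq : 2 ≤ q) {C : ℝ≥0∞}
    (h : ∀ᵐ a ∂μ, w a ≠ 0 ∧ w a ≠ ∞ ∧ ∫⁻ ω, f ω a ^ q ∂P ≤ C * w a ^ q) :
    ∫⁻ ω, (∫⁻ a, f ω a ∂μ) ^ q ∂P ≤ C * (∫⁻ a, w a ∂μ) ^ q := by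
  set T := ∫⁻ a, w a ∂μ with hT
  have hgm : Measurable (Function.uncurry fun ω a => f ω a / w a) :=
    hf.div (hw.comp measurable_snd)
  -- Dividing `f` by `w` gives functions whose `q`-th moments are at most `C` for almost every `a`.
  -- The weighted Jensen inequality and Tonelli then finish.
  calc ∫⁻ ω, (∫⁻ a, f ω a ∂μ) ^ q ∂P
      = ∫⁻ ω, (∫⁻ a, w a * (f ω a / w a) ∂μ) ^ q ∂P := by
        refine lintegral_congr fun ω => ?_
        congr 1
        refine lintegral_congr_ae ?_
        filter_upwards [h] with a ha
        exact (ENNReal.mul_div_cancel ha.1 ha.2.1).symm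
    _ ≤ ∫⁻ ω, T ^ (q - 1) * ∫⁻ a, w a * (f ω a / w a) ^ q ∂μ ∂P :=
        lintegral_mono fun ω =>
          lintegral_weight_mul_pow_le μ hw (hgm.comp measurable_prodMk_left) hq
    _ = T ^ (q - 1) * ∫⁻ a, ∫⁻ ω, w a * (f ω a / w a) ^ q ∂P ∂μ := by
        have hm : Measurable (Function.uncurry fun ω a => w a * (f ω a / w a) ^ q) :=
          (hw.comp measurable_snd).mul (hgm.pow_const q)
        have hm' : Measurable fun ω => ∫⁻ a, w a * (f ω a / w a) ^ q ∂μ := hm.lintegral_prod_right'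
        rw [lintegral_const_mul _ hm', lintegral_lintegral_swap hm.aemeasurable]
    _ ≤ T ^ (q - 1) * ∫⁻ a, C * w a ∂μ := by
        refine mul_le_mul_right (lintegral_mono_ae ?_) _
        filter_upwards [h] with a ⟨h0, ht, hle⟩
        have hfa : Measurable fun ω => f ω a := hf.comp measurable_prodMk_right
        have hq0 : w a ^ q ≠ 0 := pow_ne_zero _ h0
        have hqt : w a ^ q ≠ ∞ := ENNReal.pow_ne_top ht
        have e : ∀ ω, w a * (f ω a / w a) ^ q = w a * (w a ^ q)⁻¹ * f ω a ^ q := fun ω => by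
          rw [div_eq_mul_inv, mul_pow, ENNReal.inv_pow]
          ring
        simp only [e]
        rw [lintegral_const_mul _ (hfa.pow_const q)]
        calc w a * (w a ^ q)⁻¹ * ∫⁻ ω, f ω a ^ q ∂P ≤ w a * (w a ^ q)⁻¹ * (C * w a ^ q) := by
              gcongr
          _ = C * w a * ((w a ^ q)⁻¹ * w a ^ q) := by ring
          _ = C * w a := by rw [ENNReal.inv_mul_cancel hq0 hqt, mul_one]
    _ = C * T ^ q := by
        rw [lintegral_const_mul _ hw, ← hT]
        obtain ⟨n, rfl⟩ : ∃ n, q = n + 1 := ⟨q - 1, by omega⟩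
        rw [Nat.add_sub_cancel, pow_succ]
        ring

/-! ### Dominated convergence in all `L^p` -/

lemma memLp_toReal_of_lintegral_pow_lt_top {Ω : Type*} [MeasurableSpace Ω] {P : Measure Ω}
    [IsFiniteMeasure P] {h : Ω → ℝ≥0∞} (hm : AEMeasurable h P)
    (hh : ∀ m : ℕ, 1 ≤ m → ∫⁻ ω, h ω ^ (2 * m) ∂P < ∞) {p : ℝ≥0∞} (hp : p ≠ ∞) :
    MemLp (fun ω => (h ω).toReal) p P := by
  obtain ⟨n, hn⟩ := exists_nat_ge p.toReal
  set m := n + 1 with hmdef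
  have hle : p ≤ ((2 * m : ℕ) : ℝ≥0∞) := by
    rw [← ENNReal.ofReal_toReal hp, ← ENNReal.ofReal_natCast]
    refine ENNReal.ofReal_le_ofReal (hn.trans ?_)
    exact_mod_cast (by omega)
  refine MemLp.mono_exponent (q := ((2 * m : ℕ) : ℝ≥0∞)) ⟨hm.ennreal_toReal.aestronglyMeasurable, ?_⟩ hle
  rw [eLpNorm_lt_top_iff_lintegral_rpow_enorm_lt_top (by simp [hmdef]) (ENNReal.natCast_ne_top _)]
  refine lt_of_le_of_lt (lintegral_mono fun ω => ?_) (hh m (by omega))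
  rw [ENNReal.toReal_natCast, ENNReal.rpow_natCast]
  gcongr
  rw [Real.enorm_eq_ofReal ENNReal.toReal_nonneg]
  exact ENNReal.ofReal_toReal_le

/-- The limit inherits the bound `H`, so `|F i - X| ≤ 2 H` and dominated convergence applies to
every power. One variable with all moments thus upgrades almost sure convergence to convergence in
every `L^p`. -/
lemma ConvergesAEAndLp.of_dominated {Ω ι : Type*} [MeasurableSpace Ω] {P : Measure Ω}
    {l : Filter ι} [l.IsCountablyGenerated] [l.NeBot]
    {F : ι → Ω → ℝ} {X H : Ω → ℝ} {s : Set ι} (hs : s ∈ l)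
    (hF : ∀ i ∈ s, AEStronglyMeasurable (F i) P)
    (hH : ∀ p : ℝ≥0∞, p ≠ ∞ → MemLp H p P) (hdom : ∀ᵐ ω ∂P, ∀ i ∈ s, |F i ω| ≤ H ω)
    (hlim : ∀ᵐ ω ∂P, Tendsto (fun i => F i ω) l (𝓝 (X ω))) :
    ConvergesAEAndLp P l F X := by
  have hXH : ∀ᵐ ω ∂P, |X ω| ≤ H ω := by
    filter_upwards [hdom, hlim] with ω h1 h2
    exact le_of_tendsto h2.abs (eventually_of_mem hs h1)
  have hXm : AEStronglyMeasurable X P := by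
    obtain ⟨u, hu⟩ := l.exists_seq_tendsto
    obtain ⟨N, hN⟩ := eventually_atTop.1 (hu.eventually_mem hs)
    refine aestronglyMeasurable_of_tendsto_ae atTop (f := fun n => F (u (n + N)))
      (fun n => hF _ (hN _ (by omega))) ?_
    filter_upwards [hlim] with ω hω
    exact (hω.comp hu).comp (tendsto_add_atTop_nat N)
  refine ⟨hlim, fun p hp0 hp => ?_⟩
  have hHp := hH p hp.ne
  refine ⟨eventually_of_mem hs fun i hi => ?_, ?_, ?_⟩
  · refine hHp.mono (hF i hi) ?_
    filter_upwards [hdom] with ω h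
    exact (h i hi).trans (le_abs_self _)
  · refine hHp.mono hXm ?_
    filter_upwards [hXH] with ω h
    exact h.trans (le_abs_self _)
  · have hp' : 0 < p.toReal := ENNReal.toReal_pos hp0.ne' hp.ne
    have hmain : Tendsto (fun i => ∫⁻ ω, ‖F i ω - X ω‖ₑ ^ p.toReal ∂P) l
        (𝓝 (∫⁻ _, 0 ∂P)) := by
      refine tendsto_lintegral_filter_of_dominated_convergence'
        (fun ω => ‖2 * H ω‖ₑ ^ p.toReal) ?_ ?_ ?_ ?_
      · filter_upwards [hs] with i hi
        exact ((hF i hi).sub hXm).enorm.pow_const _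
      · filter_upwards [hs] with i hi
        filter_upwards [hdom, hXH] with ω h1 h2
        refine ENNReal.rpow_le_rpow ?_ hp'.le
        rw [enorm_le_iff_norm_le, Real.norm_eq_abs, Real.norm_eq_abs]
        refine (abs_sub _ _).trans (le_trans ?_ (le_abs_self _))
        linarith [h1 i hi]
      · have := (hHp.const_mul 2).2
        rw [eLpNorm_lt_top_iff_lintegral_rpow_enorm_lt_top hp0.ne' hp.ne] at this
        exact this.ne
      · filter_upwards [hlim] with ω hω
        have h1 : Tendsto (fun i => ‖F i ω - X ω‖ₑ) l (𝓝 0) := by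
          have := (hω.sub_const (X ω)).enorm
          simpa using this
        have h2 := h1.ennrpow_const p.toReal
        rwa [ENNReal.zero_rpow_of_pos hp'] at h2
    rw [lintegral_zero] at hmain
    have := hmain.ennrpow_const (1 / p.toReal)
    rw [ENNReal.zero_rpow_of_pos (by positivity)] at this
    refine this.congr fun i => ?_
    rw [eLpNorm_eq_lintegral_rpow_enorm_toReal hp0.ne' hp.ne]

end LeGallScheme

namespace LeGallScheme

open scoped Matrix

/-! ### Brownian motions all of whose paths are continuous -/

/-- A pre-Brownian motion with measurable marginals all of whose paths are continuous. -/
structure IsContBrownian {Ω : Type*} [MeasurableSpace Ω] (B : ℝ≥0 → Ω → ℝ) (P : Measure Ω) :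
    Prop where
  pre : IsPreBrownianReal B P
  meas : ∀ t, Measurable (B t)
  cont : ∀ ω, Continuous fun t => B t ω

variable {Ω Ω' : Type*} [MeasurableSpace Ω] [MeasurableSpace Ω'] {P : Measure Ω} {P' : Measure Ω'}
  {B : ℝ≥0 → Ω → ℝ} {B' : ℝ≥0 → Ω' → ℝ}

/-- All paths are set to zero on a measurable null set containing the discontinuous ones. Outside it
the marginals agree with measurable versions at all nonnegative rational times, and continuity
transfers measurability to every time. -/
lemma exists_isContBrownian (hB : IsBrownianReal B P) :
    ∃ C : ℝ≥0 → Ω → ℝ, IsContBrownian C P ∧ ∀ᵐ ω ∂P, ∀ t, B t ω = C t ω := by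
  have hm := hB.aemeasurable
  have hae : ∀ᵐ ω ∂P, Continuous (fun t => B t ω) ∧ ∀ a b : ℕ,
      B ((a : ℝ≥0) / b) ω = (hm ((a : ℝ≥0) / b)).mk _ ω := by
    filter_upwards [hB.cont, ae_all_iff.2 fun a : ℕ => ae_all_iff.2 fun b : ℕ =>
      (hm ((a : ℝ≥0) / b)).ae_eq_mk] with ω h1 h2 using ⟨h1, h2⟩
  obtain ⟨N, hNsub, hNm, hN0⟩ := exists_measurable_superset_of_null (ae_iff.1 hae)
  have hG : ∀ ω ∈ Nᶜ, Continuous (fun t => B t ω) ∧ ∀ a b : ℕ,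
      B ((a : ℝ≥0) / b) ω = (hm ((a : ℝ≥0) / b)).mk _ ω := by
    intro ω hω
    by_contra h
    exact hω (hNsub h)
  have hNae : ∀ᵐ ω ∂P, ω ∈ Nᶜ := measure_eq_zero_iff_ae_notMem.1 hN0
  have heq : ∀ᵐ ω ∂P, ∀ t, B t ω = Nᶜ.indicator (B t) ω := by
    filter_upwards [hNae] with ω hω t
    rw [Set.indicator_of_mem hω]
  refine ⟨fun t => Nᶜ.indicator (B t), ⟨hB.toIsPreBrownianReal.congr fun t => ?_, fun t => ?_,
    fun ω => ?_⟩, heq⟩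
  · filter_upwards [heq] with ω hω using hω t
  · let q : ℕ → ℝ≥0 := fun j => (⌊(t : ℝ) * j⌋₊ : ℝ≥0) / (j : ℝ≥0)
    have hq : Tendsto q atTop (𝓝 t) := by
      rw [← NNReal.tendsto_coe]
      have := (tendsto_nat_floor_mul_div_atTop (R := ℝ) t.2).comp tendsto_natCast_atTop_atTop
      refine this.congr fun j => ?_
      simp [q]
    refine measurable_of_tendsto_metrizable
      (f := fun j => Nᶜ.indicator ((hm (q j)).mk _))
      (fun j => (hm (q j)).measurable_mk.indicator hNm.compl) ?_
    refine tendsto_pi_nhds.2 fun ω => ?_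
    by_cases hω : ω ∈ Nᶜ
    · simp only [Set.indicator_of_mem hω]
      have h1 := ((hG ω hω).1.tendsto t).comp hq
      refine h1.congr fun j => ?_
      exact (hG ω hω).2 _ _
    · simp only [Set.indicator_of_notMem hω]
      exact tendsto_const_nhds
  · by_cases hω : ω ∈ Nᶜ
    · simp only [Set.indicator_of_mem hω]
      exact (hG ω hω).1
    · simp only [Set.indicator_of_notMem hω]
      exact continuous_const

/-- The restriction of a continuous process to the unit interval, as a random path. -/
def toUnitPath (B : ℝ≥0 → Ω → ℝ) (hc : ∀ ω, Continuous fun t => B t ω) (ω : Ω) : UnitPath :=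
  ⟨fun u => B (unitInterval.toNNReal u) ω,
    (hc ω).comp (Continuous.subtype_mk continuous_subtype_val _)⟩

lemma pathEval_toUnitPath {Ω : Type*} {B : ℝ≥0 → Ω → ℝ} (hc : ∀ ω, Continuous fun t => B t ω) (ω : Ω) {t : ℝ}
    (ht : t ∈ Set.Icc (0 : ℝ) 1) : pathEval (toUnitPath B hc ω) t = B t.toNNReal ω := by
  simp only [pathEval, toUnitPath, Set.projIcc_of_mem zero_le_one ht]
  congr 1
  refine NNReal.eq ?_
  rw [Real.coe_toNNReal _ ht.1]
  rfl

lemma measurable_toUnitPath (hm : ∀ t, Measurable (B t)) (hc : ∀ ω, Continuous fun t => B t ω) :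
    Measurable (toUnitPath B hc) :=
  Measurable.subtype_mk (measurable_pi_lambda _ fun _ => hm _)

lemma IsContBrownian.isProbabilityMeasure (hB : IsContBrownian B P) : IsProbabilityMeasure P :=
  hB.pre.isGaussianProcess.isProbabilityMeasure

/-- Both laws are projective limits of the same finite-dimensional Gaussian laws, and such a limit
is unique. -/
lemma IsContBrownian.map_eq (hB : IsContBrownian B P) (hB' : IsContBrownian B' P') :
    P.map (fun ω t => B t ω) = P'.map (fun ω t => B' t ω) := by
  have h1 := isProjectiveLimit_map (measurable_pi_lambda _ hB.meas).aemeasurable (P := P)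
  have h2 := isProjectiveLimit_map (measurable_pi_lambda _ hB'.meas).aemeasurable (P := P')
  simp_rw [fun I => (hB.pre.hasLaw I).map_eq] at h1
  simp_rw [fun I => (hB'.pre.hasLaw I).map_eq] at h2
  exact h1.unique h2

/-- All Brownian motions induce the same law on continuous paths. -/
lemma IsContBrownian.map_toUnitPath_eq (hB : IsContBrownian B P) (hB' : IsContBrownian B' P') :
    P.map (toUnitPath B hB.cont) = P'.map (toUnitPath B' hB'.cont) := by
  ext s hs
  obtain ⟨S, hS, rfl⟩ := hs
  have hρ : Measurable fun (x : ℝ≥0 → ℝ) (u : unitInterval) => x (unitInterval.toNNReal u) :=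
    measurable_pi_lambda _ fun u => measurable_pi_apply _
  have key : ∀ {Ω : Type _} [MeasurableSpace Ω] {P : Measure Ω} {B : ℝ≥0 → Ω → ℝ}
      (hB : IsContBrownian B P), P.map (toUnitPath B hB.cont) (Subtype.val ⁻¹' S) =
      P.map (fun ω t => B t ω) ((fun (x : ℝ≥0 → ℝ) (u : unitInterval) =>
        x (unitInterval.toNNReal u)) ⁻¹' S) := by
    intro Ω _ P B hB
    rw [Measure.map_apply (measurable_toUnitPath hB.meas hB.cont) (measurable_subtype_coe hS),
      Measure.map_apply (measurable_pi_lambda _ hB.meas) (hρ hS)]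
    rfl
  have key' : P'.map (toUnitPath B' hB'.cont) (Subtype.val ⁻¹' S) =
      P'.map (fun ω t => B' t ω) ((fun (x : ℝ≥0 → ℝ) (u : unitInterval) =>
        x (unitInterval.toNNReal u)) ⁻¹' S) := by
    rw [Measure.map_apply (measurable_toUnitPath hB'.meas hB'.cont) (measurable_subtype_coe hS),
      Measure.map_apply (measurable_pi_lambda _ hB'.meas) (hρ hS)]
    rfl
  rw [key hB, key', hB.map_eq hB']

lemma integral_cexp_I_mul_of_hasLaw {X : Ω → ℝ} {v : ℝ≥0} (hX : HasLaw X (gaussianReal 0 v) P)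
    (u : ℝ) : ∫ ω, Complex.exp (Complex.I * u * X ω) ∂P =
      Complex.exp (-((v : ℝ) * u ^ 2 / 2 : ℝ)) := by
  have h := hX.integral_comp (f := fun x : ℝ => Complex.exp (u * x * Complex.I))
    (Continuous.aestronglyMeasurable (by fun_prop))
  rw [← charFun_apply_real, charFun_gaussianReal] at h
  have e : ∀ ω, Complex.exp (Complex.I * u * X ω) =
      ((fun x : ℝ => Complex.exp (u * x * Complex.I)) ∘ X) ω := fun ω => by
    simp only [Function.comp]
    congr 1
    ring
  simp only [e, h]
  congr 1
  push_cast
  ring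

/-- Summation by parts turns `∑ p_j B_{t_j}` into `∑ u_i D_i` with independent Gaussian increments
`D_i` of variance `s_i`, so the characteristic function factorises. -/
lemma IsContBrownian.isWiener (hB : IsContBrownian B P) :
    IsWiener (P.map (toUnitPath B hB.cont)) := by
  intro M p s hs0 hs1
  have hprob := hB.isProbabilityMeasure
  have hΘ := measurable_toUnitPath hB.meas hB.cont
  rw [integral_map hΘ.aemeasurable (Measurable.aestronglyMeasurable (by fun_prop))]
  -- The partition starts at `τ 0 = 0`, so the evaluation time with index `j` is `τ (j + 1)`.
  let τ : ℕ → ℝ≥0 := fun n => ∑ i : Fin M, if i.1 < n then (s i).toNNReal else 0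
  have hτm : Monotone τ := by
    intro a b hab
    refine Finset.sum_le_sum fun i _ => ?_
    by_cases h : i.1 < a
    · rw [if_pos h, if_pos (h.trans_le hab)]
    · rw [if_neg h]; exact zero_le
  have hτ0 : τ 0 = 0 := by simp [τ]
  have hτs : ∀ i : Fin M, τ (i + 1) = τ i + (s i).toNNReal := by
    intro i
    simp only [τ]
    rw [← Finset.sum_erase_add _ _ (Finset.mem_univ i),
      ← Finset.sum_erase_add (a := i) (f := fun j : Fin M => if j.1 < i.1 then (s j).toNNReal else 0)
        _ (Finset.mem_univ i)]
    simp only [Nat.lt_succ_self, if_true, lt_irrefl, if_false, add_zero]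
    congr 1
    refine Finset.sum_congr rfl fun j hj => ?_
    have hne : j.1 ≠ i.1 := fun h => (Finset.ne_of_mem_erase hj) (Fin.ext h)
    have : j.1 < i.1 + 1 ↔ j.1 < i.1 := by omega
    simp only [this]
  have hτt : ∀ j : Fin M, ((τ (j + 1) : ℝ≥0) : ℝ) = ((cumMat M)ᵀ *ᵥ s) j := by
    intro j
    rw [cumMat_transpose_mulVec]
    simp only [τ, NNReal.coe_sum]
    refine Finset.sum_congr rfl fun i _ => ?_
    have : i.1 < j.1 + 1 ↔ i ≤ j := by rw [Fin.le_def]; omega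
    simp only [this]
    split_ifs
    · exact Real.coe_toNNReal _ (hs0 i)
    · rfl
  let D : Fin M → Ω → ℝ := fun i ω => B (τ (i + 1)) ω - B (τ i) ω
  have hind : iIndepFun D P :=
    (hB.pre.hasIndepIncrements.nat hτm).precomp (g := fun i : Fin M => i.1) Fin.val_injective
  have hlaw : ∀ i, HasLaw (D i) (gaussianReal 0 (s i).toNNReal) P := by
    intro i
    have h := hB.pre.hasLaw_sub (τ (i + 1)) (τ i)
    have e : nndist ((τ (i + 1) : ℝ≥0) : ℝ) ((τ i : ℝ≥0) : ℝ) = (s i).toNNReal := by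
      rw [hτs i]
      apply NNReal.eq
      simp [Real.nndist_eq, Real.coe_toNNReal _ (hs0 i), abs_of_nonneg (hs0 i)]
    rw [← e]
    exact h
  set u := cumMat M *ᵥ p with hu
  have hmem : ∀ j, ((cumMat M)ᵀ *ᵥ s) j ∈ Set.Icc (0 : ℝ) 1 := by
    intro j
    rw [cumMat_transpose_mulVec]
    refine ⟨Finset.sum_nonneg fun i _ => by split_ifs <;> simp [hs0], le_trans ?_ hs1⟩
    exact Finset.sum_le_sum fun i _ => by split_ifs <;> simp [hs0]
  have hsum : ∀ᵐ ω ∂P, ∏ j, Complex.exp (Complex.I * p j *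
      pathEval (toUnitPath B hB.cont ω) (((cumMat M)ᵀ *ᵥ s) j)) =
      ∏ i, Complex.exp (Complex.I * u i * D i ω) := by
    filter_upwards [hB.pre.eval_zero_ae_eq_zero] with ω hω
    have hval : ∀ j : Fin M, pathEval (toUnitPath B hB.cont ω) (((cumMat M)ᵀ *ᵥ s) j) =
        ∑ i : Fin M, if i ≤ j then D i ω else 0 := by
      intro j
      rw [pathEval_toUnitPath _ _ (hmem j), ← hτt j, Real.toNNReal_coe]
      have h1 := Finset.sum_range_sub (fun n => B (τ n) ω) (j.1 + 1)
      rw [hτ0, hω, sub_zero] at h1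
      rw [← h1, ← Finset.sum_filter]
      refine (Finset.sum_nbij (fun i : Fin M => i.1) ?_ ?_ ?_ ?_).symm
      · intro i hi
        have := Fin.le_def.1 (Finset.mem_filter.1 hi).2
        exact Finset.mem_range.2 (by omega)
      · exact fun a _ b _ h => Fin.ext h
      · intro n hn
        have hn' : n < j.1 + 1 := by simpa using hn
        refine ⟨⟨n, by omega⟩, ?_, rfl⟩
        simp only [Finset.coe_filter, Finset.mem_univ, true_and, Set.mem_ofPred_eq, Fin.le_def]
        omega
      · intro i _
        rfl
    rw [← Complex.exp_sum, ← Complex.exp_sum]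
    congr 1
    have hreal : ∑ j, p j * pathEval (toUnitPath B hB.cont ω) (((cumMat M)ᵀ *ᵥ s) j) =
        ∑ i, u i * D i ω := by
      simp only [hval, hu, cumMat_mulVec, Finset.mul_sum, Finset.sum_mul]
      rw [Finset.sum_comm]
      refine Finset.sum_congr rfl fun i _ => Finset.sum_congr rfl fun j _ => ?_
      split_ifs <;> simp
    simp only [mul_assoc, ← Finset.mul_sum]
    congr 1
    exact_mod_cast hreal
  rw [integral_congr_ae hsum, hind.integral_fun_prod_comp
    (f := fun i x => Complex.exp (Complex.I * u i * (x : ℝ)))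
    (fun i => (hlaw i).aemeasurable) (fun i => Continuous.aestronglyMeasurable (by fun_prop))]
  refine Finset.prod_congr rfl fun i _ => ?_
  rw [integral_cexp_I_mul_of_hasLaw (hlaw i), Real.coe_toNNReal _ (hs0 i)]

/-! ### Rescaled pieces of a Brownian path on both sides of a time -/

lemma _root_.ProbabilityTheory.IsPreBrownianReal.covariance_increments
    (hB : IsPreBrownianReal B P) (a b a' b' : ℝ≥0) :
    cov[fun ω => B a ω - B b ω, fun ω => B a' ω - B b' ω; P] =
      min a a' - min a b' - min b a' + (min b b' : ℝ≥0) := by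
  have := hB.isGaussianProcess.isProbabilityMeasure
  have hL : ∀ t, MemLp (fun ω => B t ω) 2 P := fun t =>
    (hB.isGaussianProcess.hasGaussianLaw_eval t).memLp_two
  rw [covariance_fun_sub_fun_sub (hL _) (hL _) (hL _) (hL _)]
  simp only [hB.covariance_fun_eval]

/-- The Brownian motion `t ↦ B_{c-t} - B_c`, continued after time `c` by the increments of `B`. -/
def reverseAt (B : ℝ≥0 → Ω → ℝ) (c t : ℝ≥0) (ω : Ω) : ℝ :=
  (B (max t c) ω - B c ω) - (B c ω - B (c - t) ω)

/-- The process is linear in `B`, hence Gaussian, so it suffices to check that it is centred with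
covariance `min s t`. Truncated subtraction makes `c - t = 0` after time `c`, where the increments
of `B` beyond `c` take over. This continuation gives a Brownian motion on all of `[0, ∞)`. -/
lemma _root_.ProbabilityTheory.IsPreBrownianReal.reverseAt (hB : IsPreBrownianReal B P) (c : ℝ≥0) :
    IsPreBrownianReal (reverseAt B c) P := by
  have := hB.isGaussianProcess.isProbabilityMeasure
  have hI : ∀ t, Integrable (B t) P := hB.integrable_eval
  have hL : ∀ s t, MemLp (fun ω => B s ω - B t ω) 2 P := fun s t =>
    hB.isGaussianProcess.hasGaussianLaw_fun_sub.memLp_two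
  refine IsGaussianProcess.isPreBrownianReal_of_covariance ?_ (fun t => ?_) (fun s t hst => ?_)
  · apply hB.isGaussianProcess.of_isGaussianProcess
    intro t
    exact ⟨{max t c, c, c - t},
      { toFun x := (x ⟨max t c, by simp⟩ - x ⟨c, by simp⟩) - (x ⟨c, by simp⟩ - x ⟨c - t, by simp⟩)
        map_add' x y := by simp; ring
        map_smul' r x := by simp; ring }, by simp [LeGallScheme.reverseAt]⟩
  · simp only [LeGallScheme.reverseAt]
    rw [integral_sub ((hL _ _).integrable one_le_two) ((hL _ _).integrable one_le_two),
      integral_sub (hI _) (hI _),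
      integral_sub (hI _) (hI _)]
    simp [hB.integral_eval]
  · unfold LeGallScheme.reverseAt
    rw [covariance_fun_sub_fun_sub (hL _ _) (hL _ _) (hL _ _) (hL _ _)]
    simp only [hB.covariance_increments]
    have e1 : min (max s c) (max t c) = max s c := min_eq_left (max_le_max_right _ hst)
    have e2 : min (max s c) c = c := min_eq_right (le_max_right _ _)
    have e3 : min c (max t c) = c := min_eq_left (le_max_right _ _)
    have e4 : ∀ r, min (max r c) (c - t) = c - t := fun r =>
      min_eq_right (tsub_le_self.trans (le_max_right _ _))
    have e5 : min c (c - t) = c - t := min_eq_right tsub_le_self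
    have e6 : min (c - s) c = c - s := min_eq_left tsub_le_self
    have e7 : min (c - s) (max t c) = c - s := min_eq_left (tsub_le_self.trans (le_max_right _ _))
    have e8 : min (c - s) (c - t) = c - t := min_eq_right (tsub_le_tsub_left hst c)
    rw [e1, e2, e3, e4, e5, e6, e7, e8, min_self]
    rcases le_total s c with h | h
    · rw [max_eq_right h, NNReal.coe_sub h]; ring
    · rw [max_eq_left h, tsub_eq_zero_of_le h]; push_cast; ring

/-- The Brownian path after time `c`, at scale `δ`. -/
noncomputable def rightPart (B : ℝ≥0 → Ω → ℝ) (c δ t : ℝ≥0) (ω : Ω) : ℝ :=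
  (√(δ : ℝ))⁻¹ * (B (c + δ * t) ω - B c ω)

/-- The time-reversed Brownian path before time `c`, at scale `δ`. -/
noncomputable def leftPart (B : ℝ≥0 → Ω → ℝ) (c δ t : ℝ≥0) (ω : Ω) : ℝ :=
  (√(δ : ℝ))⁻¹ * reverseAt B c (δ * t) ω

lemma IsContBrownian.rightPart (hB : IsContBrownian B P) (c : ℝ≥0) {δ : ℝ≥0} (hδ : δ ≠ 0) :
    IsContBrownian (rightPart B c δ) P where
  pre := (hB.pre.shift c).smul hδ
  meas t := ((hB.meas _).sub (hB.meas _)).const_mul _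
  cont ω := by
    have := hB.cont ω
    unfold LeGallScheme.rightPart
    fun_prop

lemma IsContBrownian.leftPart (hB : IsContBrownian B P) (c : ℝ≥0) {δ : ℝ≥0} (hδ : δ ≠ 0) :
    IsContBrownian (leftPart B c δ) P where
  pre := (hB.pre.reverseAt c).smul hδ
  meas t := (((hB.meas _).sub (hB.meas _)).sub ((hB.meas _).sub (hB.meas _))).const_mul _
  cont ω := by
    have := hB.cont ω
    unfold LeGallScheme.leftPart LeGallScheme.reverseAt
    fun_prop

lemma leftPart_of_le {Ω : Type*} {B : ℝ≥0 → Ω → ℝ} {c δ t : ℝ≥0} (h : δ * t ≤ c) (ω : Ω) :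
    leftPart B c δ t ω = (√(δ : ℝ))⁻¹ * (B (c - δ * t) ω - B c ω) := by
  rw [leftPart, reverseAt, max_eq_right h]
  ring

/-- The pair of rescaled paths on both sides of the time `c`. -/
noncomputable def sidePaths (hB : IsContBrownian B P) (c : ℝ≥0) {δ : ℝ≥0} (hδ : δ ≠ 0) (ω : Ω) :
    UnitPath × UnitPath :=
  (toUnitPath (rightPart B c δ) (hB.rightPart c hδ).cont ω,
    toUnitPath (leftPart B c δ) (hB.leftPart c hδ).cont ω)

lemma measurable_sidePaths (hB : IsContBrownian B P) (c : ℝ≥0) {δ : ℝ≥0} (hδ : δ ≠ 0) :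
    Measurable (sidePaths hB c hδ) :=
  (measurable_toUnitPath (hB.rightPart c hδ).meas _).prodMk
    (measurable_toUnitPath (hB.leftPart c hδ).meas _)

lemma mul_toNNReal_le (δ : ℝ≥0) (u : unitInterval) : δ * unitInterval.toNNReal u ≤ δ :=
  mul_le_of_le_one_right zero_le (by exact_mod_cast u.2.2)

/-- The right path is built from increments after `c`. Because `δ ≤ c`, the left path on `[0,1]`
uses only values of `B` up to time `c`, never the artificial continuation in `reverseAt`. The Markov
property makes the two independent, and each is a rescaled Brownian motion. -/
lemma map_sidePaths (hB : IsContBrownian B P) {c δ : ℝ≥0} (hδ : δ ≠ 0) (hδc : δ ≤ c) :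
    P.map (sidePaths hB c hδ) =
      (P.map (toUnitPath B hB.cont)).prod (P.map (toUnitPath B hB.cont)) := by
  have := hB.isProbabilityMeasure
  have hR := hB.rightPart c hδ
  have hL := hB.leftPart c hδ
  have hind : IndepFun (toUnitPath (rightPart B c δ) hR.cont)
      (toUnitPath (leftPart B c δ) hL.cont) P := by
    rw [IndepFun_iff_Indep]
    refine indep_of_indep_of_le ((IndepFun_iff_Indep _ _ _).1 (hB.pre.indepFun_shift c)) ?_ ?_
    · set Z := fun (ω : Ω) (t : ℝ≥0) => B (c + t) ω - B c ω
      rw [← measurable_iff_comap_le]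
      refine Measurable.subtype_mk (@measurable_pi_lambda _ _ _ (_) _ _ fun u => ?_)
      have h1 : Measurable fun z : ℝ≥0 → ℝ =>
          (√(δ : ℝ))⁻¹ * z (δ * unitInterval.toNNReal u) := by fun_prop
      exact h1.comp (comap_measurable Z)
    · set Z := fun (ω : Ω) (t : Set.Iic c) => B t ω
      rw [← measurable_iff_comap_le]
      refine Measurable.subtype_mk (@measurable_pi_lambda _ _ _ (_) _ _ fun u => ?_)
      have h1 : Measurable fun z : Set.Iic c → ℝ => (√(δ : ℝ))⁻¹ *
          (z ⟨c - δ * unitInterval.toNNReal u, Set.mem_Iic.2 tsub_le_self⟩ - z ⟨c, Set.self_mem_Iic⟩) := by fun_prop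
      have h2 := h1.comp (comap_measurable Z)
      convert h2 using 1
      ext ω
      exact leftPart_of_le ((mul_toNNReal_le δ u).trans hδc) ω
  have h := (indepFun_iff_map_prod_eq_prod_map_map
    (measurable_toUnitPath hR.meas hR.cont).aemeasurable
    (measurable_toUnitPath hL.meas hL.cont).aemeasurable).1 hind
  rw [hR.map_toUnitPath_eq hB, hL.map_toUnitPath_eq hB] at h
  exact h

/-- All increments from the midpoints form one Gaussian family. Those with different `k` live on
time intervals that do not overlap, so they are uncorrelated, and zero covariance between the blocks
gives their joint independence. The Boolean selects the side of the midpoint. -/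
lemma iIndepFun_sidePaths {ι : Type*} (hB : IsContBrownian B P) {δ : ℝ≥0} (hδ : δ ≠ 0)
    (c : ι → ℝ≥0) (hδc : ∀ k, δ ≤ c k)
    (hsep : ∀ k l, k ≠ l → c k + δ ≤ c l - δ ∨ c l + δ ≤ c k - δ) :
    iIndepFun (fun k => sidePaths hB (c k) hδ) P := by
  let hi : ι → Bool × unitInterval → ℝ≥0 := fun k q =>
    if q.1 then c k + δ * unitInterval.toNNReal q.2 else c k
  let lo : ι → Bool × unitInterval → ℝ≥0 := fun k q =>
    if q.1 then c k else c k - δ * unitInterval.toNNReal q.2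
  let Z : ι → Bool × unitInterval → Ω → ℝ := fun k q ω => B (hi k q) ω - B (lo k q) ω
  have hhi : ∀ k q, c k - δ ≤ hi k q ∧ hi k q ≤ c k + δ := fun k q => by
    simp only [hi]
    split_ifs
    · exact ⟨tsub_le_self.trans le_self_add, add_le_add_right (mul_toNNReal_le _ _) _⟩
    · exact ⟨tsub_le_self, le_self_add⟩
  have hlo : ∀ k q, c k - δ ≤ lo k q ∧ lo k q ≤ c k + δ := fun k q => by
    simp only [lo]
    split_ifs
    · exact ⟨tsub_le_self, le_self_add⟩
    · exact ⟨tsub_le_tsub_left (mul_toNNReal_le _ _) _, tsub_le_self.trans le_self_add⟩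
  have hZ : iIndepFun (fun k ω q => Z k q ω) P := by
    apply IsGaussianProcess.iIndepFun_of_covariance_eq_zero
    · apply hB.pre.isGaussianProcess.of_isGaussianProcess
      rintro ⟨k, q⟩
      exact ⟨{hi k q, lo k q},
        { toFun x := x ⟨hi k q, by simp⟩ - x ⟨lo k q, by simp⟩
          map_add' x y := by simp; ring
          map_smul' r x := by simp; ring }, by simp [Z]⟩
    · exact fun k q => ((hB.meas _).sub (hB.meas _)).aemeasurable
    · intro k l hkl q r
      simp only [Z]
      rw [hB.pre.covariance_increments]
      rcases hsep k l hkl with h | h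
      · have h1 : ∀ {x y : ℝ≥0}, x ≤ c k + δ → c l - δ ≤ y → min x y = x := fun hx hy =>
          min_eq_left (hx.trans (h.trans hy))
        rw [h1 (hhi k q).2 (hhi l r).1, h1 (hhi k q).2 (hlo l r).1, h1 (hlo k q).2 (hhi l r).1,
          h1 (hlo k q).2 (hlo l r).1]
        ring
      · have h1 : ∀ {x y : ℝ≥0}, c k - δ ≤ x → y ≤ c l + δ → min x y = y := fun hx hy =>
          min_eq_right (hy.trans (h.trans hx))
        rw [h1 (hhi k q).1 (hhi l r).2, h1 (hhi k q).1 (hlo l r).2, h1 (hlo k q).1 (hhi l r).2,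
          h1 (hlo k q).1 (hlo l r).2]
        ring
  rw [iIndepFun_iff_iIndep] at hZ ⊢
  refine iIndep_of_iIndep_of_le hZ fun k => ?_
  set Y := fun (ω : Ω) (q : Bool × unitInterval) => Z k q ω with hY
  rw [← measurable_iff_comap_le]
  refine Measurable.prodMk ?_ ?_
  · refine Measurable.subtype_mk (@measurable_pi_lambda _ _ _ (_) _ _ fun u => ?_)
    have h1 : Measurable fun z : Bool × unitInterval → ℝ =>
        (√(δ : ℝ))⁻¹ * z (true, u) := by fun_prop
    exact h1.comp (comap_measurable Y)
  · refine Measurable.subtype_mk (@measurable_pi_lambda _ _ _ (_) _ _ fun u => ?_)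
    have h1 : Measurable fun z : Bool × unitInterval → ℝ =>
        (√(δ : ℝ))⁻¹ * -z (false, u) := by fun_prop
    have h2 := h1.comp (comap_measurable Y)
    convert h2 using 1
    ext ω
    rw [leftPart_of_le ((mul_toNNReal_le δ u).trans (hδc k))]
    simp only [hY, Z, hi, lo, Function.comp, Bool.false_eq_true, if_false]
    ring

end LeGallScheme

namespace LeGallScheme

/-! ### Change of variables on a dyadic square -/

lemma setIntegral_square_eq {h : ℝ × ℝ → ℝ} (hh : Continuous h) (c δ : ℝ) (hδ : 0 < δ) :
    ∫ z in Set.Ico (c - δ) c ×ˢ Set.Ioc c (c + δ), h z =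
      δ ^ 2 * ∫ z in unitSquare, h (c - δ * z.1, c + δ * z.2) := by
  have hint : IntegrableOn h (Set.Ico (c - δ) c ×ˢ Set.Ioc c (c + δ)) :=
    (hh.continuousOn.integrableOn_compact (isCompact_Icc.prod isCompact_Icc)).mono_set
      (Set.prod_mono Set.Ico_subset_Icc_self Set.Ioc_subset_Icc_self)
  have hint' : IntegrableOn (fun z : ℝ × ℝ => h (c - δ * z.1, c + δ * z.2)) unitSquare :=
    ContinuousOn.integrableOn_compact (isCompact_Icc.prod isCompact_Icc) (by fun_prop)
  rw [unitSquare, Measure.volume_eq_prod] at *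
  rw [setIntegral_prod _ hint, setIntegral_prod _ hint', integral_Ico_eq_integral_Ioo,
    ← integral_Ioc_eq_integral_Ioo, ← intervalIntegral.integral_of_le (by linarith),
    integral_Icc_eq_integral_Ioc, ← intervalIntegral.integral_of_le zero_le_one]
  have hin : ∀ s, ∫ t in Set.Ioc c (c + δ), h (s, t) =
      δ * ∫ t in Set.Icc (0 : ℝ) 1, h (s, c + δ * t) := by
    intro s
    rw [← intervalIntegral.integral_of_le (by linarith), integral_Icc_eq_integral_Ioc,
      ← intervalIntegral.integral_of_le zero_le_one]
    have := intervalIntegral.smul_integral_comp_add_mul (a := 0) (b := 1) (fun t => h (s, t)) δ c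
    simp only [mul_zero, add_zero, mul_one, smul_eq_mul] at this
    exact this.symm
  simp only [hin]
  rw [intervalIntegral.integral_const_mul]
  have := intervalIntegral.smul_integral_comp_sub_mul (a := 0) (b := 1)
    (fun s => ∫ t in Set.Icc (0 : ℝ) 1, h (s, c + δ * t)) δ c
  simp only [mul_zero, sub_zero, mul_one, smul_eq_mul] at this
  rw [← this]
  ring

/-- Brownian scaling of `δ'`: together with the area factor `δ ^ 2` of a square of side `δ` it
leaves the factor `δ`, which is the source of `2^{-n}`. -/
lemma heatKernelDeriv_sqrt_mul {ε δ : ℝ} (hε : 0 < ε) (hδ : 0 < δ) (x : ℝ) :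
    heatKernelDeriv ε (√δ * x) = δ⁻¹ * heatKernelDeriv (δ⁻¹ * ε) x := by
  have hs : 0 < √δ := Real.sqrt_pos.2 hδ
  have hs2 : √δ ^ 2 = δ := Real.sq_sqrt hδ.le
  have h1 : √(2 * Real.pi * (δ⁻¹ * ε)) = √(2 * Real.pi * ε) / √δ := by
    rw [← Real.sqrt_div (by positivity)]
    congr 1
    field_simp
  have h2 : -(√δ * x) ^ 2 / (2 * ε) = -x ^ 2 / (2 * (δ⁻¹ * ε)) := by
    rw [mul_pow, hs2]
    field_simp
  have h3 : 0 < √(2 * Real.pi * ε) := Real.sqrt_pos.2 (by positivity)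
  rw [heatKernelDeriv_eq, heatKernelDeriv_eq, heatKernel, heatKernel, h1, h2]
  field_simp

/-- The midpoint of the dyadic square with indices `n`, `k`. -/
noncomputable def dyadicMid (n k : ℕ) : ℝ≥0 := ((2 * k - 1 : ℕ) : ℝ≥0) * ((2 : ℝ≥0) ^ n)⁻¹

lemma dyadicScale_ne_zero (n : ℕ) : ((2 : ℝ≥0) ^ n)⁻¹ ≠ 0 := by positivity

lemma dyadicScale_le_dyadicMid {n k : ℕ} (hk : 1 ≤ k) : ((2 : ℝ≥0) ^ n)⁻¹ ≤ dyadicMid n k :=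
  le_mul_of_one_le_left zero_le (by exact_mod_cast (by omega : 1 ≤ 2 * k - 1))

lemma coe_dyadicMid {n k : ℕ} (hk : 1 ≤ k) :
    (dyadicMid n k : ℝ) = (2 * (k : ℝ) - 1) * ((2 : ℝ) ^ n)⁻¹ := by
  have : ((2 * k - 1 : ℕ) : ℝ) = 2 * (k : ℝ) - 1 := by
    rw [Nat.cast_sub (by omega)]
    push_cast
    ring
  rw [dyadicMid, NNReal.coe_mul, NNReal.coe_natCast, this]
  simp

lemma dyadicSquare_eq {n k : ℕ} (hk : 1 ≤ k) : dyadicSquare n k =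
    Set.Ico ((dyadicMid n k : ℝ) - ((2 : ℝ) ^ n)⁻¹) (dyadicMid n k) ×ˢ
      Set.Ioc (dyadicMid n k : ℝ) (dyadicMid n k + ((2 : ℝ) ^ n)⁻¹) := by
  rw [dyadicSquare, coe_dyadicMid hk]
  simp only [div_eq_mul_inv]
  congr 2 <;> ring

variable {Ω : Type*} [MeasurableSpace Ω] {P : Measure Ω} {B : ℝ≥0 → Ω → ℝ}

/-- The approximation over a dyadic square is a rescaled approximation over the unit square. -/
lemma localTimeDerivApprox_dyadicSquare (hB : IsContBrownian B P) {n k : ℕ} (hk : 1 ≤ k) {ε : ℝ}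
    (hε : 0 < ε) (ω : Ω) :
    localTimeDerivApprox (dyadicSquare n k) B B ε ω =
      ((2 : ℝ) ^ n)⁻¹ * squareApprox (2 ^ n * ε)
        (sidePaths hB (dyadicMid n k) (dyadicScale_ne_zero n) ω).1
        (sidePaths hB (dyadicMid n k) (dyadicScale_ne_zero n) ω).2 := by
  set δ : ℝ := ((2 : ℝ) ^ n)⁻¹ with hδdef
  have hδ : 0 < δ := by positivity
  have hδ' : (2 : ℝ) ^ n = δ⁻¹ := by simp [hδdef]
  have hδc : (((2 : ℝ≥0) ^ n)⁻¹ : ℝ≥0) = δ.toNNReal := by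
    apply NNReal.eq
    rw [Real.coe_toNNReal _ hδ.le]
    simp [hδdef]
  have hδcoe : ((((2 : ℝ≥0) ^ n)⁻¹ : ℝ≥0) : ℝ) = δ := by simp [hδdef]
  set c := dyadicMid n k with hc
  have hcδ : δ ≤ c := by
    rw [← hδcoe]
    exact_mod_cast dyadicScale_le_dyadicMid hk
  have hcont : Continuous fun z : ℝ × ℝ =>
      heatKernelDeriv ε (B z.2.toNNReal ω - B z.1.toNNReal ω) := by
    have h1 := hB.cont ω
    have h2 := continuous_heatKernelDeriv ε
    have h3 := continuous_real_toNNReal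
    fun_prop
  rw [localTimeDerivApprox, dyadicSquare_eq hk, setIntegral_square_eq hcont _ _ hδ, squareApprox,
    hδ']
  have : δ ^ 2 * ∫ z in unitSquare, heatKernelDeriv ε
      (B ((c : ℝ) + δ * z.2).toNNReal ω - B ((c : ℝ) - δ * z.1).toNNReal ω) =
      δ ^ 2 * ∫ z in unitSquare, δ⁻¹ * heatKernelDeriv (δ⁻¹ * ε)
        (pathEval (sidePaths hB c (dyadicScale_ne_zero n) ω).1 z.2 -
          pathEval (sidePaths hB c (dyadicScale_ne_zero n) ω).2 z.1) := by
    congr 1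
    refine setIntegral_congr_fun (measurableSet_Icc.prod measurableSet_Icc) fun z hz => ?_
    rw [← heatKernelDeriv_sqrt_mul hε hδ]
    congr 1
    simp only [sidePaths]
    rw [pathEval_toUnitPath _ _ hz.2, pathEval_toUnitPath _ _ hz.1]
    have hs : δ.toNNReal * z.1.toNNReal ≤ c := by
      rw [← NNReal.coe_le_coe]
      rw [NNReal.coe_mul, Real.coe_toNNReal _ hδ.le, Real.coe_toNNReal _ hz.1.1]
      have := hz.1.2
      nlinarith
    rw [leftPart_of_le (by rw [hδc]; exact hs), rightPart, hδcoe, hδc]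
    have e1 : ((c : ℝ) + δ * z.2).toNNReal = c + δ.toNNReal * z.2.toNNReal := by
      rw [Real.toNNReal_add (NNReal.coe_nonneg c) (mul_nonneg hδ.le hz.2.1), Real.toNNReal_coe,
        Real.toNNReal_mul hδ.le]
    have e2 : ((c : ℝ) - δ * z.1).toNNReal = c - δ.toNNReal * z.1.toNNReal := by
      rw [← Real.toNNReal_mul hδ.le]
      apply NNReal.eq
      rw [NNReal.coe_sub (by rwa [Real.toNNReal_mul hδ.le]),
        Real.coe_toNNReal _ (mul_nonneg hδ.le hz.1.1), Real.coe_toNNReal]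
      rw [← NNReal.coe_le_coe, NNReal.coe_mul, Real.coe_toNNReal _ hδ.le,
        Real.coe_toNNReal _ hz.1.1] at hs
      linarith
    rw [e1, e2]
    have : √δ ≠ 0 := (Real.sqrt_pos.2 hδ).ne'
    field_simp
    ring
  rw [this, integral_const_mul, ← mul_assoc]
  congr 1
  field_simp

lemma localTimeDerivApprox_unitSquare {Ω : Type*} {B₁ B₂ : ℝ≥0 → Ω → ℝ}
    (h₁ : ∀ ω, Continuous fun t => B₁ t ω) (h₂ : ∀ ω, Continuous fun t => B₂ t ω) (ε : ℝ) (ω : Ω) :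
    localTimeDerivApprox unitSquare B₁ B₂ ε ω =
      squareApprox ε (toUnitPath B₁ h₁ ω) (toUnitPath B₂ h₂ ω) := by
  refine setIntegral_congr_fun (measurableSet_Icc.prod measurableSet_Icc) fun z hz => ?_
  rw [pathEval_toUnitPath _ _ hz.2, pathEval_toUnitPath _ _ hz.1]

/-! ### Decomposition of the triangle into dyadic squares -/

lemma mem_dyadicSquare_iff {n k : ℕ} {z : ℝ × ℝ} : z ∈ dyadicSquare n k ↔
    2 * ((k : ℝ) - 1) ≤ z.1 * 2 ^ n ∧ z.1 * 2 ^ n < 2 * k - 1 ∧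
      2 * (k : ℝ) - 1 < z.2 * 2 ^ n ∧ z.2 * 2 ^ n ≤ 2 * k := by
  have h : (0 : ℝ) < 2 ^ n := by positivity
  simp only [dyadicSquare, Set.mem_prod, Set.mem_Ico, Set.mem_Ioc, div_le_iff₀ h, lt_div_iff₀ h,
    div_lt_iff₀ h, le_div_iff₀ h, and_assoc]

lemma measurableSet_dyadicSquare (n k : ℕ) : MeasurableSet (dyadicSquare n k) :=
  measurableSet_Ico.prod measurableSet_Ioc

lemma dyadicSquare_index_eq {n k l : ℕ} {z : ℝ × ℝ} (h1 : z ∈ dyadicSquare n k)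
    (h2 : z ∈ dyadicSquare n l) : k = l := by
  rw [mem_dyadicSquare_iff] at h1 h2
  have a : (2 : ℝ) * l - 2 < 2 * k - 1 := by linarith [h2.1, h1.2.1]
  have b : (2 : ℝ) * k - 2 < 2 * l - 1 := by linarith [h1.1, h2.2.1]
  have a' : 2 * (l : ℤ) - 2 < 2 * k - 1 := by exact_mod_cast a
  have b' : 2 * (k : ℤ) - 2 < 2 * l - 1 := by exact_mod_cast b
  omega

/-- The midpoint of the coarser square separates the two coordinates of `z`. In units of the
half-open dyadic blocks of the finer level it is an integer, and it would have to lie strictly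
between `l - 1` and `l`. -/
lemma dyadicSquare_level_not_lt {n m k l : ℕ} (hnm : n < m) {z : ℝ × ℝ}
    (h1 : z ∈ dyadicSquare n k) (h2 : z ∈ dyadicSquare m l) : False := by
  rw [mem_dyadicSquare_iff] at h1 h2
  obtain ⟨d, rfl⟩ : ∃ d, m = n + 1 + d := ⟨m - n - 1, by omega⟩
  have hd : (0 : ℝ) < 2 ^ d := by positivity
  have hpow : ∀ x : ℝ, x * 2 ^ (n + 1 + d) = 2 * ((x * 2 ^ n) * 2 ^ d) := fun x => by ring
  rw [hpow, hpow] at h2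
  have a : (l : ℝ) - 1 < (2 * k - 1) * 2 ^ d := by
    have := mul_lt_mul_of_pos_right h1.2.1 hd
    linarith [h2.1]
  have b : (2 * (k : ℝ) - 1) * 2 ^ d < l := by
    have := mul_lt_mul_of_pos_right h1.2.2.1 hd
    linarith [h2.2.2.2]
  have a' : (l : ℤ) - 1 < (2 * k - 1) * 2 ^ d := by exact_mod_cast a
  have b' : (2 * (k : ℤ) - 1) * 2 ^ d < l := by exact_mod_cast b
  omega

/-- The level is the first one with a dyadic point strictly between the two coordinates. That point
is the midpoint of the square, and minimality confines both coordinates to the two halves around it.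
-/
lemma exists_mem_dyadicSquare {z : ℝ × ℝ} (h0 : 0 ≤ z.1) (h1 : z.1 < z.2) (h2 : z.2 ≤ 1) :
    ∃ n k : ℕ, k ∈ Finset.Icc 1 (2 ^ n) ∧ z ∈ dyadicSquare (n + 1) k := by
  have hex : ∃ n : ℕ, ∃ j : ℕ, z.1 * 2 ^ n < j ∧ (j : ℝ) < z.2 * 2 ^ n := by
    obtain ⟨n, hn⟩ := pow_unbounded_of_one_lt (z.2 - z.1)⁻¹ (one_lt_two (α := ℝ))
    refine ⟨n, ⌊z.1 * 2 ^ n⌋₊ + 1, ?_, ?_⟩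
    · push_cast
      exact Nat.lt_floor_add_one _
    · push_cast
      have hfl := Nat.floor_le (a := z.1 * 2 ^ n) (by positivity)
      rw [inv_lt_iff_one_lt_mul₀ (by linarith)] at hn
      linarith
  classical
  set N := Nat.find hex with hN
  obtain ⟨j, hj1, hj2⟩ := Nat.find_spec hex
  rw [← hN] at hj1 hj2
  -- No integer lies strictly inside `(0, 1)`, so the minimal level is positive.
  have hN0 : N ≠ 0 := by
    intro h
    rw [h, pow_zero, mul_one] at hj1 hj2
    have a : (0 : ℝ) < j := by linarith
    have b : (j : ℝ) < 1 := by linarith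
    have a' : 0 < j := by exact_mod_cast a
    have b' : j < 1 := by exact_mod_cast b
    omega
  obtain ⟨n, hn⟩ := Nat.exists_eq_succ_of_ne_zero hN0
  have hmin : ∀ i : ℕ, z.1 * 2 ^ n < i → (i : ℝ) < z.2 * 2 ^ n → False := fun i h h' =>
    Nat.find_min hex (m := n) (by omega) ⟨i, h, h'⟩
  rw [hn, Nat.succ_eq_add_one, pow_succ] at hj1 hj2
  -- An even numerator would already give a separating point one level earlier.
  rcases Nat.even_or_odd' j with ⟨i, rfl | rfl⟩
  · push_cast at hj1 hj2
    exact (hmin i (by linarith) (by linarith)).elim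
  · push_cast at hj1 hj2
    refine ⟨n, i + 1, ?_, ?_⟩
    · have hp : (0 : ℝ) < 2 ^ n := by positivity
      have : (2 * (i : ℝ) + 1) < 2 * 2 ^ n := by nlinarith
      have : 2 * i + 1 < 2 * 2 ^ n := by exact_mod_cast this
      rw [Finset.mem_Icc]
      omega
    · rw [mem_dyadicSquare_iff, pow_succ]
      push_cast
      refine ⟨?_, by linarith, by linarith, ?_⟩
      · by_contra h
        exact hmin i (by linarith) (by linarith)
      · by_contra h
        exact hmin (i + 1) (by push_cast; linarith) (by push_cast; linarith)

/-- The union of the dyadic squares of level `n + 1`. -/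
def dyadicLayer (n : ℕ) : Set (ℝ × ℝ) := ⋃ k ∈ Finset.Icc 1 (2 ^ n), dyadicSquare (n + 1) k

lemma measurableSet_dyadicLayer (n : ℕ) : MeasurableSet (dyadicLayer n) :=
  Finset.measurableSet_biUnion _ fun _ _ => measurableSet_dyadicSquare _ _

lemma pairwise_disjoint_dyadicLayer : Pairwise (Function.onFun Disjoint dyadicLayer) := by
  intro n m hnm
  rw [Function.onFun, Set.disjoint_left]
  intro z h1 h2
  simp only [dyadicLayer, Set.mem_iUnion] at h1 h2
  obtain ⟨k, _, hk⟩ := h1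
  obtain ⟨l, _, hl⟩ := h2
  rcases lt_or_gt_of_ne hnm with h | h
  · exact dyadicSquare_level_not_lt (by omega) hk hl
  · exact dyadicSquare_level_not_lt (by omega) hl hk

lemma iUnion_dyadicLayer :
    ⋃ n, dyadicLayer n = {z : ℝ × ℝ | 0 ≤ z.1 ∧ z.1 < z.2 ∧ z.2 ≤ 1} := by
  ext z
  simp only [dyadicLayer, Set.mem_iUnion, Set.mem_ofPred_eq, exists_prop]
  constructor
  · rintro ⟨n, k, hk, hz⟩
    rw [mem_dyadicSquare_iff] at hz
    obtain ⟨hk1, hk2⟩ := Finset.mem_Icc.1 hk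
    have hp : (0 : ℝ) < 2 ^ (n + 1) := by positivity
    have hk1' : (1 : ℝ) ≤ k := by exact_mod_cast hk1
    have hk2' : (k : ℝ) ≤ 2 ^ n := by exact_mod_cast hk2
    refine ⟨?_, ?_, ?_⟩
    · have : 0 ≤ z.1 * 2 ^ (n + 1) := by linarith [hz.1]
      exact nonneg_of_mul_nonneg_left this hp
    · exact lt_of_mul_lt_mul_right (hz.2.1.trans hz.2.2.1) hp.le
    · refine le_of_mul_le_mul_right (hz.2.2.2.trans ?_) hp
      rw [one_mul, pow_succ]
      linarith
  · rintro ⟨h0, h1, h2⟩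
    exact exists_mem_dyadicSquare h0 h1 h2

/-- The two sets differ only on the diagonal, which is a null set. -/
lemma triangle_ae_eq : triangle =ᵐ[volume] ⋃ n, dyadicLayer n := by
  rw [iUnion_dyadicLayer]
  have hdiag : (volume : Measure (ℝ × ℝ)) {z | z.1 = z.2} = 0 := by
    rw [Measure.volume_eq_prod, Measure.measure_prod_null
      (measurableSet_eq_fun measurable_fst measurable_snd)]
    refine ae_of_all _ fun s => ?_
    have : Prod.mk s ⁻¹' {z : ℝ × ℝ | z.1 = z.2} = {s} := by
      ext t
      simp [eq_comm]
    change volume (Prod.mk s ⁻¹' {z : ℝ × ℝ | z.1 = z.2}) = 0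
    rw [this]
    simp
  have hae : ∀ᵐ z : ℝ × ℝ, z.1 ≠ z.2 := by
    rw [ae_iff]
    simpa using hdiag
  filter_upwards [hae] with z hz
  refine propext ?_
  change (0 ≤ z.1 ∧ z.1 ≤ z.2 ∧ z.2 ≤ 1) ↔ (0 ≤ z.1 ∧ z.1 < z.2 ∧ z.2 ≤ 1)
  rw [lt_iff_le_and_ne]
  tauto

lemma hasSum_setIntegral_triangle {h : ℝ × ℝ → ℝ} (hh : Continuous h) :
    HasSum (fun n : ℕ => ∑ k ∈ Finset.Icc 1 (2 ^ n), ∫ z in dyadicSquare (n + 1) k, h z)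
      (∫ z in triangle, h z) := by
  have hsub : ⋃ n, dyadicLayer n ⊆ unitSquare := by
    rw [iUnion_dyadicLayer]
    rintro z ⟨h0, h1, h2⟩
    exact ⟨⟨h0, h1.le.trans h2⟩, ⟨h0.trans h1.le, h2⟩⟩
  have hint : IntegrableOn h (⋃ n, dyadicLayer n) :=
    (hh.continuousOn.integrableOn_compact (isCompact_Icc.prod isCompact_Icc)).mono_set hsub
  rw [setIntegral_congr_set triangle_ae_eq]
  have hlayer : ∀ n : ℕ, ∫ z in dyadicLayer n, h z =
      ∑ k ∈ Finset.Icc 1 (2 ^ n), ∫ z in dyadicSquare (n + 1) k, h z := by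
    intro n
    rw [dyadicLayer, integral_biUnion_finset _ fun k _ => measurableSet_dyadicSquare _ _]
    · intro k _ l _ hkl
      rw [Function.onFun, Set.disjoint_left]
      exact fun z h1 h2 => hkl (dyadicSquare_index_eq h1 h2)
    · intro k hk
      refine hint.mono_set (subset_trans ?_ (Set.subset_iUnion _ n))
      exact Set.subset_biUnion_of_mem (u := fun k => dyadicSquare (n + 1) k) hk
  simpa only [hlayer] using
    hasSum_integral_iUnion measurableSet_dyadicLayer pairwise_disjoint_dyadicLayer hint

end LeGallScheme

/-! ### Integrable derivatives and limits at zero -/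

namespace LeGallScheme

lemma ConvergesAEAndLp.congr {Ω ι : Type*} [MeasurableSpace Ω] {P : Measure Ω} {l : Filter ι}
    {F G : ι → Ω → ℝ} {X Y : Ω → ℝ} (h : ConvergesAEAndLp P l F X)
    (hFG : ∀ᵐ ω ∂P, ∀ i, F i ω = G i ω) (hXY : X =ᵐ[P] Y) : ConvergesAEAndLp P l G Y := by
  have hFG' : ∀ i, F i =ᵐ[P] G i := fun i => by filter_upwards [hFG] with ω h using h i
  refine ⟨?_, fun p hp hp' => ?_⟩
  · filter_upwards [h.1, hFG, hXY] with ω h1 h2 h3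
    simpa only [← h2, ← h3] using h1
  · obtain ⟨h1, h2, h3⟩ := h.2 p hp hp'
    refine ⟨h1.mono fun i hi => hi.ae_eq (hFG' i), h2.ae_eq hXY, h3.congr fun i => ?_⟩
    refine eLpNorm_congr_ae ?_
    filter_upwards [hFG' i, hXY] with ω h4 h5
    rw [h4, h5]

/-- A function on `(0, 1]` with integrable derivative has a limit at `0` and is bounded. -/
lemma exists_tendsto_and_abs_le {S D : ℝ → ℝ} (hD : Measurable D)
    (hS : ∀ a b, 0 < a → a ≤ b → S b - S a = ∫ ε in a..b, D ε)
    (hfin : ∫⁻ ε in Set.Ioc (0 : ℝ) 1, ‖D ε‖ₑ ≠ ∞) :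
    (∃ l, Tendsto S (𝓝[>] 0) (𝓝 l)) ∧
      ∀ ε ∈ Set.Ioc (0 : ℝ) 1, |S ε| ≤ |S 1| + (∫⁻ ε in Set.Ioc (0 : ℝ) 1, ‖D ε‖ₑ).toReal := by
  have hint : IntegrableOn D (Set.Ioc 0 1) := ⟨hD.aestronglyMeasurable, hfin.lt_top⟩
  have hint' : IntegrableOn D (Set.uIcc 0 1) := by
    rwa [Set.uIcc_of_le zero_le_one, integrableOn_Icc_iff_integrableOn_Ioc]
  have hSε : ∀ ε ∈ Set.Ioc (0 : ℝ) 1, S ε = S 1 - ∫ t in ε..1, D t := fun ε hε => by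
    rw [← hS ε 1 hε.1 hε.2]
    ring
  have hmem : Set.Ioc (0 : ℝ) 1 ∈ 𝓝[>] (0 : ℝ) := Ioc_mem_nhdsGT zero_lt_one
  constructor
  · refine ⟨S 1 - ∫ t in (0 : ℝ)..1, D t, ?_⟩
    have h0 := intervalIntegral.continuousOn_primitive_interval_left hint' 0 Set.left_mem_uIcc
    have h1 : Tendsto (fun ε => ∫ t in ε..1, D t) (𝓝[>] 0) (𝓝 (∫ t in (0 : ℝ)..1, D t)) := by
      refine h0.mono_left ?_
      rw [Set.uIcc_of_le zero_le_one, ← nhdsWithin_Ioc_eq_nhdsGT zero_lt_one]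
      exact nhdsWithin_mono _ Set.Ioc_subset_Icc_self
    refine (h1.const_sub (S 1)).congr' ?_
    filter_upwards [hmem] with ε hε using (hSε ε hε).symm
  · intro ε hε
    rw [hSε ε hε]
    refine (abs_sub _ _).trans (add_le_add_right ?_ _)
    rw [intervalIntegral.integral_of_le hε.2, ← integral_norm_eq_lintegral_enorm
      hint.aestronglyMeasurable, ← Real.norm_eq_abs]
    refine (norm_integral_le_integral_norm _).trans ?_
    exact setIntegral_mono_set hint.norm (ae_of_all _ fun _ => norm_nonneg _)
      (Set.Ioc_subset_Ioc_left hε.1.le).eventuallyLE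

lemma lintegral_enorm_pow_le {Ω : Type*} [MeasurableSpace Ω] {P : Measure Ω} [IsFiniteMeasure P]
    {X : Ω → ℝ} (hX : Measurable X) (hb : ∃ D, ∀ ω, |X ω| ≤ D) {m : ℕ} {a K : ℝ} (ha : 0 ≤ a)
    (h : ∫ ω, X ω ^ (2 * m) ∂P ≤ a ^ (2 * m) * K) :
    ∫⁻ ω, ‖X ω‖ₑ ^ (2 * m) ∂P ≤ ENNReal.ofReal K * ENNReal.ofReal a ^ (2 * m) := by
  obtain ⟨D, hD⟩ := hb
  have hint : Integrable (fun ω => X ω ^ (2 * m)) P := by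
    refine Integrable.of_bound (hX.pow_const _).aestronglyMeasurable (D ^ (2 * m))
      (ae_of_all _ fun ω => ?_)
    rw [norm_pow, Real.norm_eq_abs]
    exact pow_le_pow_left₀ (abs_nonneg _) (hD ω) _
  calc ∫⁻ ω, ‖X ω‖ₑ ^ (2 * m) ∂P = ∫⁻ ω, ENNReal.ofReal (X ω ^ (2 * m)) ∂P := by
        refine lintegral_congr fun ω => ?_
        rw [Real.enorm_eq_ofReal_abs, ← ENNReal.ofReal_pow (abs_nonneg _),
          (even_two_mul m).pow_abs]
    _ = ENNReal.ofReal (∫ ω, X ω ^ (2 * m) ∂P) :=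
        (ofReal_integral_eq_lintegral_ofReal hint
          (ae_of_all _ fun ω => (even_two_mul m).pow_nonneg _)).symm
    _ ≤ ENNReal.ofReal (a ^ (2 * m) * K) := ENNReal.ofReal_le_ofReal h
    _ = _ := by rw [ENNReal.ofReal_mul (by positivity), ENNReal.ofReal_pow ha, mul_comm]

lemma lintegral_rpow_unit_lt_top :
    ∫⁻ ε in Set.Ioc (0 : ℝ) 1, ENNReal.ofReal (ε ^ (-(7 / 8) : ℝ)) < ∞ := by
  have h : IntervalIntegrable (fun x : ℝ => x ^ (-(7 / 8) : ℝ)) volume 0 1 :=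
    intervalIntegral.intervalIntegrable_rpow' (by norm_num)
  rw [intervalIntegrable_iff_integrableOn_Ioc_of_le zero_le_one] at h
  exact h.lintegral_lt_top

/-! ### The derivative of intersection local time as a functional of a pair of paths -/

/-- The total variation on `(0, 1]` of `ε ↦ squareApprox ε`. -/
noncomputable def squareVar (z : UnitPath × UnitPath) : ℝ≥0∞ :=
  ∫⁻ ε in Set.Ioc (0 : ℝ) 1, ‖squareDeriv ε z.1 z.2‖ₑ

/-- The limit of `squareApprox ε` as `ε ↓ 0`. -/
noncomputable def squareLim (z : UnitPath × UnitPath) : ℝ :=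
  limUnder (𝓝[>] (0 : ℝ)) fun ε => squareApprox ε z.1 z.2

lemma measurable_squareVar : Measurable squareVar := by
  refine Measurable.lintegral_prod_right' (f := fun q : (UnitPath × UnitPath) × ℝ =>
    ‖squareDeriv q.2 q.1.1 q.1.2‖ₑ) ?_
  fun_prop

lemma tendsto_squareApprox {z : UnitPath × UnitPath} (hz : squareVar z ≠ ∞) :
    Tendsto (fun ε => squareApprox ε z.1 z.2) (𝓝[>] 0) (𝓝 (squareLim z)) :=
  tendsto_nhds_limUnder (exists_tendsto_and_abs_le (D := fun ε => squareDeriv ε z.1 z.2)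
    (by fun_prop) (fun _ _ ha hab => squareApprox_sub ha hab _ _) hz).1

lemma abs_squareApprox_le_squareVar {z : UnitPath × UnitPath} (hz : squareVar z ≠ ∞) {ε : ℝ}
    (hε : ε ∈ Set.Ioc (0 : ℝ) 1) : |squareApprox ε z.1 z.2| ≤ 1 + (squareVar z).toReal := by
  refine ((exists_tendsto_and_abs_le (D := fun ε => squareDeriv ε z.1 z.2) (by fun_prop)
    (fun _ _ ha hab => squareApprox_sub ha hab _ _) hz).2 ε hε).trans (add_le_add_left ?_ _)
  simpa using abs_squareApprox_le zero_lt_one z.1 z.2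

section Wiener

variable {W : Measure UnitPath} [IsProbabilityMeasure W]

lemma lintegral_squareVar_pow_lt_top (hW : IsWiener W) {m : ℕ} (hm : 1 ≤ m) :
    ∫⁻ z, squareVar z ^ (2 * m) ∂(W.prod W) < ∞ := by
  obtain ⟨K, -, h⟩ := exists_integral_squareDeriv_pow_le hW m
  have := lintegral_lintegral_pow_le (W.prod W) (volume.restrict (Set.Ioc (0 : ℝ) 1))
    (f := fun z ε => ‖squareDeriv ε z.1 z.2‖ₑ)
    (w := fun ε => ENNReal.ofReal (ε ^ (-(7 / 8) : ℝ))) (by unfold Function.uncurry; fun_prop)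
    (by fun_prop) (q := 2 * m) (by omega) (C := ENNReal.ofReal K) ?_
  · exact this.trans_lt (ENNReal.mul_lt_top ENNReal.ofReal_lt_top
      (ENNReal.pow_lt_top lintegral_rpow_unit_lt_top))
  · filter_upwards [ae_restrict_mem measurableSet_Ioc] with ε hε
    have hpos : 0 < ε ^ (-(7 / 8) : ℝ) := Real.rpow_pos_of_pos hε.1 _
    refine ⟨by simpa using hpos, ENNReal.ofReal_ne_top, ?_⟩
    obtain ⟨D, hD⟩ := exists_abs_squareDeriv_le hε.1
    exact lintegral_enorm_pow_le (by fun_prop) ⟨D, fun z => hD _ _⟩ hpos.le (h ε hε.1)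

lemma ae_squareVar_ne_top (hW : IsWiener W) : ∀ᵐ z ∂(W.prod W), squareVar z ≠ ∞ := by
  have h := lintegral_squareVar_pow_lt_top hW le_rfl
  filter_upwards [ae_lt_top (measurable_squareVar.pow_const _) h.ne] with z hz hz'
  simp [hz'] at hz

lemma aemeasurable_squareLim (hW : IsWiener W) : AEMeasurable squareLim (W.prod W) := by
  obtain ⟨u, hu⟩ := (𝓝[>] (0 : ℝ)).exists_seq_tendsto
  refine aemeasurable_of_tendsto_metrizable_ae atTop
    (f := fun n z => squareApprox (u n) z.1 z.2)
    (fun n => (measurable_squareApprox _).aemeasurable) ?_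
  filter_upwards [ae_squareVar_ne_top hW] with z hz
  exact (tendsto_squareApprox hz).comp hu

lemma memLp_squareVar (hW : IsWiener W) {p : ℝ≥0∞} (hp : p ≠ ∞) :
    MemLp (fun z => (squareVar z).toReal) p (W.prod W) :=
  memLp_toReal_of_lintegral_pow_lt_top measurable_squareVar.aemeasurable
    (fun _ hm => lintegral_squareVar_pow_lt_top hW hm) hp

/-- This common form covers both the dyadic pieces, with `c = 2^n`, and the DILT, with `c = 1`. The
dominating variable is the total variation plus a constant, transported by the law of `Θ`. -/
lemma convergesAEAndLp_of_eq_squareApprox {Ω : Type*} [MeasurableSpace Ω] {P : Measure Ω}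
    [IsProbabilityMeasure P] (hW : IsWiener W) {Θ : Ω → UnitPath × UnitPath} (hΘ : Measurable Θ)
    (hlaw : P.map Θ = W.prod W) {c : ℝ} (hc : 0 < c) {F : ℝ → Ω → ℝ}
    (hF : ∀ ε, 0 < ε → ∀ ω, F ε ω = c⁻¹ * squareApprox (c * ε) (Θ ω).1 (Θ ω).2) :
    ConvergesAEAndLp P (𝓝[>] 0) F (fun ω => c⁻¹ * squareLim (Θ ω)) := by
  have hae : ∀ᵐ ω ∂P, squareVar (Θ ω) ≠ ∞ :=
    ae_of_ae_map hΘ.aemeasurable (hlaw ▸ ae_squareVar_ne_top hW)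
  have hc' : 0 < c⁻¹ := inv_pos.2 hc
  -- For `ε ≤ c⁻¹` the rescaled parameter `c ε` stays in `(0, 1]`, where the variation bound holds.
  refine ConvergesAEAndLp.of_dominated (s := Set.Ioc 0 c⁻¹)
    (H := fun ω => c⁻¹ * (1 + (squareVar (Θ ω)).toReal)) (Ioc_mem_nhdsGT hc') ?_ ?_ ?_ ?_
  · intro ε hε
    rw [show F ε = fun ω => c⁻¹ * squareApprox (c * ε) (Θ ω).1 (Θ ω).2 from funext (hF ε hε.1)]
    exact (((measurable_squareApprox _).comp hΘ).const_mul _).aestronglyMeasurable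
  · intro p hp
    have h1 : MemLp (fun ω => (squareVar (Θ ω)).toReal) p P := by
      have := memLp_squareVar hW hp
      rw [← hlaw] at this
      exact (memLp_map_measure_iff this.1 hΘ.aemeasurable).1 this
    exact ((memLp_const (1 : ℝ)).add h1).const_mul _
  · filter_upwards [hae] with ω hω ε hε
    rw [hF ε hε.1, abs_mul, abs_of_pos hc']
    refine mul_le_mul_of_nonneg_left (abs_squareApprox_le_squareVar hω ⟨mul_pos hc hε.1, ?_⟩) hc'.le
    calc c * ε ≤ c * c⁻¹ := mul_le_mul_of_nonneg_left hε.2 hc.le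
      _ = 1 := mul_inv_cancel₀ hc.ne'
  · filter_upwards [hae] with ω hω
    have h1 : Tendsto (fun ε : ℝ => c * ε) (𝓝[>] 0) (𝓝[>] 0) := by
      refine tendsto_nhdsWithin_iff.2 ⟨?_, ?_⟩
      · have : Tendsto (fun ε : ℝ => c * ε) (𝓝 0) (𝓝 (c * 0)) := by
          exact (continuous_const_mul c).tendsto 0
        rw [mul_zero] at this
        exact this.mono_left nhdsWithin_le_nhds
      · filter_upwards [self_mem_nhdsWithin] with ε hε using mul_pos hc hε
    refine (((tendsto_squareApprox hω).comp h1).const_mul c⁻¹).congr' ?_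
    filter_upwards [self_mem_nhdsWithin] with ε hε using (hF ε hε ω).symm

end Wiener

end LeGallScheme

namespace LeGallScheme

variable {Ω : Type*} [MeasurableSpace Ω] {P : Measure Ω} {B : ℝ≥0 → Ω → ℝ}

/-! ### The sum of the dyadic pieces of one level -/

/-- The rescaled paths of `B` on the two sides of the midpoint of a dyadic square. -/
noncomputable def dyadicPaths (hB : IsContBrownian B P) (n k : ℕ) : Ω → UnitPath × UnitPath :=
  sidePaths hB (dyadicMid n k) (dyadicScale_ne_zero n)

lemma measurable_dyadicPaths (hB : IsContBrownian B P) (n k : ℕ) :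
    Measurable (dyadicPaths hB n k) :=
  measurable_sidePaths hB _ _

lemma map_dyadicPaths (hB : IsContBrownian B P) {n k : ℕ} (hk : 1 ≤ k) :
    P.map (dyadicPaths hB n k) =
      (P.map (toUnitPath B hB.cont)).prod (P.map (toUnitPath B hB.cont)) :=
  map_sidePaths hB _ (dyadicScale_le_dyadicMid hk)

lemma iIndepFun_dyadicPaths (hB : IsContBrownian B P) (n M : ℕ) :
    iIndepFun (fun k : Finset.Icc 1 M => dyadicPaths hB n k) P := by
  have key : ∀ k l : ℕ, 1 ≤ k → k < l →
      dyadicMid n k + ((2 : ℝ≥0) ^ n)⁻¹ ≤ dyadicMid n l - ((2 : ℝ≥0) ^ n)⁻¹ := by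
    intro k l hk hkl
    rw [le_tsub_iff_right (dyadicScale_le_dyadicMid (by omega))]
    have h : (((2 * k - 1 : ℕ) : ℝ≥0) + 1 + 1) ≤ ((2 * l - 1 : ℕ) : ℝ≥0) := by
      exact_mod_cast (by omega : 2 * k - 1 + 1 + 1 ≤ 2 * l - 1)
    calc dyadicMid n k + ((2 : ℝ≥0) ^ n)⁻¹ + ((2 : ℝ≥0) ^ n)⁻¹
        = (((2 * k - 1 : ℕ) : ℝ≥0) + 1 + 1) * ((2 : ℝ≥0) ^ n)⁻¹ := by
          rw [dyadicMid]
          ring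
      _ ≤ dyadicMid n l := mul_le_mul_left h _
  refine iIndepFun_sidePaths hB (dyadicScale_ne_zero n) (fun k : Finset.Icc 1 M => dyadicMid n k)
    (fun k => dyadicScale_le_dyadicMid (Finset.mem_Icc.1 k.2).1) fun k l hkl => ?_
  have hk := (Finset.mem_Icc.1 k.2).1
  have hl := (Finset.mem_Icc.1 l.2).1
  rcases lt_or_gt_of_ne (fun h => hkl (Subtype.ext h) : (k : ℕ) ≠ l) with h | h
  · exact Or.inl (key _ _ hk h)
  · exact Or.inr (key _ _ hl h)

/-- The approximation, at scale `ε`, of the sum of the dyadic pieces of level `n + 1`. -/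
noncomputable def layerApprox (hB : IsContBrownian B P) (n : ℕ) (ε : ℝ) (ω : Ω) : ℝ :=
  ∑ k : Finset.Icc 1 (2 ^ n), ((2 : ℝ) ^ (n + 1))⁻¹ *
    squareApprox (2 ^ (n + 1) * ε) (dyadicPaths hB (n + 1) k ω).1 (dyadicPaths hB (n + 1) k ω).2

/-- The derivative in `ε` of `layerApprox`. -/
noncomputable def layerDeriv (hB : IsContBrownian B P) (n : ℕ) (ε : ℝ) (ω : Ω) : ℝ :=
  ∑ k : Finset.Icc 1 (2 ^ n),
    squareDeriv (2 ^ (n + 1) * ε) (dyadicPaths hB (n + 1) k ω).1 (dyadicPaths hB (n + 1) k ω).2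

lemma layerApprox_eq (hB : IsContBrownian B P) (n : ℕ) {ε : ℝ} (hε : 0 < ε) (ω : Ω) :
    layerApprox hB n ε ω =
      ∑ k ∈ Finset.Icc 1 (2 ^ n), localTimeDerivApprox (dyadicSquare (n + 1) k) B B ε ω := by
  rw [layerApprox, ← Finset.sum_coe_sort (Finset.Icc 1 (2 ^ n))]
  exact Finset.sum_congr rfl fun k _ =>
    (localTimeDerivApprox_dyadicSquare hB (Finset.mem_Icc.1 k.2).1 hε ω).symm

lemma measurable_layerApprox (hB : IsContBrownian B P) (n : ℕ) (ε : ℝ) :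
    Measurable (layerApprox hB n ε) :=
  Finset.measurable_fun_sum _ fun k _ =>
    ((measurable_squareApprox _).comp (measurable_dyadicPaths hB (n + 1) k)).const_mul _

lemma measurable_layerDeriv (hB : IsContBrownian B P) (n : ℕ) :
    Measurable fun q : Ω × ℝ => layerDeriv hB n q.2 q.1 := by
  refine Finset.measurable_fun_sum _ fun k _ => ?_
  have h := (measurable_dyadicPaths hB (n + 1) k).comp (measurable_fst : Measurable (Prod.fst : Ω × ℝ → Ω))
  exact measurable_squareDeriv_comp (measurable_snd.const_mul _) h.fst h.snd

/-- The prefactor of `layerApprox` cancels the inner derivative of `ε ↦ 2^{n+1} ε`, which is why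
`layerDeriv` has none. -/
lemma layerApprox_sub (hB : IsContBrownian B P) (n : ℕ) {a b : ℝ} (ha : 0 < a) (hab : a ≤ b)
    (ω : Ω) : layerApprox hB n b ω - layerApprox hB n a ω = ∫ ε in a..b, layerDeriv hB n ε ω := by
  have hl : (0 : ℝ) < 2 ^ (n + 1) := by positivity
  have hla : 0 < 2 ^ (n + 1) * a := by positivity
  have hlab : 2 ^ (n + 1) * a ≤ 2 ^ (n + 1) * b := mul_le_mul_of_nonneg_left hab hl.le
  simp only [layerDeriv, layerApprox]
  rw [intervalIntegral.integral_finsetSum, ← Finset.sum_sub_distrib]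
  · refine Finset.sum_congr rfl fun k _ => ?_
    rw [intervalIntegral.integral_comp_mul_left (fun ε => squareDeriv ε _ _) hl.ne', smul_eq_mul,
      ← squareApprox_sub hla hlab]
    ring
  · intro k _
    have := (intervalIntegrable_squareDeriv hla hlab (dyadicPaths hB (n + 1) k ω).1
      (dyadicPaths hB (n + 1) k ω).2).comp_mul_left (c := 2 ^ (n + 1))
    simpa [hl.ne'] using this

/-- There are `2^n` terms, each at most `4^{-(n+1)}` by the deterministic bound `1 / ε` at the
rescaled parameter. The values at `ε = 1` are thus summable over the levels without any
probabilistic cancellation. -/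
lemma abs_layerApprox_one_le (hB : IsContBrownian B P) (n : ℕ) (ω : Ω) :
    |layerApprox hB n 1 ω| ≤ (1 / 2) ^ n := by
  have hl : (0 : ℝ) < 2 ^ (n + 1) := by positivity
  refine (Finset.abs_sum_le_sum_abs _ _).trans ?_
  refine (Finset.sum_le_card_nsmul _ _ ((1 / 4 : ℝ) ^ n) fun k _ => ?_).trans ?_
  · rw [abs_mul, abs_of_pos (inv_pos.2 hl)]
    calc ((2 : ℝ) ^ (n + 1))⁻¹ * |squareApprox (2 ^ (n + 1) * 1) _ _|
        ≤ ((2 : ℝ) ^ (n + 1))⁻¹ * (1 / (2 ^ (n + 1) * 1)) := by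
          gcongr
          exact abs_squareApprox_le (by positivity) _ _
      _ = (1 / 4) ^ n * (1 / 4) := by
          rw [← pow_succ, mul_one, one_div, ← mul_inv, ← mul_pow, one_div, inv_pow]
          norm_num
      _ ≤ (1 / 4) ^ n := mul_le_of_le_one_right (by positivity) (by norm_num)
  · rw [Finset.card_univ, Fintype.card_coe, Nat.card_Icc, nsmul_eq_mul]
    rw [add_tsub_cancel_right, Nat.cast_pow, Nat.cast_ofNat, ← mul_pow]
    norm_num

/-- The `2^n` summands are independent and centred, of size `(2^{n+1} ε)^{-7/8}` in every even
moment. Their sum is therefore of order `2^{n/2} (2^{n+1} ε)^{-7/8}`, which decays geometrically in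
`n`. The triangle inequality alone would give `2^{n/8}`, which diverges. -/
lemma exists_integral_layerDeriv_pow_le (hB : IsContBrownian B P) (m : ℕ) :
    ∃ K, 0 ≤ K ∧ ∀ n ε, 0 < ε → ∫ ω, layerDeriv hB n ε ω ^ (2 * m) ∂P ≤
      (((2 : ℝ) ^ (-(3 / 8) : ℝ)) ^ n * ε ^ (-(7 / 8) : ℝ)) ^ (2 * m) * K := by
  have := hB.isProbabilityMeasure
  set W := P.map (toUnitPath B hB.cont) with hWdef
  have hWp : IsProbabilityMeasure W :=
    Measure.isProbabilityMeasure_map (measurable_toUnitPath hB.meas hB.cont).aemeasurable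
  have hW : IsWiener W := hB.isWiener
  choose C hC h using exists_integral_squareDeriv_pow_le hW
  obtain ⟨K, hK, hsum⟩ := exists_integral_sum_pow_le C hC m
  refine ⟨K, hK, fun n ε hε => ?_⟩
  set η : ℝ := 2 ^ (n + 1) * ε with hη
  have hη0 : 0 < η := by positivity
  set b : ℝ := η ^ (-(7 / 8) : ℝ) with hb
  have hb0 : 0 < b := Real.rpow_pos_of_pos hη0 _
  -- After division by `b` the even moments are bounded by constants independent of `n` and `ε`, as
  -- the moment inequality for sums requires.
  set X : Finset.Icc 1 (2 ^ n) → Ω → ℝ := fun k ω =>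
    b⁻¹ * squareDeriv η (dyadicPaths hB (n + 1) k ω).1 (dyadicPaths hB (n + 1) k ω).2 with hX
  have hmeas : Measurable fun z : UnitPath × UnitPath => squareDeriv η z.1 z.2 := by fun_prop
  have htr : ∀ (k : Finset.Icc 1 (2 ^ n)) (f : ℝ → ℝ), Measurable f →
      ∫ ω, f (squareDeriv η (dyadicPaths hB (n + 1) k ω).1 (dyadicPaths hB (n + 1) k ω).2) ∂P =
        ∫ z, f (squareDeriv η z.1 z.2) ∂(W.prod W) := by
    intro k f hf
    rw [← map_dyadicPaths hB (n := n + 1) (Finset.mem_Icc.1 k.2).1]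
    exact (integral_map (measurable_dyadicPaths hB _ _).aemeasurable
      (hf.comp hmeas).aestronglyMeasurable).symm
  have hmain := hsum P X (fun k => (hmeas.comp (measurable_dyadicPaths hB _ _)).const_mul _) ?_ ?_
    ?_ ?_ Finset.univ
  · have e1 : ∀ ω, layerDeriv hB n ε ω ^ (2 * m) = b ^ (2 * m) * (∑ k, X k ω) ^ (2 * m) := by
      intro ω
      rw [← mul_pow, layerDeriv, Finset.mul_sum]
      congr 1
      refine Finset.sum_congr rfl fun k _ => ?_
      simp only [hX]
      rw [mul_inv_cancel_left₀ hb0.ne']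
    simp only [e1]
    rw [integral_const_mul]
    refine (mul_le_mul_of_nonneg_left hmain (by positivity)).trans ?_
    have hcard : ((Finset.univ : Finset (Finset.Icc 1 (2 ^ n))).card : ℝ) = √(2 ^ n) ^ 2 := by
      rw [Finset.card_univ, Fintype.card_coe, Nat.card_Icc, add_tsub_cancel_right,
        Real.sq_sqrt (by positivity)]
      push_cast
      rfl
    rw [hcard, ← pow_mul, mul_left_comm, ← mul_pow, mul_comm K]
    refine mul_le_mul_of_nonneg_right (pow_le_pow_left₀ (by positivity) ?_ _) hK
    have e2 : b = ((2 : ℝ) ^ (n + 1)) ^ (-(7 / 8) : ℝ) * ε ^ (-(7 / 8) : ℝ) := by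
      rw [hb, hη, Real.mul_rpow (by positivity) hε.le]
    rw [e2, mul_right_comm]
    refine mul_le_mul_of_nonneg_right ?_ (Real.rpow_nonneg hε.le _)
    rw [Real.sqrt_eq_rpow, ← Real.rpow_natCast, ← Real.rpow_natCast, ← Real.rpow_natCast,
      ← Real.rpow_mul zero_le_two, ← Real.rpow_mul zero_le_two, ← Real.rpow_mul zero_le_two,
      ← Real.rpow_add two_pos]
    -- The exponent is `n/2 - 7(n+1)/8 = -3n/8 - 7/8`, and the surplus `-7/8` is dropped.
    refine Real.rpow_le_rpow_of_exponent_le one_le_two ?_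
    push_cast
    linarith
  · intro k
    obtain ⟨D, hD⟩ := exists_abs_squareDeriv_le hη0
    refine ⟨b⁻¹ * D, fun ω => ?_⟩
    simp only [hX]
    rw [abs_mul, abs_of_pos (inv_pos.2 hb0)]
    exact mul_le_mul_of_nonneg_left (hD _ _) (inv_pos.2 hb0).le
  · exact (iIndepFun_dyadicPaths hB (n + 1) (2 ^ n)).comp
      (fun _ z => b⁻¹ * squareDeriv η z.1 z.2) fun _ => hmeas.const_mul _
  · intro k
    simp only [hX]
    rw [integral_const_mul, mul_eq_zero]
    exact Or.inr ((htr k id measurable_id).trans (integral_squareDeriv_eq_zero hη0))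
  · intro k j
    simp only [hX, mul_pow]
    rw [integral_const_mul, htr k (fun x => x ^ (2 * j)) (by fun_prop)]
    refine (mul_le_mul_of_nonneg_left (h j η hη0) (by positivity)).trans ?_
    rw [← mul_assoc, ← mul_pow, inv_mul_cancel₀ hb0.ne', one_pow, one_mul]

/-- The total variation on `(0, 1]` of `ε ↦ layerApprox hB n ε ω`. -/
noncomputable def layerVar (hB : IsContBrownian B P) (n : ℕ) (ω : Ω) : ℝ≥0∞ :=
  ∫⁻ ε in Set.Ioc (0 : ℝ) 1, ‖layerDeriv hB n ε ω‖ₑ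

lemma measurable_layerVar (hB : IsContBrownian B P) (n : ℕ) : Measurable (layerVar hB n) :=
  Measurable.lintegral_prod_right' (f := fun q : Ω × ℝ => ‖layerDeriv hB n q.2 q.1‖ₑ)
    (measurable_layerDeriv hB n).enorm

lemma exists_lintegral_layerVar_pow_le (hB : IsContBrownian B P) {m : ℕ} (hm : 1 ≤ m) :
    ∃ C : ℝ≥0∞, C ≠ ∞ ∧ ∀ n, ∫⁻ ω, layerVar hB n ω ^ (2 * m) ∂P ≤
      C * ENNReal.ofReal (((2 : ℝ) ^ (-(3 / 8) : ℝ)) ^ n) ^ (2 * m) := by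
  have := hB.isProbabilityMeasure
  obtain ⟨K, hK, h⟩ := exists_integral_layerDeriv_pow_le hB m
  set T := ∫⁻ ε in Set.Ioc (0 : ℝ) 1, ENNReal.ofReal (ε ^ (-(7 / 8) : ℝ)) with hT
  refine ⟨ENNReal.ofReal K * T ^ (2 * m), (ENNReal.mul_lt_top ENNReal.ofReal_lt_top
      (ENNReal.pow_lt_top lintegral_rpow_unit_lt_top)).ne, fun n => ?_⟩
  set r : ℝ := ((2 : ℝ) ^ (-(3 / 8) : ℝ)) ^ n with hr
  have hr0 : 0 < r := by positivity
  have := lintegral_lintegral_pow_le P (volume.restrict (Set.Ioc (0 : ℝ) 1))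
    (f := fun ω ε => ‖layerDeriv hB n ε ω‖ₑ)
    (w := fun ε => ENNReal.ofReal r * ENNReal.ofReal (ε ^ (-(7 / 8) : ℝ)))
    (measurable_layerDeriv hB n).enorm (by fun_prop) (q := 2 * m) (by omega)
    (C := ENNReal.ofReal K) ?_
  · rw [lintegral_const_mul _ (by fun_prop), ← hT, mul_pow] at this
    refine this.trans_eq ?_
    ring
  · filter_upwards [ae_restrict_mem measurableSet_Ioc] with ε hε
    have hpos : 0 < ε ^ (-(7 / 8) : ℝ) := Real.rpow_pos_of_pos hε.1 _
    rw [← ENNReal.ofReal_mul hr0.le]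
    refine ⟨by simpa using mul_pos hr0 hpos, ENNReal.ofReal_ne_top, ?_⟩
    refine lintegral_enorm_pow_le ((measurable_layerDeriv hB n).comp measurable_prodMk_right) ?_
      (mul_pos hr0 hpos).le (h n ε hε.1)
    obtain ⟨D, hD⟩ := exists_abs_squareDeriv_le (ε := 2 ^ (n + 1) * ε)
      (mul_pos (by positivity) hε.1)
    refine ⟨∑ _k : Finset.Icc 1 (2 ^ n), D, fun ω => ?_⟩
    change |layerDeriv hB n ε ω| ≤ _
    exact (Finset.abs_sum_le_sum_abs _ _).trans (Finset.sum_le_sum fun k _ => hD _ _)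

/-- Minkowski's inequality is used a second time, now for the counting measure on levels with
geometric weights. -/
lemma lintegral_tsum_layerVar_pow_lt_top (hB : IsContBrownian B P) {m : ℕ} (hm : 1 ≤ m) :
    ∫⁻ ω, (∑' n, layerVar hB n ω) ^ (2 * m) ∂P < ∞ := by
  have := hB.isProbabilityMeasure
  obtain ⟨C, hC, h⟩ := exists_lintegral_layerVar_pow_le hB hm
  set r : ℝ := (2 : ℝ) ^ (-(3 / 8) : ℝ) with hr
  have hr0 : 0 < r := Real.rpow_pos_of_pos two_pos _
  have hr1 : r < 1 := Real.rpow_lt_one_of_one_lt_of_neg one_lt_two (by norm_num)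
  have := lintegral_lintegral_pow_le P Measure.count (f := fun ω (n : ℕ) => layerVar hB n ω)
    (w := fun n => ENNReal.ofReal (r ^ n)) (measurable_from_prod_countable_left
      (measurable_layerVar hB)) (by fun_prop) (q := 2 * m) (by omega) (C := C)
    (ae_of_all _ fun n => ⟨by simpa using pow_pos hr0 n, ENNReal.ofReal_ne_top, h n⟩)
  simp only [lintegral_count] at this
  refine this.trans_lt (ENNReal.mul_lt_top hC.lt_top (ENNReal.pow_lt_top ?_))
  exact (summable_geometric_of_lt_one hr0.le hr1).tsum_ofReal_lt_top

lemma measurable_tsum_layerVar (hB : IsContBrownian B P) :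
    Measurable fun ω => ∑' n, layerVar hB n ω :=
  Measurable.tsum (measurable_layerVar hB)

lemma ae_tsum_layerVar_ne_top (hB : IsContBrownian B P) :
    ∀ᵐ ω ∂P, ∑' n, layerVar hB n ω ≠ ∞ := by
  have h := lintegral_tsum_layerVar_pow_lt_top hB le_rfl
  filter_upwards [ae_lt_top ((measurable_tsum_layerVar hB).pow_const _) h.ne] with ω hω hω'
  simp [hω'] at hω

lemma memLp_tsum_layerVar (hB : IsContBrownian B P) {p : ℝ≥0∞} (hp : p ≠ ∞) :
    MemLp (fun ω => 2 + (∑' n, layerVar hB n ω).toReal) p P := by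
  have := hB.isProbabilityMeasure
  exact (memLp_const (2 : ℝ)).add (memLp_toReal_of_lintegral_pow_lt_top
    (measurable_tsum_layerVar hB).aemeasurable
    (fun _ hm => lintegral_tsum_layerVar_pow_lt_top hB hm) hp)

/-- A bound of `layerApprox hB n ε ω` for `0 < ε ≤ 1`. -/
noncomputable def layerBound (hB : IsContBrownian B P) (n : ℕ) (ω : Ω) : ℝ :=
  (1 / 2) ^ n + (layerVar hB n ω).toReal

lemma abs_layerApprox_le (hB : IsContBrownian B P) {n : ℕ} {ω : Ω} (hω : layerVar hB n ω ≠ ∞)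
    {ε : ℝ} (hε : ε ∈ Set.Ioc (0 : ℝ) 1) : |layerApprox hB n ε ω| ≤ layerBound hB n ω :=
  ((exists_tendsto_and_abs_le (S := fun ε => layerApprox hB n ε ω)
    ((measurable_layerDeriv hB n).comp measurable_prodMk_left)
    (fun _ _ ha hab => layerApprox_sub hB n ha hab ω) hω).2 ε hε).trans
    (add_le_add_left (abs_layerApprox_one_le hB n ω) _)

lemma hasSum_layerBound (hB : IsContBrownian B P) {ω : Ω} (hω : ∑' n, layerVar hB n ω ≠ ∞) :
    HasSum (fun n => layerBound hB n ω) (2 + (∑' n, layerVar hB n ω).toReal) := by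
  refine hasSum_geometric_two.add ?_
  rw [ENNReal.tsum_toReal_eq fun n => ENNReal.ne_top_of_tsum_ne_top hω n]
  exact (ENNReal.summable_toReal hω).hasSum

end LeGallScheme

/-! ### Passage from the approximations to the local time derivatives -/

namespace LeGallScheme

variable {Ω Ω' : Type*} [MeasurableSpace Ω] [MeasurableSpace Ω'] {P : Measure Ω} {P' : Measure Ω'}

lemma ConvergesAEAndLp.ae_eq_localTimeDeriv {A : Set (ℝ × ℝ)} {X Y : ℝ≥0 → Ω → ℝ} {Z : Ω → ℝ}
    (h : ConvergesAEAndLp P (𝓝[>] 0) (localTimeDerivApprox A X Y) Z) :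
    localTimeDeriv A X Y =ᵐ[P] Z := by
  filter_upwards [h.1] with ω hω using hω.limUnder_eq

lemma ConvergesAEAndLp.localTimeDeriv {A : Set (ℝ × ℝ)} {X Y : ℝ≥0 → Ω → ℝ} {Z : Ω → ℝ}
    (h : ConvergesAEAndLp P (𝓝[>] 0) (localTimeDerivApprox A X Y) Z) :
    ConvergesAEAndLp P (𝓝[>] 0) (localTimeDerivApprox A X Y) (localTimeDeriv A X Y) :=
  h.congr (ae_of_all _ fun _ _ => rfl) h.ae_eq_localTimeDeriv.symm

lemma ConvergesAEAndLp.aemeasurable {ι : Type*} {l : Filter ι} {F : ι → Ω → ℝ} {Z : Ω → ℝ}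
    (h : ConvergesAEAndLp P l F Z) : AEMeasurable Z P :=
  (h.2 1 one_pos ENNReal.one_lt_top).2.1.1.aemeasurable

/-! ### Limits for continuous Brownian motions -/

section Continuous

variable {B : ℝ≥0 → Ω → ℝ} {B₁ B₂ : ℝ≥0 → Ω' → ℝ}

lemma convergesAEAndLp_dyadicSquare (hB : IsContBrownian B P) {n k : ℕ} (hk : 1 ≤ k) :
    ConvergesAEAndLp P (𝓝[>] 0) (localTimeDerivApprox (dyadicSquare n k) B B)
      (fun ω => ((2 : ℝ) ^ n)⁻¹ * squareLim (dyadicPaths hB n k ω)) := by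
  have := hB.isProbabilityMeasure
  have : IsProbabilityMeasure (P.map (toUnitPath B hB.cont)) :=
    Measure.isProbabilityMeasure_map (measurable_toUnitPath hB.meas hB.cont).aemeasurable
  exact convergesAEAndLp_of_eq_squareApprox hB.isWiener (measurable_dyadicPaths hB n k)
    (map_dyadicPaths hB hk) (by positivity)
    fun ε hε ω => localTimeDerivApprox_dyadicSquare hB hk hε ω

lemma dsltPiece_ae_eq (hB : IsContBrownian B P) {n k : ℕ} (hk : 1 ≤ k) :
    dsltPiece B n k =ᵐ[P] fun ω => ((2 : ℝ) ^ n)⁻¹ * squareLim (dyadicPaths hB n k ω) :=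
  (convergesAEAndLp_dyadicSquare hB hk).ae_eq_localTimeDeriv

lemma comap_toUnitPath_le {Ω : Type*} {B : ℝ≥0 → Ω → ℝ} (hc : ∀ ω, Continuous fun t => B t ω) :
    MeasurableSpace.comap (toUnitPath B hc) inferInstance ≤
      MeasurableSpace.comap (fun ω t => B t ω) inferInstance := by
  rw [← measurable_iff_comap_le]
  set Z := fun (ω : Ω) (t : ℝ≥0) => B t ω with hZ
  refine Measurable.subtype_mk (@measurable_pi_lambda _ _ _ (_) _ _ fun u => ?_)
  exact (measurable_pi_apply (unitInterval.toNNReal u)).comp (comap_measurable Z)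

lemma map_pair_toUnitPath (h₁ : IsContBrownian B₁ P') (h₂ : IsContBrownian B₂ P')
    (h₁₂ : IndepFun (fun ω t => B₁ t ω) (fun ω t => B₂ t ω) P') :
    P'.map (fun ω => (toUnitPath B₁ h₁.cont ω, toUnitPath B₂ h₂.cont ω)) =
      (P'.map (toUnitPath B₁ h₁.cont)).prod (P'.map (toUnitPath B₁ h₁.cont)) := by
  have := h₁.isProbabilityMeasure
  have m₁ := measurable_toUnitPath h₁.meas h₁.cont
  have m₂ := measurable_toUnitPath h₂.meas h₂.cont
  have hind : IndepFun (toUnitPath B₁ h₁.cont) (toUnitPath B₂ h₂.cont) P' := by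
    rw [IndepFun_iff_Indep]
    refine indep_of_indep_of_le ((IndepFun_iff_Indep _ _ _).1 h₁₂) ?_ ?_
    · exact comap_toUnitPath_le h₁.cont
    · exact comap_toUnitPath_le h₂.cont
  rw [(indepFun_iff_map_prod_eq_prod_map_map m₁.aemeasurable m₂.aemeasurable).1 hind,
    h₂.map_toUnitPath_eq h₁]

lemma convergesAEAndLp_unitSquare (h₁ : IsContBrownian B₁ P') (h₂ : IsContBrownian B₂ P')
    (h₁₂ : IndepFun (fun ω t => B₁ t ω) (fun ω t => B₂ t ω) P') :
    ConvergesAEAndLp P' (𝓝[>] 0) (localTimeDerivApprox unitSquare B₁ B₂)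
      (fun ω => squareLim (toUnitPath B₁ h₁.cont ω, toUnitPath B₂ h₂.cont ω)) := by
  have := h₁.isProbabilityMeasure
  have m₁ := measurable_toUnitPath h₁.meas h₁.cont
  have : IsProbabilityMeasure (P'.map (toUnitPath B₁ h₁.cont)) :=
    Measure.isProbabilityMeasure_map m₁.aemeasurable
  have := convergesAEAndLp_of_eq_squareApprox h₁.isWiener
    (m₁.prodMk (measurable_toUnitPath h₂.meas h₂.cont)) (map_pair_toUnitPath h₁ h₂ h₁₂)
    one_pos (F := localTimeDerivApprox unitSquare B₁ B₂) fun ε _ ω => by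
      rw [inv_one, one_mul, one_mul, localTimeDerivApprox_unitSquare h₁.cont h₂.cont]
  simpa using this

/-- Each piece is almost surely the same limit functional of its own pair of paths. That functional
is known to be measurable only up to null sets of the product law, which suffices for transporting
independence. -/
lemma iIndepFun_dsltPiece (hB : IsContBrownian B P) (n M : ℕ) :
    iIndepFun (fun k : Finset.Icc 1 M => dsltPiece B n k) P := by
  have := hB.isProbabilityMeasure
  have : IsProbabilityMeasure (P.map (toUnitPath B hB.cont)) :=
    Measure.isProbabilityMeasure_map (measurable_toUnitPath hB.meas hB.cont).aemeasurable
  have h := (iIndepFun_dyadicPaths hB n M).comp₀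
    (fun _ z => ((2 : ℝ) ^ n)⁻¹ * squareLim z)
    (fun k => (measurable_dyadicPaths hB n k).aemeasurable) fun k => by
      rw [map_dyadicPaths hB (Finset.mem_Icc.1 k.2).1]
      exact (aemeasurable_squareLim hB.isWiener).const_mul _
  exact h.congr fun k => (dsltPiece_ae_eq hB (Finset.mem_Icc.1 k.2).1).symm

lemma identDistrib_dsltPiece (hB : IsContBrownian B P) (h₁ : IsContBrownian B₁ P')
    (h₂ : IsContBrownian B₂ P') (h₁₂ : IndepFun (fun ω t => B₁ t ω) (fun ω t => B₂ t ω) P')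
    {n k : ℕ} (hk : 1 ≤ k) :
    IdentDistrib (dsltPiece B n k) (fun ω => ((2 : ℝ) ^ n)⁻¹ * dilt B₁ B₂ ω) P P' := by
  have := hB.isProbabilityMeasure
  have : IsProbabilityMeasure (P.map (toUnitPath B hB.cont)) :=
    Measure.isProbabilityMeasure_map (measurable_toUnitPath hB.meas hB.cont).aemeasurable
  have m := (measurable_toUnitPath h₁.meas h₁.cont).prodMk (measurable_toUnitPath h₂.meas h₂.cont)
  have hlaw : P.map (dyadicPaths hB n k) =
      P'.map (fun ω => (toUnitPath B₁ h₁.cont ω, toUnitPath B₂ h₂.cont ω)) := by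
    rw [map_dyadicPaths hB hk, map_pair_toUnitPath h₁ h₂ h₁₂, hB.map_toUnitPath_eq h₁]
  have hid : IdentDistrib (dyadicPaths hB n k)
      (fun ω => (toUnitPath B₁ h₁.cont ω, toUnitPath B₂ h₂.cont ω)) P P' :=
    ⟨(measurable_dyadicPaths hB n k).aemeasurable, m.aemeasurable, hlaw⟩
  have h := hid.comp_of_aemeasurable (u := fun z => ((2 : ℝ) ^ n)⁻¹ * squareLim z) (by
    rw [map_dyadicPaths hB hk]
    exact (aemeasurable_squareLim hB.isWiener).const_mul _)
  have hc := (convergesAEAndLp_unitSquare h₁ h₂ h₁₂)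
  refine ((IdentDistrib.of_ae_eq ?_ (dsltPiece_ae_eq hB hk)).trans h).trans
    (IdentDistrib.of_ae_eq ?_ ?_)
  · exact (convergesAEAndLp_dyadicSquare hB hk).localTimeDeriv.aemeasurable
  · exact (hc.aemeasurable.const_mul _)
  · filter_upwards [hc.ae_eq_localTimeDeriv] with ω hω
    simp only [Function.comp_apply, dilt, hω]

/-- The sum of the dyadic pieces of level `n + 1`. -/
noncomputable def layerSum (B : ℝ≥0 → Ω → ℝ) (n : ℕ) (ω : Ω) : ℝ :=
  ∑ k ∈ Finset.Icc 1 (2 ^ n), dsltPiece B (n + 1) k ω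

lemma sum_layerSum {Ω : Type*} (B : ℝ≥0 → Ω → ℝ) (N : ℕ) (ω : Ω) :
    ∑ n ∈ Finset.Icc 1 N, ∑ k ∈ Finset.Icc 1 (2 ^ (n - 1)), dsltPiece B n k ω =
      ∑ n ∈ Finset.range N, layerSum B n ω := by
  induction N with
  | zero => simp
  | succ N ih =>
    rw [Finset.sum_Icc_succ_top (by omega), Finset.sum_range_succ, ih, add_tsub_cancel_right]
    rfl

lemma aemeasurable_layerSum (hB : IsContBrownian B P) (n : ℕ) : AEMeasurable (layerSum B n) P :=
  Finset.aemeasurable_fun_sum _ fun _ hk =>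
    (convergesAEAndLp_dyadicSquare hB (Finset.mem_Icc.1 hk).1).localTimeDeriv.aemeasurable

lemma ae_tendsto_layerApprox (hB : IsContBrownian B P) :
    ∀ᵐ ω ∂P, ∀ n, Tendsto (fun ε => layerApprox hB n ε ω) (𝓝[>] 0) (𝓝 (layerSum B n ω)) := by
  have h : ∀ᵐ ω ∂P, ∀ n k : ℕ, 1 ≤ k →
      Tendsto (fun ε => localTimeDerivApprox (dyadicSquare n k) B B ε ω) (𝓝[>] 0)
        (𝓝 (dsltPiece B n k ω)) :=
    ae_all_iff.2 fun n => ae_all_iff.2 fun k => eventually_imp_distrib_left.2 fun hk =>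
      (convergesAEAndLp_dyadicSquare hB hk).localTimeDeriv.1
  filter_upwards [h] with ω hω n
  refine (tendsto_finsetSum _ fun k hk => hω (n + 1) k (Finset.mem_Icc.1 hk).1).congr' ?_
  filter_upwards [self_mem_nhdsWithin] with ε hε using (layerApprox_eq hB n hε ω).symm

lemma ae_abs_layerSum_le (hB : IsContBrownian B P) :
    ∀ᵐ ω ∂P, ∀ n, |layerSum B n ω| ≤ layerBound hB n ω := by
  filter_upwards [ae_tendsto_layerApprox hB, ae_tsum_layerVar_ne_top hB] with ω h1 h2 n
  refine le_of_tendsto (h1 n).abs ?_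
  filter_upwards [Ioc_mem_nhdsGT zero_lt_one] with ε hε
  exact abs_layerApprox_le hB (ENNReal.ne_top_of_tsum_ne_top h2 n) hε

lemma hasSum_layerApprox (hB : IsContBrownian B P) {ε : ℝ} (hε : 0 < ε) (ω : Ω) :
    HasSum (fun n => layerApprox hB n ε ω) (localTimeDerivApprox triangle B B ε ω) := by
  simp only [layerApprox_eq hB _ hε]
  refine hasSum_setIntegral_triangle ?_
  have h1 := hB.cont ω
  have h2 := continuous_heatKernelDeriv ε
  have h3 := continuous_real_toNNReal
  fun_prop

/-- For fixed `ε` the integral over the triangle is the sum of the layers. Each layer converges as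
`ε ↓ 0`, and `layerBound` is a summable bound uniform in `ε`, so limit and sum can be exchanged
pathwise. The total of the bounds has all moments and supplies the domination. -/
lemma convergesAEAndLp_triangle (hB : IsContBrownian B P) :
    ConvergesAEAndLp P (𝓝[>] 0) (localTimeDerivApprox triangle B B)
      (fun ω => ∑' n, layerSum B n ω) := by
  refine ConvergesAEAndLp.of_dominated (s := Set.Ioc 0 1) (Ioc_mem_nhdsGT zero_lt_one) ?_
    (fun p hp => memLp_tsum_layerVar hB hp) ?_ ?_
  · intro ε hε
    refine aestronglyMeasurable_of_tendsto_ae atTop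
      (f := fun N ω => ∑ n ∈ Finset.range N, layerApprox hB n ε ω)
      (fun N => (Finset.measurable_fun_sum _ fun n _ =>
        measurable_layerApprox hB n ε).aestronglyMeasurable)
      (ae_of_all _ fun ω => (hasSum_layerApprox hB hε.1 ω).tendsto_sum_nat)
  · filter_upwards [ae_tsum_layerVar_ne_top hB] with ω hω ε hε
    rw [← (hasSum_layerApprox hB hε.1 ω).tsum_eq, ← (hasSum_layerBound hB hω).tsum_eq]
    exact tsum_of_norm_bounded (f := fun n => layerApprox hB n ε ω) (hasSum_layerBound hB hω).summable.hasSum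
      fun n => abs_layerApprox_le hB (ENNReal.ne_top_of_tsum_ne_top hω n) hε
  · filter_upwards [ae_tsum_layerVar_ne_top hB, ae_tendsto_layerApprox hB] with ω hω h
    refine (tendsto_tsum_of_dominated_convergence (hasSum_layerBound hB hω).summable h ?_).congr' ?_
    · filter_upwards [Ioc_mem_nhdsGT zero_lt_one] with ε hε n
      exact abs_layerApprox_le hB (ENNReal.ne_top_of_tsum_ne_top hω n) hε
    · filter_upwards [self_mem_nhdsWithin] with ε hε using (hasSum_layerApprox hB hε ω).tsum_eq

/-- The bounds on the layers pass to their limits, so the same variable with all moments dominates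
every partial sum. The sum of the series is the limit already identified over the triangle. -/
lemma convergesAEAndLp_sum_dsltPiece (hB : IsContBrownian B P) :
    ConvergesAEAndLp P atTop
      (fun (N : ℕ) ω => ∑ n ∈ Finset.Icc 1 N, ∑ k ∈ Finset.Icc 1 (2 ^ (n - 1)), dsltPiece B n k ω)
      (dslt B) := by
  simp only [sum_layerSum]
  have h : ConvergesAEAndLp P atTop (fun (N : ℕ) ω => ∑ n ∈ Finset.range N, layerSum B n ω)
      (fun ω => ∑' n, layerSum B n ω) := by
    refine ConvergesAEAndLp.of_dominated univ_mem
      (fun N _ => (Finset.aemeasurable_fun_sum _ fun n _ =>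
        aemeasurable_layerSum hB n).aestronglyMeasurable)
      (fun p hp => memLp_tsum_layerVar hB hp) ?_ ?_
    · filter_upwards [ae_tsum_layerVar_ne_top hB, ae_abs_layerSum_le hB] with ω h1 h2 N _
      refine (Finset.abs_sum_le_sum_abs _ _).trans ((Finset.sum_le_sum fun n _ => h2 n).trans ?_)
      exact sum_le_hasSum _ (fun n _ => (abs_nonneg _).trans (h2 n)) (hasSum_layerBound hB h1)
    · filter_upwards [ae_tsum_layerVar_ne_top hB, ae_abs_layerSum_le hB] with ω h1 h2
      exact (Summable.of_norm_bounded (hasSum_layerBound hB h1).summable h2).hasSum.tendsto_sum_nat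
  exact h.congr (ae_of_all _ fun _ _ => rfl)
    (convergesAEAndLp_triangle hB).ae_eq_localTimeDeriv.symm

end Continuous

/-! ### Passage between indistinguishable processes -/

section Indistinguishable

variable {X X' Y Y' : ℝ≥0 → Ω → ℝ}

lemma ae_localTimeDerivApprox_eq (hX : ∀ᵐ ω ∂P, ∀ t, X t ω = X' t ω)
    (hY : ∀ᵐ ω ∂P, ∀ t, Y t ω = Y' t ω) (A : Set (ℝ × ℝ)) :
    ∀ᵐ ω ∂P, ∀ ε, localTimeDerivApprox A X Y ε ω = localTimeDerivApprox A X' Y' ε ω := by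
  filter_upwards [hX, hY] with ω h1 h2 ε
  simp only [localTimeDerivApprox, h1, h2]

lemma localTimeDeriv_ae_eq (hX : ∀ᵐ ω ∂P, ∀ t, X t ω = X' t ω)
    (hY : ∀ᵐ ω ∂P, ∀ t, Y t ω = Y' t ω) (A : Set (ℝ × ℝ)) :
    localTimeDeriv A X Y =ᵐ[P] localTimeDeriv A X' Y' := by
  filter_upwards [ae_localTimeDerivApprox_eq hX hY A] with ω h
  simp only [localTimeDeriv, h]

lemma convergesAEAndLp_localTimeDeriv_of_ae_eq (hX : ∀ᵐ ω ∂P, ∀ t, X t ω = X' t ω)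
    (hY : ∀ᵐ ω ∂P, ∀ t, Y t ω = Y' t ω) {A : Set (ℝ × ℝ)} {Z : Ω → ℝ}
    (h : ConvergesAEAndLp P (𝓝[>] 0) (localTimeDerivApprox A X' Y') Z) :
    ConvergesAEAndLp P (𝓝[>] 0) (localTimeDerivApprox A X Y) (localTimeDeriv A X Y) :=
  h.localTimeDeriv.congr
    ((ae_localTimeDerivApprox_eq hX hY A).mono fun _ h ε => (h ε).symm)
    (localTimeDeriv_ae_eq hX hY A).symm

end Indistinguishable

end LeGallScheme

/-! ### The theorem for general Brownian motions -/

theorem propositionB1 {Ω Ω' : Type*} [MeasurableSpace Ω] [MeasurableSpace Ω']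
    (P : Measure Ω) [IsProbabilityMeasure P] (P' : Measure Ω') [IsProbabilityMeasure P']
    (B : ℝ≥0 → Ω → ℝ) (hB : IsBrownianReal B P)
    (B₁ B₂ : ℝ≥0 → Ω' → ℝ) (hB₁ : IsBrownianReal B₁ P') (hB₂ : IsBrownianReal B₂ P')
    (hB₁₂ : IndepFun (fun ω t => B₁ t ω) (fun ω t => B₂ t ω) P') :
    -- the DSLT, its dyadic pieces and the DILT exist
    (LeGallScheme.ConvergesAEAndLp P (𝓝[>] (0 : ℝ))
        (LeGallScheme.localTimeDerivApprox LeGallScheme.triangle B B) (LeGallScheme.dslt B) ∧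
      (∀ n k : ℕ, 1 ≤ n → 1 ≤ k → k ≤ 2 ^ (n - 1) →
        LeGallScheme.ConvergesAEAndLp P (𝓝[>] (0 : ℝ))
          (LeGallScheme.localTimeDerivApprox (LeGallScheme.dyadicSquare n k) B B)
          (LeGallScheme.dsltPiece B n k)) ∧
      LeGallScheme.ConvergesAEAndLp P' (𝓝[>] (0 : ℝ))
        (LeGallScheme.localTimeDerivApprox LeGallScheme.unitSquare B₁ B₂)
        (LeGallScheme.dilt B₁ B₂)) ∧
    -- for each `n`, the pieces are mutually independent in `k`
    (∀ n : ℕ, 1 ≤ n →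
      iIndepFun (fun (k : Finset.Icc 1 (2 ^ (n - 1))) => LeGallScheme.dsltPiece B n (k : ℕ)) P) ∧
    -- each piece has the law of `2^{-n} L`
    (∀ n k : ℕ, 1 ≤ n → 1 ≤ k → k ≤ 2 ^ (n - 1) →
      IdentDistrib (LeGallScheme.dsltPiece B n k)
        (fun ω => ((2 : ℝ) ^ n)⁻¹ * LeGallScheme.dilt B₁ B₂ ω) P P') ∧
    -- the DSLT is the sum of the pieces, almost surely and in every `L^p`
    LeGallScheme.ConvergesAEAndLp P atTop
      (fun (N : ℕ) ω => ∑ n ∈ Finset.Icc 1 N, ∑ k ∈ Finset.Icc 1 (2 ^ (n - 1)),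
        LeGallScheme.dsltPiece B n k ω)
      (LeGallScheme.dslt B) := by
  -- Each Brownian motion is replaced by an indistinguishable one with all paths continuous. Almost
  -- surely, simultaneously in `ε`, the approximations agree, so every conclusion transfers back.
  open LeGallScheme in
  obtain ⟨C, hC, hBC⟩ := exists_isContBrownian hB
  obtain ⟨C₁, hC₁, hBC₁⟩ := exists_isContBrownian hB₁
  obtain ⟨C₂, hC₂, hBC₂⟩ := exists_isContBrownian hB₂
  have hC₁₂ : IndepFun (fun ω t => C₁ t ω) (fun ω t => C₂ t ω) P' :=
    hB₁₂.congr (hBC₁.mono fun _ h => funext h) (hBC₂.mono fun _ h => funext h)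
  have hpiece : ∀ n k, dsltPiece B n k =ᵐ[P] dsltPiece C n k := fun n k =>
    localTimeDeriv_ae_eq hBC hBC _
  have hdilt : dilt B₁ B₂ =ᵐ[P'] dilt C₁ C₂ := localTimeDeriv_ae_eq hBC₁ hBC₂ _
  have hconvPiece : ∀ n k : ℕ, 1 ≤ n → 1 ≤ k → k ≤ 2 ^ (n - 1) →
      ConvergesAEAndLp P (𝓝[>] (0 : ℝ)) (localTimeDerivApprox (dyadicSquare n k) B B)
        (dsltPiece B n k) := fun n k _ hk _ =>
    convergesAEAndLp_localTimeDeriv_of_ae_eq hBC hBC (convergesAEAndLp_dyadicSquare hC hk)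
  have hconvDilt : ConvergesAEAndLp P' (𝓝[>] (0 : ℝ)) (localTimeDerivApprox unitSquare B₁ B₂)
      (dilt B₁ B₂) :=
    convergesAEAndLp_localTimeDeriv_of_ae_eq hBC₁ hBC₂ (convergesAEAndLp_unitSquare hC₁ hC₂ hC₁₂)
  refine ⟨⟨?_, hconvPiece, hconvDilt⟩, ?_, ?_, ?_⟩
  · exact convergesAEAndLp_localTimeDeriv_of_ae_eq hBC hBC (convergesAEAndLp_triangle hC)
  · exact fun n _ => (iIndepFun_dsltPiece hC n _).congr fun k => (hpiece n k).symm
  · intro n k hn hk hk'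
    refine ((IdentDistrib.of_ae_eq (hconvPiece n k hn hk hk').aemeasurable (hpiece n k)).trans
      (identDistrib_dsltPiece hC hC₁ hC₂ hC₁₂ hk)).trans
      (IdentDistrib.of_ae_eq (hconvDilt.aemeasurable.const_mul _) ?_).symm
    filter_upwards [hdilt] with ω h
    rw [h]
  · refine (convergesAEAndLp_sum_dsltPiece hC).congr ?_ (localTimeDeriv_ae_eq hBC hBC _).symm
    filter_upwards [ae_all_iff.2 fun n => ae_all_iff.2 fun k => hpiece n k] with ω h N
    simp only [h]
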